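/- Let $\mathcal X$ be a set of keys and let $(x_0,v_0),\dots,(x_{m-1},v_{m-1})$ be a finite stream of elements with keys $x_i\in\mathcal X$ and weights $v_i>0$. The weight $w_x$ of a key $x$ is the sum of the weights of its elements; $x$ is active if it occurs in the stream. For $T>0$ let $\mathsf{cap}_T(y)=\min\{y,T\}$, and for $H\subseteq\mathcal X$ let $Q(\mathsf{cap}_T,H)=\sum_{x\in H}\mathsf{cap}_T(w_x)$. Let $\ell>0$ and let $k\ge 2$ be an integer. **Sampling (streaming fixed-$k$ continuous $\mathrm{SH}_\ell$).** Each key has a base hash $\mathrm{KeyBase}(x)$, uniform on $[0,1/\ell]$ and fixed throughout. All base hashes and all random numbers drawn below (each a fresh uniform number in $[0,1]$) are independent. Start with threshold $\tau=\infty$ and an empty set $S$ of cached keys, with $1/\infty=0$. For each element $(x,w)$ of the stream: - if $x\in S$, put $c_x\leftarrow c_x+w$; - otherwise draw $\rho$ and put $\Delta=-\ln(1-\rho)/\max\{\ell^{-1},\tau\}$. If $\Delta<w$ and ($\tau\ell>1$ or $\mathrm{KeyBase}(x)<\tau$), add $x$ to $S$ with $c_x\leftarrow w-\Delta$; if now $|S|=k+1$,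 evict a key. Eviction when $\tau\ell>1$: for each $x\in S$ draw $u_x,r_x$ and let $z_x=\min\{\tau u_x,-\ln(1-r_x)/c_x\}$, replacing $z_x$ by $\mathrm{KeyBase}(x)$ if $z_x\le \ell^{-1}$. Remove from $S$ a key $y$ with maximum $z_y$ and put $\tau^*=z_y$. For each remaining $x\in S$ with $u_x>\max\{\tau^*,\ell^{-1}\}/\tau$, decrease $c_x$ by $-\ln(1-r_x)/\max\{\tau^*,\ell^{-1}\}$. Then put $\tau\leftarrow\tau^*$. Eviction when $\tau\ell\le1$: remove from $S$ a key $y$ with maximum $\mathrm{KeyBase}(y)$ and put $\tau\leftarrow \mathrm{KeyBase}(y)$. **Estimator.** From the final $\tau$, $S$ and $(c_x)_{x\in S}$, the estimator of $Q(\mathsf{cap}_T,H)$ is $$\hat Q=\sum_{x\in H\cap S}\left(\frac{f(c_x)}{\min\{1,\ell\tau\}}+\frac{f'(c_x)}{\tau}\right),\qquad f=\mathsf{cap}_T .$$ **Theorem.** Suppose that $H$ contains an active key, and let $q=Q(\mathsf{cap}_T,H)/Q(\mathsf{cap}_T,\mathcal X)$, so that $q>0$. Then $\hat Q$ is square integrable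 with mean $Q(\mathsf{cap}_T,H)$, and its coefficient of variation (standard deviation divided by mean) satisfies $$\mathrm{CV}(\hat Q)\le\left(\frac{\frac{e}{e-1}\max\{1,\frac{\ell}{T}\}\left(\frac{\ell}{T}(1-e^{-T/\ell})+\frac{T}{\ell}\right)}{q(k-1)}\right)^{1/2}\le\left(\frac{\frac{e}{e-1}\left(1+\max\{\frac{\ell}{T},\frac{T}{\ell}\}\right)}{q(k-1)}\right)^{1/2}.$$ In particular, for $\ell=T$ the coefficient of variation is at most $\left(\frac{2e-1}{e-1}\cdot\frac{1}{q(k-1)}\right)^{1/2}$, where $\left|\left(\frac{2e-1}{e-1}\right)^{1/2}-1.6\right|<0.01$. -/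

import Mathlib

open MeasureTheory ProbabilityTheory
open scoped ENNReal

namespace ContSH

/-- The frequency cap function `cap_T(y) = min {y, T}`. -/
noncomputable def cap (T : ℝ) (y : ℝ) : ℝ := min y T

section Stream

variable {𝒳 : Type*} [DecidableEq 𝒳]

/-- The weight `w_x` of a key: the sum of the weights of all elements with key `x`
(so `w_x = 0` when no element has key `x`). -/
noncomputable def keyWeight (stream : List (𝒳 × ℝ)) (x : 𝒳) : ℝ :=
  ((stream.filter (fun e => e.1 = x)).map Prod.snd).sum

/-- The active keys: those that occur in at least one element. -/
def activeKeys (stream : List (𝒳 × ℝ)) : Finset 𝒳 := (stream.map Prod.fst).toFinset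

open Classical in
/-- The frequency statistics `Q(f, H) = ∑_{x ∈ 𝒳 ∩ H} f (w_x)`. As `f 0 = 0`, only active keys
contribute, and the sum is written over those. -/
noncomputable def freqStat (stream : List (𝒳 × ℝ)) (f : ℝ → ℝ) (H : Set 𝒳) : ℝ :=
  ∑ x ∈ activeKeys stream with x ∈ H, f (keyWeight stream x)

/-- The proportion `q = Q(f, H) / Q(f, 𝒳)` of the segment `H`. -/
noncomputable def proportion (stream : List (𝒳 × ℝ)) (f : ℝ → ℝ) (H : Set 𝒳) : ℝ :=
  freqStat stream f H / freqStat stream f Set.univ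

end Stream

/-- Names of the uniform random numbers used by the sampling algorithm: `hash x` is the value of
the random hash function at the key `x` (fixed throughout the computation), `entry i` is the
number drawn when the `i`-th stream element is considered for insertion, and `evictU i x`,
`evictR i x` are the numbers `u_x`, `r_x` drawn for the cached key `x` in the eviction step (if
any) triggered by the `i`-th stream element. Every call thus gets fresh randomness. -/
inductive RandCall (𝒳 : Type*) where
  | hash (x : 𝒳)
  | entry (i : ℕ)
  | evictU (i : ℕ) (x : 𝒳)
  | evictR (i : ℕ) (x : 𝒳)

/-- The state of the streaming algorithm: the current threshold `τ ∈ [0, ∞]`, the set of cached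
keys, and the counters `c_x` (meaningful for cached keys; `0` for other keys). -/
structure State (𝒳 : Type*) where
  τ : ℝ≥0∞
  keys : Finset 𝒳
  count : 𝒳 → ℝ

/-- `- ln (1 - ρ) / rate`, which is exponentially distributed with parameter `rate` when `ρ` is
uniform on `[0, 1]`. For `rate = ∞` the value is `0`. -/
noncomputable def expDraw (ρ : ℝ) (rate : ℝ≥0∞) : ℝ :=
  (ENNReal.ofReal (-Real.log (1 - ρ)) / rate).toReal

section Algorithm

variable {𝒳 : Type*} [DecidableEq 𝒳]

/-- `KeyBase(x) = Hash(x) / ℓ`. -/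
noncomputable def keyBase (ℓ : ℝ) (ρ : RandCall 𝒳 → ℝ) (x : 𝒳) : ℝ≥0∞ :=
  ENNReal.ofReal (ρ (.hash x) / ℓ)

/-- A key of the nonempty set `S` at which `z` is maximum. -/
noncomputable def argmaxKey (S : Finset 𝒳) (hS : S.Nonempty) (z : 𝒳 → ℝ≥0∞) : 𝒳 :=
  (S.exists_max_image z hS).choose

/-- The eviction threshold `z_x` of a cached key, when the current threshold exceeds `1/ℓ`. -/
noncomputable def evictionThreshold (ℓ : ℝ) (ρ : RandCall 𝒳 → ℝ) (i : ℕ) (s : State 𝒳)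
    (x : 𝒳) : ℝ≥0∞ :=
  let z := min (s.τ * ENNReal.ofReal (ρ (.evictU i x)))
    (ENNReal.ofReal (-Real.log (1 - ρ (.evictR i x))) / ENNReal.ofReal (s.count x))
  if z ≤ ENNReal.ofReal ℓ⁻¹ then keyBase ℓ ρ x else z

/-- The eviction step: one cached key is removed and the threshold is lowered. -/
noncomputable def evict (ℓ : ℝ) (ρ : RandCall 𝒳 → ℝ) (i : ℕ) (s : State 𝒳)
    (hs : s.keys.Nonempty) : State 𝒳 :=
  if 1 < s.τ * ENNReal.ofReal ℓ then
    let z := evictionThreshold ℓ ρ i s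
    let y := argmaxKey s.keys hs z
    let τ' := z y
    let rate := max τ' (ENNReal.ofReal ℓ⁻¹)
    { τ := τ'
      keys := s.keys.erase y
      count := fun x =>
        if x ∈ s.keys.erase y then
          if rate / s.τ < ENNReal.ofReal (ρ (.evictU i x)) then
            s.count x - expDraw (ρ (.evictR i x)) rate
          else s.count x
        else 0 }
  else
    let y := argmaxKey s.keys hs (keyBase ℓ ρ)
    { τ := keyBase ℓ ρ y
      keys := s.keys.erase y
      count := Function.update s.count y 0 }

/-- Processing of the `i`-th stream element `e = (x, w)`. -/
noncomputable def step (k : ℕ) (ℓ : ℝ) (ρ : RandCall 𝒳 → ℝ) (s : State 𝒳)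
    (e : 𝒳 × ℝ) (i : ℕ) : State 𝒳 :=
  if e.1 ∈ s.keys then
    { s with count := Function.update s.count e.1 (s.count e.1 + e.2) }
  else
    let Δ := expDraw (ρ (.entry i)) (max (ENNReal.ofReal ℓ⁻¹) s.τ)
    if Δ < e.2 ∧ (1 < s.τ * ENNReal.ofReal ℓ ∨
        (s.τ * ENNReal.ofReal ℓ ≤ 1 ∧ keyBase ℓ ρ e.1 < s.τ)) then
      let s' : State 𝒳 :=
        { τ := s.τ
          keys := insert e.1 s.keys
          count := Function.update s.count e.1 (e.2 - Δ) }
      if s'.keys.card = k + 1 then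
        evict ℓ ρ i s' (Finset.insert_nonempty e.1 s.keys)
      else s'
    else s

/-- The streaming fixed-`k` continuous SH_ℓ sampling algorithm: the final state after one pass
over the stream, as a function of the random numbers. It starts with an empty cache and
threshold `∞`. -/
noncomputable def sample (k : ℕ) (ℓ : ℝ) (stream : List (𝒳 × ℝ)) (ρ : RandCall 𝒳 → ℝ) :
    State 𝒳 :=
  stream.zipIdx.foldl (fun s ei => step k ℓ ρ s ei.1 ei.2)
    { τ := ⊤, keys := ∅, count := fun _ => 0 }

/-- The estimation coefficient `β^{(f,τ,ℓ)}(c) = f(c) / min{1, ℓτ} + f'(c) / τ`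
(with `1/τ = 0` for `τ = ∞`). -/
noncomputable def beta (f : ℝ → ℝ) (τ : ℝ≥0∞) (ℓ : ℝ) (c : ℝ) : ℝ :=
  f c / (min 1 (ENNReal.ofReal ℓ * τ)).toReal + deriv f c * (τ⁻¹).toReal

open Classical in
/-- The estimator `∑_{x ∈ H ∩ S} β^{(f,τ,ℓ)}(c_x)` of `Q(f, H)`, computed from the sample. -/
noncomputable def estimator (f : ℝ → ℝ) (ℓ : ℝ) (H : Set 𝒳) (s : State 𝒳) : ℝ :=
  ∑ x ∈ s.keys with x ∈ H, beta f s.τ ℓ (s.count x)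

end Algorithm

/-- The coefficient of variation: standard deviation divided by mean. -/
noncomputable def cv {Ω : Type*} [MeasurableSpace Ω] (P : Measure Ω) (X : Ω → ℝ) : ℝ :=
  √(variance X P) / ∫ ω, X ω ∂P

end ContSH

/-! Write t = 1/τ and p = min{1, ℓτ}, so that a cached key with counter c contributes f(c)/p +
f'(c)t. Everything rests on one identity, `integral_prod_sampleEst`: if B has at most k keys and
each g_x vanishes at 0 and is regular enough (`IsTest`), then the product over B of g_x(c_x)/p +
g_x'(c_x)t, read as 0 for uncached x, has expectation ∏ g_x(w_x). Thus contributions of single keys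
are unbiased and those of distinct keys are uncorrelated, although the threshold depends on all keys
at once.

The identity separates two sources of randomness. The relaxed process ignores the base hashes and
evicts nothing once its level 1/max{τ, 1/ℓ} has reached ℓ. Its products have the right expectation
for every B (`integral_prod_relEst_relaxed`): in an eviction the new level may be replaced by the
one determined by the keys outside B, which is independent of the numbers drawn for the keys of B,
and then each key averages out by itself. Almost surely the real sample is the relaxed one or, at
level ℓ, its k cached keys of smallest hash (`ae_coupled`). This last selection is undone by inverse
probability weights whose threshold is again read off the keys outside B
(`integral_mul_prod_hashWeight`).

For the variance only the second moment of each contribution is needed. Pathwise, its square is at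
most the estimate of f² plus t times the estimate of `varBound` composed with f. The factor t is
controlled by the other keys: unless t = 0, there are k − 1 other cached keys, and the `expSat`
estimate of each is at least t (`Coupled.sq_sampleEst_le`). Only products over two distinct keys
remain, and the identity evaluates them. Linear bounds of `varBound` and `expSat` by the cap
function finish the proof. The constant e/(e − 1) is slack: only that it is at least 1 is used. -/

namespace ContSH

set_option linter.unusedSectionVars false

/-! ### Redrawing coordinates of a product measure. -/

section Resampling

variable {ι : Type*} [DecidableEq ι] {α : Type*} [MeasurableSpace α]

theorem measurable_update_prod (c : ι) :
    Measurable (fun p : (ι → α) × α => Function.update p.1 c p.2) := by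
  refine measurable_pi_lambda _ fun i => ?_
  by_cases h : i = c
  · subst h; simpa using measurable_snd
  · simp only [Function.update_of_ne h]
    exact (measurable_pi_apply i).comp measurable_fst

/-- On a finite box the coordinate `c` is constrained through the fresh draw and the others through
the old point, so the measures of boxes agree. This is the form in which independence is used
throughout. -/
theorem map_update_infinitePi (ν : Measure α) [IsProbabilityMeasure ν] (c : ι) :
    ((Measure.infinitePi fun _ : ι => ν).prod ν).map
      (fun p => Function.update p.1 c p.2) = Measure.infinitePi fun _ : ι => ν := by
  refine Measure.eq_infinitePi (μ := fun _ : ι => ν) fun s t ht => ?_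
  rw [Measure.map_apply (measurable_update_prod c)
    (MeasurableSet.pi s.countable_toSet fun i _ => ht i)]
  by_cases hc : c ∈ s
  · have : (fun p : (ι → α) × α => Function.update p.1 c p.2) ⁻¹' (Set.pi s t) =
        (Set.pi (s.erase c : Finset ι) t) ×ˢ t c := by
      ext ⟨f, a⟩
      simp only [Set.mem_preimage, Set.mem_pi, Set.mem_prod, Finset.mem_coe, Finset.mem_erase]
      constructor
      · intro h
        refine ⟨fun i hi => ?_, by simpa using h c hc⟩
        simpa [Function.update_of_ne hi.1] using h i hi.2
      · rintro ⟨h1, h2⟩ i hi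
        by_cases hic : i = c
        · subst hic; simpa using h2
        · simpa [Function.update_of_ne hic] using h1 i ⟨hic, hi⟩
    rw [this, Measure.prod_prod, Measure.infinitePi_pi _ fun i _ => ht i, mul_comm,
      Finset.mul_prod_erase s (fun i => ν (t i)) hc]
  · have : (fun p : (ι → α) × α => Function.update p.1 c p.2) ⁻¹' (Set.pi s t) =
        (Set.pi (s : Set ι) t) ×ˢ Set.univ := by
      ext ⟨f, a⟩
      simp only [Set.mem_preimage, Set.mem_pi, Set.mem_prod, Finset.mem_coe, Set.mem_univ,
        and_true]
      refine forall₂_congr fun i hi => ?_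
      have hic : i ≠ c := fun h => hc (h ▸ hi)
      rw [Function.update_of_ne hic]
    rw [this, Measure.prod_prod, Measure.infinitePi_pi _ fun i _ => ht i]
    simp

theorem lintegral_resample (ν : Measure α) [IsProbabilityMeasure ν] (c : ι)
    {F : (ι → α) → ℝ≥0∞} (hF : Measurable F) :
    ∫⁻ ρ, F ρ ∂(Measure.infinitePi fun _ : ι => ν) =
      ∫⁻ ρ, ∫⁻ u, F (Function.update ρ c u) ∂ν ∂(Measure.infinitePi fun _ : ι => ν) := by
  conv_lhs => rw [← map_update_infinitePi ν c]
  have hm : Measurable fun p : (ι → α) × α => F (Function.update p.1 c p.2) :=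
    hF.comp (measurable_update_prod c)
  rw [lintegral_map hF (measurable_update_prod c), lintegral_prod _ hm.aemeasurable]

theorem integrable_of_measurable_bounded {β : Type*} [MeasurableSpace β] {μ : Measure β}
    [IsFiniteMeasure μ] {F : β → ℝ} (hF : Measurable F) (hb : ∃ K, ∀ x, |F x| ≤ K) :
    Integrable F μ := by
  obtain ⟨K, hK⟩ := hb
  exact Integrable.of_bound hF.aestronglyMeasurable K (Filter.Eventually.of_forall hK)

theorem integral_resample (ν : Measure α) [IsProbabilityMeasure ν] (c : ι)
    {F : (ι → α) → ℝ} (hF : Measurable F) (hb : ∃ K, ∀ ρ, |F ρ| ≤ K) :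
    ∫ ρ, F ρ ∂(Measure.infinitePi fun _ : ι => ν) =
      ∫ ρ, ∫ u, F (Function.update ρ c u) ∂ν ∂(Measure.infinitePi fun _ : ι => ν) := by
  conv_lhs => rw [← map_update_infinitePi ν c]
  have hm : Measurable fun p : (ι → α) × α => F (Function.update p.1 c p.2) :=
    hF.comp (measurable_update_prod c)
  rw [integral_map (measurable_update_prod c).aemeasurable hF.aestronglyMeasurable,
    integral_prod]
  exact integrable_of_measurable_bounded hm (hb.imp fun K hK p => hK _)

theorem integral_resample_pair (ν : Measure α) [IsProbabilityMeasure ν] (c d : ι)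
    {F : (ι → α) → ℝ} (hF : Measurable F) (hb : ∃ K, ∀ ρ, |F ρ| ≤ K) :
    ∫ ρ, F ρ ∂(Measure.infinitePi fun _ : ι => ν) =
      ∫ ρ, ∫ u, ∫ r, F (Function.update (Function.update ρ c u) d r) ∂ν ∂ν
        ∂(Measure.infinitePi fun _ : ι => ν) := by
  rw [integral_resample ν d hF hb]
  have hm' : Measurable (Function.uncurry fun (ρ : ι → α) r => F (Function.update ρ d r)) :=
    hF.comp (measurable_update_prod d)
  have hm : Measurable fun ρ : ι → α => ∫ r, F (Function.update ρ d r) ∂ν :=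
    (hm'.stronglyMeasurable.integral_prod_right (ν := ν)).measurable
  refine integral_resample ν c hm ?_
  obtain ⟨K, hK⟩ := hb
  refine ⟨K, fun ρ => ?_⟩
  simpa using norm_integral_le_of_norm_le_const (μ := ν)
    (f := fun r => F (Function.update ρ d r)) (Filter.Eventually.of_forall fun r => hK _)

theorem ae_resample (ν : Measure α) [IsProbabilityMeasure ν] (c : ι) {p : (ι → α) → Prop}
    (hp : MeasurableSet {ρ | p ρ}) (h : ∀ ρ, ∀ᵐ u ∂ν, p (Function.update ρ c u)) :
    ∀ᵐ ρ ∂(Measure.infinitePi fun _ : ι => ν), p ρ := by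
  rw [← map_update_infinitePi ν c, ae_map_iff (measurable_update_prod c).aemeasurable hp]
  have hm : MeasurableSet {q : (ι → α) × α | p (Function.update q.1 c q.2)} :=
    (measurable_update_prod c) hp
  exact (Measure.ae_prod_iff_ae_ae hm).2 (Filter.Eventually.of_forall h)

/-- The factor of each key depends on its own coordinates `c x`, `d x` and on data that no key of
`B` influences, so the factors may be averaged one after another. The weight `Z` is general in order
that the induction can absorb into it a factor not yet averaged. -/
theorem integral_mul_prod_resample {κ : Type*} (ν : Measure α) [IsProbabilityMeasure ν]
    (c d : κ → ι) (B : Finset κ) (Z : (ι → α) → ℝ) (φ ψ : κ → (ι → α) → ℝ)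
    (hZ : Measurable Z) (hZb : ∃ K, ∀ ρ, |Z ρ| ≤ K)
    (hφ : ∀ x ∈ B, Measurable (φ x)) (hφb : ∀ x ∈ B, ∃ K, ∀ ρ, |φ x ρ| ≤ K)
    (hψ : ∀ x ∈ B, Measurable (ψ x)) (hψb : ∀ x ∈ B, ∃ K, ∀ ρ, |ψ x ρ| ≤ K)
    (havg : ∀ x ∈ B, ∀ ρ,
      ∫ u, ∫ r, φ x (Function.update (Function.update ρ (c x) u) (d x) r) ∂ν ∂ν = ψ x ρ)
    (hinvφ : ∀ x ∈ B, ∀ y ∈ B, y ≠ x → ∀ ρ u r,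
      φ y (Function.update (Function.update ρ (c x) u) (d x) r) = φ y ρ)
    (hinvψ : ∀ x ∈ B, ∀ y ∈ B, y ≠ x → ∀ ρ u r,
      ψ y (Function.update (Function.update ρ (c x) u) (d x) r) = ψ y ρ)
    (hinvZ : ∀ x ∈ B, ∀ ρ u r,
      Z (Function.update (Function.update ρ (c x) u) (d x) r) = Z ρ) :
    ∫ ρ, Z ρ * ∏ x ∈ B, φ x ρ ∂(Measure.infinitePi fun _ : ι => ν) =
      ∫ ρ, Z ρ * ∏ x ∈ B, ψ x ρ ∂(Measure.infinitePi fun _ : ι => ν) := by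
  classical
  induction B using Finset.induction_on generalizing Z with
  | empty => simp
  | insert x B hx ih =>
    have hne : ∀ y ∈ B, y ≠ x := fun y hy h => hx (h ▸ hy)
    have hmul : ∀ {f g : (ι → α) → ℝ}, (∃ K, ∀ ρ, |f ρ| ≤ K) → (∃ K, ∀ ρ, |g ρ| ≤ K) →
        ∃ K, ∀ ρ, |f ρ * g ρ| ≤ K := by
      rintro f g ⟨K, hK⟩ ⟨L, hL⟩
      refine ⟨K * L, fun ρ => ?_⟩
      rw [abs_mul]
      exact mul_le_mul (hK ρ) (hL ρ) (abs_nonneg _) ((abs_nonneg _).trans (hK ρ))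
    have hxB := Finset.mem_insert_self x B
    have hBx : ∀ {y}, y ∈ B → y ∈ insert x B := fun h => Finset.mem_insert_of_mem h
    have hprodb : ∃ K, ∀ ρ, |∏ y ∈ B, ψ y ρ| ≤ K := by
      have : ∀ C ⊆ B, ∃ K, ∀ ρ, |∏ y ∈ C, ψ y ρ| ≤ K := by
        intro C
        induction C using Finset.induction_on with
        | empty => exact fun _ => ⟨1, by simp⟩
        | insert y C hy ihC =>
          intro hC
          simp only [Finset.prod_insert hy]
          exact hmul (hψb y (hBx (hC (Finset.mem_insert_self y C))))
            (ihC ((Finset.subset_insert y C).trans hC))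
      exact this B subset_rfl
    calc ∫ ρ, Z ρ * ∏ y ∈ insert x B, φ y ρ ∂(Measure.infinitePi fun _ : ι => ν)
        = ∫ ρ, (Z ρ * φ x ρ) * ∏ y ∈ B, φ y ρ ∂(Measure.infinitePi fun _ : ι => ν) := by
          simp only [Finset.prod_insert hx, mul_assoc]
      _ = ∫ ρ, (Z ρ * φ x ρ) * ∏ y ∈ B, ψ y ρ ∂(Measure.infinitePi fun _ : ι => ν) := by
          refine ih (fun ρ => Z ρ * φ x ρ) (hZ.mul (hφ x hxB)) (hmul hZb (hφb x hxB))
            (fun y hy => hφ y (hBx hy)) (fun y hy => hφb y (hBx hy))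
            (fun y hy => hψ y (hBx hy)) (fun y hy => hψb y (hBx hy))
            (fun y hy => havg y (hBx hy)) (fun y hy z hz => hinvφ y (hBx hy) z (hBx hz))
            (fun y hy z hz => hinvψ y (hBx hy) z (hBx hz)) ?_
          intro y hy ρ u r
          rw [hinvZ y (hBx hy), hinvφ y (hBx hy) x hxB (hne y hy).symm]
      _ = ∫ ρ, Z ρ * ∏ y ∈ insert x B, ψ y ρ ∂(Measure.infinitePi fun _ : ι => ν) := by
          have hm : Measurable fun ρ => Z ρ * φ x ρ * ∏ y ∈ B, ψ y ρ :=
            (hZ.mul (hφ x hxB)).mul (Finset.measurable_fun_prod B fun y hy => hψ y (hBx hy))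
          rw [integral_resample_pair ν (c x) (d x) hm
            (hmul (hmul hZb (hφb x hxB)) hprodb)]
          refine integral_congr_ae (Filter.Eventually.of_forall fun ρ => ?_)
          have h1 : ∀ u r, ∏ y ∈ B,
              ψ y (Function.update (Function.update ρ (c x) u) (d x) r) = ∏ y ∈ B, ψ y ρ :=
            fun u r => Finset.prod_congr rfl fun y hy =>
              hinvψ x hxB y (hBx hy) (hne y hy) ρ u r
          simp only [h1, hinvZ x hxB, Finset.prod_insert hx, integral_mul_const,
            integral_const_mul, havg x hxB]
          ring

/-- The version for the hash weights: they are nonnegative but unbounded, so it is stated in `ℝ≥0∞`,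
where no integrability is required. -/
theorem lintegral_mul_prod_resample {κ : Type*} (ν : Measure α) [IsProbabilityMeasure ν]
    (c : κ → ι) (B : Finset κ) (Z : (ι → α) → ℝ≥0∞) (φ : κ → (ι → α) → ℝ≥0∞)
    (hZ : Measurable Z) (hφ : ∀ x ∈ B, Measurable (φ x))
    (havg : ∀ x ∈ B, ∀ ρ, ∫⁻ u, φ x (Function.update ρ (c x) u) ∂ν = 1)
    (hinvφ : ∀ x ∈ B, ∀ y ∈ B, y ≠ x → ∀ ρ u, φ y (Function.update ρ (c x) u) = φ y ρ)
    (hinvZ : ∀ x ∈ B, ∀ ρ u, Z (Function.update ρ (c x) u) = Z ρ) :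
    ∫⁻ ρ, Z ρ * ∏ x ∈ B, φ x ρ ∂(Measure.infinitePi fun _ : ι => ν) =
      ∫⁻ ρ, Z ρ ∂(Measure.infinitePi fun _ : ι => ν) := by
  classical
  induction B using Finset.induction_on with
  | empty => simp
  | insert x B hx ih =>
    have hne : ∀ y ∈ B, y ≠ x := fun y hy h => hx (h ▸ hy)
    have hxB := Finset.mem_insert_self x B
    have hBx : ∀ {y}, y ∈ B → y ∈ insert x B := fun h => Finset.mem_insert_of_mem h
    rw [← ih (fun y hy => hφ y (hBx hy)) (fun y hy => havg y (hBx hy))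
      (fun y hy z hz => hinvφ y (hBx hy) z (hBx hz)) (fun y hy => hinvZ y (hBx hy))]
    have hm : Measurable fun ρ => Z ρ * ∏ y ∈ insert x B, φ y ρ :=
      hZ.mul (Finset.measurable_fun_prod (insert x B) fun y hy => hφ y hy)
    rw [lintegral_resample ν (c x) hm]
    refine lintegral_congr fun ρ => ?_
    have h1 : ∀ u, ∏ y ∈ B, φ y (Function.update ρ (c x) u) = ∏ y ∈ B, φ y ρ :=
      fun u => Finset.prod_congr rfl fun y hy => hinvφ x hxB y (hBx hy) (hne y hy) ρ u
    have hm : Measurable fun u => φ x (Function.update ρ (c x) u) :=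
      (hφ x hxB).comp (measurable_update ρ)
    simp only [Finset.prod_insert hx, h1, hinvZ x hxB]
    rw [lintegral_const_mul _ (hm.mul_const _), lintegral_mul_const _ hm, havg x hxB, one_mul]

end Resampling

/-! ### Uniform and exponential draws. -/

/-- The range of a generic uniform random number. -/
abbrev UnitOpen : Type := Set.Ioo (0 : ℝ) 1

/-- The uniform distribution on `(0, 1)`. -/
noncomputable def unitMeasure : Measure UnitOpen := Measure.comap Subtype.val volume

instance : IsProbabilityMeasure unitMeasure := by
  constructor
  rw [unitMeasure, comap_subtype_coe_apply measurableSet_Ioo, Set.image_univ,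
    Subtype.range_coe]
  simp

theorem integral_unitOpen (f : ℝ → ℝ) :
    ∫ u : UnitOpen, f u ∂unitMeasure = ∫ u in (0 : ℝ)..1, f u := by
  rw [intervalIntegral.integral_of_le zero_le_one, integral_Ioc_eq_integral_Ioo]
  exact integral_subtype_comap measurableSet_Ioo f

theorem lintegral_unitOpen (f : ℝ → ℝ≥0∞) :
    ∫⁻ u : UnitOpen, f u ∂unitMeasure = ∫⁻ u in Set.Ioo (0 : ℝ) 1, f u :=
  lintegral_subtype_comap measurableSet_Ioo f

theorem ae_unitOpen_ne (a : ℝ) : ∀ᵐ u : UnitOpen ∂unitMeasure, (u : ℝ) ≠ a := by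
  have : ∀ᵐ u : ℝ ∂(volume.restrict (Set.Ioo (0 : ℝ) 1)), u ≠ a :=
    ae_restrict_of_ae (by simp [ae_iff])
  exact (ae_restrict_iff_subtype (p := fun u : ℝ => u ≠ a) measurableSet_Ioo).1 this

/-- The standard exponential variable obtained from a uniform number by inversion. -/
noncomputable def stdExp (u : ℝ) : ℝ := -Real.log (1 - u)

theorem measurable_stdExp : Measurable stdExp := by
  unfold stdExp; fun_prop

theorem stdExp_pos (u : UnitOpen) : 0 < stdExp u := by
  have := u.2.1; have := u.2.2
  exact neg_pos.2 (Real.log_neg (by linarith) (by linarith))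

theorem stdExp_eq_iff (u : UnitOpen) (a : ℝ) : stdExp u = a ↔ (u : ℝ) = 1 - Real.exp (-a) := by
  have := u.2.2
  unfold stdExp
  have h1 : 0 < 1 - (u : ℝ) := by linarith
  constructor
  · intro h
    rw [← h, neg_neg, Real.exp_log h1]; ring
  · intro h
    rw [h, sub_sub_cancel, Real.log_exp, neg_neg]

/-! ### Unbiasedness for a single key. -/

/-- A function `g` vanishing at `0`, with derivative `g'` off a countable set, for which the
counters give unbiased estimates. -/
structure IsTest (g g' : ℝ → ℝ) : Prop where
  zero : g 0 = 0
  cont : Continuous g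
  meas : Measurable g'
  bdd : ∃ K, ∀ c, 0 ≤ c → |g' c| ≤ K
  deriv : ∃ D : Set ℝ, D.Countable ∧ ∀ c, 0 < c → c ∉ D → HasDerivAt g (g' c) c

/-- An element of weight `w` at a cached key shifts its counter by `w`; subtracting `g w` restores
the value 0 at 0, so the class of test functions is stable under arrivals. -/
theorem IsTest.shift {g g' : ℝ → ℝ} (h : IsTest g g') {w : ℝ} (hw : 0 ≤ w) :
    IsTest (fun c => g (c + w) - g w) (fun c => g' (c + w)) := by
  obtain ⟨K, hK⟩ := h.bdd
  obtain ⟨D, hD, hd⟩ := h.deriv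
  refine ⟨by simp, ?_, ?_, ⟨K, fun c hc => hK _ (by linarith)⟩, (· + w) ⁻¹' D,
    hD.preimage (add_left_injective w), fun c hc hcD => ?_⟩
  · have := h.cont; fun_prop
  · have := h.meas; fun_prop
  · exact ((hd (c + w) (by linarith) hcD).comp_add_const c w).sub_const _

/-- Where the counter is positive, the integrand is the derivative of −(1 − u) g(c − m·`stdExp u`).
The boundary term at u = 0 is g(c), and the one where the counter reaches 0 vanishes because g(0) =
0. -/
theorem integral_entry {g g' : ℝ → ℝ} (h : IsTest g g') {m c : ℝ} (hm : 0 ≤ m) (hc : 0 < c) :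
    ∫ u : UnitOpen, (if 0 < c - stdExp u * m then
      g (c - stdExp u * m) + m * g' (c - stdExp u * m) else 0) ∂unitMeasure = g c := by
  rcases hm.eq_or_lt with rfl | hm
  · simp [hc]
  rw [integral_unitOpen (fun u => if 0 < c - stdExp u * m then
      g (c - stdExp u * m) + m * g' (c - stdExp u * m) else 0)]
  -- At `u = b` the exponential draw times `m` equals `c`; from there on the key is not cached and
  -- the integrand is zero.
  set b : ℝ := 1 - Real.exp (-(c / m)) with hb
  have hcm : 0 < c / m := div_pos hc hm
  have hb0 : 0 < b := by
    have : Real.exp (-(c / m)) < 1 := by rw [Real.exp_lt_one_iff]; linarith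
    linarith
  have hb1 : b < 1 := by have := Real.exp_pos (-(c / m)); linarith
  have hlt : ∀ u, u < 1 → (0 < c - stdExp u * m ↔ u < b) := by
    intro u hu
    have h1 : 0 < 1 - u := by linarith
    have : 0 < c - stdExp u * m ↔ -(c / m) < Real.log (1 - u) := by
      rw [neg_lt, lt_div_iff₀ hm, sub_pos]; rfl
    rw [this, Real.lt_log_iff_exp_lt h1, hb]
    constructor <;> intro h <;> linarith
  obtain ⟨K, hK⟩ := h.bdd
  obtain ⟨D, hD, hd⟩ := h.deriv
  obtain ⟨L, hL⟩ := isCompact_Icc.exists_bound_of_continuousOn (s := Set.Icc 0 c)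
    h.cont.continuousOn
  have hmeas : Measurable fun u : ℝ => if 0 < c - stdExp u * m then
      g (c - stdExp u * m) + m * g' (c - stdExp u * m) else 0 := by
    have h1 : Measurable fun u : ℝ => c - stdExp u * m := by
      have := measurable_stdExp; fun_prop
    exact Measurable.ite (measurableSet_lt measurable_const h1)
      ((h.cont.measurable.comp h1).add ((h.meas.comp h1).const_mul m)) measurable_const
  have hint : ∀ p q : ℝ, 0 ≤ p → p ≤ q → q ≤ 1 →
      IntervalIntegrable (fun u : ℝ => if 0 < c - stdExp u * m then
        g (c - stdExp u * m) + m * g' (c - stdExp u * m) else 0) volume p q := by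
    intro p q hp hpq hq
    rw [intervalIntegrable_iff_integrableOn_Ioo_of_le hpq]
    refine Integrable.of_bound hmeas.aestronglyMeasurable (L + m * K) ?_
    refine (ae_restrict_mem measurableSet_Ioo).mono fun u hu => ?_
    have hu0 : 0 < u := lt_of_le_of_lt hp hu.1
    have hu1 : u < 1 := lt_of_lt_of_le hu.2 hq
    have hE := stdExp_pos ⟨u, hu0, hu1⟩
    simp only at hE
    have hKn : 0 ≤ K := (abs_nonneg _).trans (hK 0 le_rfl)
    have hLn : 0 ≤ L := (norm_nonneg _).trans (hL 0 ⟨le_rfl, hc.le⟩)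
    split_ifs with hpos
    · have h1 := hL (c - stdExp u * m) ⟨hpos.le, by nlinarith⟩
      have h2 := hK _ hpos.le
      calc ‖_‖ ≤ ‖g (c - stdExp u * m)‖ + ‖m * g' (c - stdExp u * m)‖ := norm_add_le _ _
        _ ≤ L + m * K := by
          refine add_le_add h1 ?_
          rw [Real.norm_eq_abs, abs_mul, abs_of_pos hm]
          gcongr
    · simp; positivity
  rw [← intervalIntegral.integral_add_adjacent_intervals (hint 0 b le_rfl hb0.le hb1.le)
    (hint b 1 hb0.le hb1.le le_rfl)]
  have hz : ∫ u in b..1, (if 0 < c - stdExp u * m then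
      g (c - stdExp u * m) + m * g' (c - stdExp u * m) else 0) = 0 := by
    rw [intervalIntegral.integral_of_le hb1.le, integral_Ioc_eq_integral_Ioo]
    refine setIntegral_eq_zero_of_forall_eq_zero fun u hu => ?_
    rw [if_neg]
    rw [hlt u hu.2]; exact not_lt.2 hu.1.le
  rw [hz, add_zero]
  -- The exceptional points of `g` pull back along the invertible map u ↦ c − m·`stdExp u` to a
  -- countable set, as the fundamental theorem of calculus allows.
  have hDc : (Set.Ioo 0 b ∩ (fun u => c - stdExp u * m) ⁻¹' D).Countable := by
    refine (hD.image (fun d => 1 - Real.exp ((d - c) / m))).mono ?_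
    rintro u ⟨hu, hud⟩
    refine ⟨_, hud, ?_⟩
    have h1 : 0 < 1 - u := by have := hu.2; linarith
    have : (c - stdExp u * m - c) / m = Real.log (1 - u) := by
      unfold stdExp; field_simp; ring
    simp only [this, Real.exp_log h1]; ring
  have := integral_eq_of_hasDerivAt_off_countable
    (fun u => -((1 - u) * g (c - stdExp u * m)))
    (fun u : ℝ => if 0 < c - stdExp u * m then
        g (c - stdExp u * m) + m * g' (c - stdExp u * m) else 0) (a := 0) (b := b) hDc ?_ ?_
    (hint 0 b le_rfl hb0.le hb1.le)
  · rw [this]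
    have h1 : c - stdExp b * m = 0 := by
      unfold stdExp
      rw [hb, sub_sub_cancel, Real.log_exp]; field_simp; ring
    rw [h1, h.zero]; simp [stdExp]
  · rw [Set.uIcc_of_le hb0.le]
    have hcE : ContinuousOn stdExp (Set.Icc 0 b) := by
      unfold stdExp
      refine ContinuousOn.neg (ContinuousOn.log (by fun_prop) fun u hu => ?_)
      have := hu.2; linarith
    have h2 := h.cont
    refine ContinuousOn.neg (ContinuousOn.mul (by fun_prop) (h2.comp_continuousOn ?_))
    fun_prop
  · rintro u ⟨hu, hud⟩
    rw [min_eq_left hb0.le, max_eq_right hb0.le] at hu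
    have hu1 : u < 1 := hu.2.trans hb1
    have hpos := (hlt u hu1).2 hu.2
    rw [if_pos hpos]
    have hg := hd _ hpos fun hm => hud ⟨hu, hm⟩
    have h1 : (1 - u) ≠ 0 := by linarith
    have hE : HasDerivAt stdExp (1 / (1 - u)) u := by
      have := (((hasDerivAt_id u).const_sub 1).log h1).neg
      exact this.congr_deriv (by simp [neg_div])
    have hcomp : HasDerivAt (fun u => g (c - stdExp u * m))
        (g' (c - stdExp u * m) * -(1 / (1 - u) * m)) u :=
      hg.comp u ((hE.mul_const m).const_sub c)
    have hfin := (((hasDerivAt_id u).const_sub 1).mul hcomp).neg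
    refine hfin.congr_deriv ?_
    simp only [id_eq]
    field_simp
    ring

/-- With probability s/m the key survives with its counter intact and contributes g(c) + m g'(c).
Otherwise it is in effect sampled afresh at level `m`, with mean g(c) by `integral_entry`. The
mixture is g(c) + s g'(c), the contribution before the eviction. -/
theorem integral_evict {g g' : ℝ → ℝ} (h : IsTest g g') {s m c : ℝ} (hs : 0 ≤ s) (hsm : s ≤ m)
    (hm : 0 < m) (hc : 0 < c) :
    ∫ u : UnitOpen, ∫ r : UnitOpen, (if m < max (s / u) (c / stdExp r) then
      g (if (u : ℝ) ≤ s / m then c else c - stdExp r * m) +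
        m * g' (if (u : ℝ) ≤ s / m then c else c - stdExp r * m) else 0)
      ∂unitMeasure ∂unitMeasure = g c + s * g' c := by
  have hinner : ∀ᵐ u : UnitOpen ∂unitMeasure,
      ∫ r : UnitOpen, (if m < max (s / u) (c / stdExp r) then
      g (if (u : ℝ) ≤ s / m then c else c - stdExp r * m) +
        m * g' (if (u : ℝ) ≤ s / m then c else c - stdExp r * m) else 0)
      ∂unitMeasure = (if (u : ℝ) ≤ s / m then g c + m * g' c else g c) := by
    -- The survival test is strict and the test on the counter is not; they disagree only at u =
    -- s/m.
    filter_upwards [ae_unitOpen_ne (s / m)] with u hu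
    have hu0 := u.2.1
    have key : ((u : ℝ) < s / m ↔ m < s / u) := by
      rw [lt_div_iff₀ hm, lt_div_iff₀ hu0, mul_comm]
    by_cases hle : (u : ℝ) ≤ s / m
    · have hlt := key.1 (lt_of_le_of_ne hle hu)
      simp [hle, hlt]
    · have hnot : ¬ m < s / u := fun hh => hle (key.2 hh).le
      simp only [hle, if_false, lt_max_iff, hnot, false_or]
      have : ∀ r : UnitOpen, (m < c / stdExp r ↔ 0 < c - stdExp r * m) := fun r => by
        rw [lt_div_iff₀ (stdExp_pos r), sub_pos, mul_comm]
      simp only [this]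
      rw [integral_entry h hm.le hc]
  rw [integral_congr_ae hinner,
    integral_unitOpen (fun u => if u ≤ s / m then g c + m * g' c else g c)]
  have h0 : 0 ≤ s / m := div_nonneg hs hm.le
  have h1 : s / m ≤ 1 := (div_le_one hm).2 hsm
  have e1 : Set.EqOn (fun u => if u ≤ s / m then g c + m * g' c else g c)
      (fun _ => g c + m * g' c) (Set.uIoc 0 (s / m)) := fun u hu => by
    rw [Set.uIoc_of_le h0] at hu
    simp [hu.2]
  have e2 : Set.EqOn (fun u => if u ≤ s / m then g c + m * g' c else g c)
      (fun _ => g c) (Set.uIoc (s / m) 1) := fun u hu => by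
    rw [Set.uIoc_of_le h1] at hu
    simp [not_le.2 hu.1]
  rw [← intervalIntegral.integral_add_adjacent_intervals (b := s / m)
    ((intervalIntegrable_const (c := g c + m * g' c)).congr e1.symm)
    ((intervalIntegrable_const (c := g c)).congr e2.symm),
    intervalIntegral.integral_congr_ae (.of_forall e1), intervalIntegral.integral_congr_ae (.of_forall e2)]
  simp only [intervalIntegral.integral_const, smul_eq_mul]
  field_simp
  ring

/-! ### The relaxed process. -/

noncomputable instance {𝒳 : Type*} : DecidableEq (RandCall 𝒳) := Classical.decEq _

/-- A state of the relaxed process: `level` is the inverse of `max τ ℓ⁻¹`, and a key is cached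
when its counter is positive. -/
structure RelaxedState (𝒳 : Type*) where
  level : ℝ
  count : 𝒳 → ℝ

section Relaxed

variable {𝒳 : Type*} [DecidableEq 𝒳]

/-- The cached keys among those in `A`. -/
noncomputable def RelaxedState.cached (s : RelaxedState 𝒳) (A : Finset 𝒳) : Finset 𝒳 :=
  A.filter fun x => 0 < s.count x

/-- Insertion of an element without eviction. -/
noncomputable def relEntry (ρ : RandCall 𝒳 → UnitOpen) (s : RelaxedState 𝒳) (e : 𝒳 × ℝ) (i : ℕ) :
    RelaxedState 𝒳 where
  level := s.level
  count := Function.update s.count e.1 (if 0 < s.count e.1 then s.count e.1 + e.2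
    else max 0 (e.2 - stdExp (ρ (.entry i)) * s.level))

/-- The inverse of the exponential part of the eviction threshold of a key. -/
noncomputable def invThreshold (ρ : RandCall 𝒳 → UnitOpen) (i : ℕ) (s : RelaxedState 𝒳) (x : 𝒳) :
    ℝ :=
  max (s.level / ρ (.evictU i x)) (s.count x / stdExp (ρ (.evictR i x)))

/-- The level after an eviction, as determined by the cached keys in `A`. -/
noncomputable def evictLevel (ℓ : ℝ) (A : Finset 𝒳) (ρ : RandCall 𝒳 → UnitOpen) (i : ℕ)
    (s : RelaxedState 𝒳) : ℝ :=
  A.fold min ℓ fun x => if 0 < s.count x then invThreshold ρ i s x else ℓ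

/-- The counter of a surviving key when the level is raised to `m`. -/
noncomputable def evictCount (ρ : RandCall 𝒳 → UnitOpen) (i : ℕ) (s : RelaxedState 𝒳) (m : ℝ)
    (x : 𝒳) : ℝ :=
  if (ρ (.evictU i x) : ℝ) ≤ s.level / m then s.count x
  else s.count x - stdExp (ρ (.evictR i x)) * m

/-- Eviction in the relaxed process. If all exponential thresholds are below `ℓ⁻¹`, the level
becomes `ℓ` and no key is removed. -/
noncomputable def relEvict (ℓ : ℝ) (A : Finset 𝒳) (ρ : RandCall 𝒳 → UnitOpen) (i : ℕ)
    (s : RelaxedState 𝒳) : RelaxedState 𝒳 where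
  level := evictLevel ℓ A ρ i s
  count := fun x => if 0 < s.count x ∧ evictLevel ℓ A ρ i s < invThreshold ρ i s x then
    evictCount ρ i s (evictLevel ℓ A ρ i s) x else 0

/-- Processing of one element by the relaxed process. -/
noncomputable def relStep (k : ℕ) (ℓ : ℝ) (A : Finset 𝒳) (ρ : RandCall 𝒳 → UnitOpen)
    (s : RelaxedState 𝒳) (e : 𝒳 × ℝ) (i : ℕ) : RelaxedState 𝒳 :=
  if (relEntry ρ s e i).level < ℓ ∧ ((relEntry ρ s e i).cached A).card = k + 1 then
    relEvict ℓ A ρ i (relEntry ρ s e i)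
  else relEntry ρ s e i

/-- The relaxed process: as the sampling algorithm, but the base hashes are not used and, once the
threshold is at most `ℓ⁻¹`, no key is removed. -/
noncomputable def relaxed (k : ℕ) (ℓ : ℝ) (A : Finset 𝒳) (stream : List (𝒳 × ℝ))
    (ρ : RandCall 𝒳 → UnitOpen) : RelaxedState 𝒳 :=
  stream.zipIdx.foldl (fun s ei => relStep k ℓ A ρ s ei.1 ei.2) { level := 0, count := fun _ => 0 }

theorem relaxed_append (k : ℕ) (ℓ : ℝ) (A : Finset 𝒳) (l : List (𝒳 × ℝ)) (e : 𝒳 × ℝ)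
    (ρ : RandCall 𝒳 → UnitOpen) :
    relaxed k ℓ A (l ++ [e]) ρ = relStep k ℓ A ρ (relaxed k ℓ A l ρ) e l.length := by
  simp [relaxed, List.zipIdx_append]

/-! ### Bounds -/

theorem le_evictLevel {ℓ : ℝ} {A : Finset 𝒳} {ρ : RandCall 𝒳 → UnitOpen} {i : ℕ}
    {s : RelaxedState 𝒳} (h0 : 0 ≤ s.level) (hℓ : s.level ≤ ℓ) : s.level ≤ evictLevel ℓ A ρ i s := by
  refine (Finset.le_fold_min _).2 ⟨hℓ, fun x _ => ?_⟩
  split_ifs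
  · refine le_max_of_le_left ?_
    have := (ρ (.evictU i x)).2
    exact le_div_self h0 this.1 this.2.le
  · exact hℓ

theorem evictLevel_le {ℓ : ℝ} {A : Finset 𝒳} {ρ : RandCall 𝒳 → UnitOpen} {i : ℕ}
    {s : RelaxedState 𝒳} : evictLevel ℓ A ρ i s ≤ ℓ :=
  (Finset.fold_min_le _).2 (Or.inl le_rfl)

theorem evictLevel_pos {ℓ : ℝ} (hℓ : 0 < ℓ) {A : Finset 𝒳} {ρ : RandCall 𝒳 → UnitOpen} {i : ℕ}
    {s : RelaxedState 𝒳} : 0 < evictLevel ℓ A ρ i s := by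
  refine (Finset.lt_fold_min _).2 ⟨hℓ, fun x _ => ?_⟩
  split_ifs with h
  · exact lt_max_of_lt_right (div_pos h (stdExp_pos _))
  · exact hℓ

theorem evictLevel_le_invThreshold {ℓ : ℝ} {A : Finset 𝒳} {ρ : RandCall 𝒳 → UnitOpen} {i : ℕ}
    {s : RelaxedState 𝒳} {x : 𝒳} (hx : x ∈ A) (hc : 0 < s.count x) :
    evictLevel ℓ A ρ i s ≤ invThreshold ρ i s x :=
  (Finset.fold_min_le _).2 (Or.inr ⟨x, hx, by simp [hc]⟩)

theorem evictCount_pos {ρ : RandCall 𝒳 → UnitOpen} {i : ℕ} {s : RelaxedState 𝒳} {m : ℝ} {x : 𝒳}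
    (hm : 0 < m) (hc : 0 < s.count x) (h : m < invThreshold ρ i s x) :
    0 < evictCount ρ i s m x := by
  unfold evictCount
  split_ifs with hu
  · exact hc
  · rcases lt_max_iff.1 h with h1 | h1
    · have := (ρ (.evictU i x)).2.1
      rw [lt_div_iff₀ this] at h1
      rw [not_le, div_lt_iff₀ hm] at hu
      exact absurd h1 (by linarith)
    · rw [lt_div_iff₀ (stdExp_pos _)] at h1
      linarith

theorem evictCount_le {ρ : RandCall 𝒳 → UnitOpen} {i : ℕ} {s : RelaxedState 𝒳} {m : ℝ} {x : 𝒳}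
    (hm : 0 < m) : evictCount ρ i s m x ≤ s.count x := by
  unfold evictCount
  split_ifs with hu
  · exact le_rfl
  · have := mul_pos (stdExp_pos (ρ (.evictR i x))) hm
    linarith

theorem relEvict_count_pos_iff {ℓ : ℝ} (hℓ : 0 < ℓ) {A : Finset 𝒳} {ρ : RandCall 𝒳 → UnitOpen}
    {i : ℕ} {s : RelaxedState 𝒳} {x : 𝒳} : 0 < (relEvict ℓ A ρ i s).count x ↔
      0 < s.count x ∧ evictLevel ℓ A ρ i s < invThreshold ρ i s x := by
  simp only [relEvict]
  split_ifs with h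
  · exact iff_of_true (evictCount_pos (evictLevel_pos hℓ) h.1 h.2) h
  · exact iff_of_false (lt_irrefl _) h

/-- The level lies in `[0, ℓ]` and the counters in `[0, W]`. -/
structure RelaxedState.Bounded (s : RelaxedState 𝒳) (ℓ W : ℝ) : Prop where
  level_nonneg : 0 ≤ s.level
  level_le : s.level ≤ ℓ
  count_nonneg : ∀ x, 0 ≤ s.count x
  count_le : ∀ x, s.count x ≤ W

theorem RelaxedState.Bounded.relEntry {s : RelaxedState 𝒳} {ℓ W : ℝ} (h : s.Bounded ℓ W)
    (ρ : RandCall 𝒳 → UnitOpen) {e : 𝒳 × ℝ} (he : 0 < e.2) (i : ℕ) :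
    (relEntry ρ s e i).Bounded ℓ (W + e.2) := by
  have hW : 0 ≤ W := (h.count_nonneg e.1).trans (h.count_le e.1)
  refine ⟨h.level_nonneg, h.level_le, fun x => ?_, fun x => ?_⟩
  · by_cases hx : x = e.1
    · subst hx
      simp only [ContSH.relEntry, Function.update_self]
      split_ifs with hc
      · linarith
      · exact le_max_left _ _
    · simpa [ContSH.relEntry, Function.update_of_ne hx] using h.count_nonneg x
  · by_cases hx : x = e.1
    · subst hx
      simp only [ContSH.relEntry, Function.update_self]
      split_ifs with hc
      · linarith [h.count_le e.1]
      · have := mul_nonneg (stdExp_pos (ρ (.entry i))).le h.level_nonneg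
        exact max_le (by linarith) (by linarith)
    · simpa [ContSH.relEntry, Function.update_of_ne hx] using (h.count_le x).trans (by linarith)

theorem RelaxedState.Bounded.relEvict {s : RelaxedState 𝒳} {ℓ W : ℝ} (h : s.Bounded ℓ W)
    (hℓ : 0 < ℓ) (A : Finset 𝒳) (ρ : RandCall 𝒳 → UnitOpen) (i : ℕ) :
    (relEvict ℓ A ρ i s).Bounded ℓ W := by
  refine ⟨(evictLevel_pos hℓ).le, evictLevel_le, fun x => ?_, fun x => ?_⟩
  · simp only [ContSH.relEvict]
    split_ifs with hc
    · exact (evictCount_pos (evictLevel_pos hℓ) hc.1 hc.2).le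
    · exact le_rfl
  · simp only [ContSH.relEvict]
    split_ifs with hc
    · exact (evictCount_le (evictLevel_pos hℓ)).trans (h.count_le x)
    · exact (h.count_nonneg x).trans (h.count_le x)

/-- The bound `W` does not depend on the random numbers, so all contributions of the relaxed process
are bounded and integrable. -/
theorem relaxed_bounded (k : ℕ) {ℓ : ℝ} (hℓ : 0 < ℓ) (A : Finset 𝒳) (l : List (𝒳 × ℝ))
    (hl : ∀ e ∈ l, 0 < e.2) :
    ∃ W, ∀ ρ : RandCall 𝒳 → UnitOpen, (relaxed k ℓ A l ρ).Bounded ℓ W := by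
  induction l using List.reverseRecOn with
  | nil => exact ⟨0, fun ρ => ⟨le_rfl, hℓ.le, fun _ => le_rfl, fun _ => le_rfl⟩⟩
  | append_singleton l e ih =>
    obtain ⟨W, hW⟩ := ih fun e' he' => hl e' (by simp [he'])
    refine ⟨W + e.2, fun ρ => ?_⟩
    have h1 := (hW ρ).relEntry ρ (hl e (by simp)) l.length
    rw [relaxed_append, relStep]
    split_ifs
    · exact h1.relEvict hℓ A ρ _
    · exact h1

/-! ### Dependence on the random numbers -/

theorem relEntry_congr {ρ ρ' : RandCall 𝒳 → UnitOpen} {s : RelaxedState 𝒳} {e : 𝒳 × ℝ} {i : ℕ}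
    (h : ρ (.entry i) = ρ' (.entry i)) : relEntry ρ s e i = relEntry ρ' s e i := by
  simp only [relEntry, h]

theorem invThreshold_congr {ρ ρ' : RandCall 𝒳 → UnitOpen} {s : RelaxedState 𝒳} {i : ℕ} {x : 𝒳}
    (h2 : ρ (.evictU i x) = ρ' (.evictU i x)) (h3 : ρ (.evictR i x) = ρ' (.evictR i x)) :
    invThreshold ρ i s x = invThreshold ρ' i s x := by
  unfold invThreshold; rw [h2, h3]

theorem evictCount_congr {ρ ρ' : RandCall 𝒳 → UnitOpen} {s : RelaxedState 𝒳} {i : ℕ} {m : ℝ} {x : 𝒳}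
    (h2 : ρ (.evictU i x) = ρ' (.evictU i x)) (h3 : ρ (.evictR i x) = ρ' (.evictR i x)) :
    evictCount ρ i s m x = evictCount ρ' i s m x := by
  unfold evictCount; rw [h2, h3]

theorem evictLevel_congr {ℓ : ℝ} {A : Finset 𝒳} {ρ ρ' : RandCall 𝒳 → UnitOpen}
    {s : RelaxedState 𝒳} {i : ℕ} (h2 : ∀ x ∈ A, ρ (.evictU i x) = ρ' (.evictU i x))
    (h3 : ∀ x ∈ A, ρ (.evictR i x) = ρ' (.evictR i x)) :
    evictLevel ℓ A ρ i s = evictLevel ℓ A ρ' i s :=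
  Finset.fold_congr fun x hx => by rw [invThreshold_congr (h2 x hx) (h3 x hx)]

theorem relEvict_congr {ℓ : ℝ} {A : Finset 𝒳} {ρ ρ' : RandCall 𝒳 → UnitOpen}
    {s : RelaxedState 𝒳} {i : ℕ} (h2 : ∀ x, ρ (.evictU i x) = ρ' (.evictU i x))
    (h3 : ∀ x, ρ (.evictR i x) = ρ' (.evictR i x)) :
    relEvict ℓ A ρ i s = relEvict ℓ A ρ' i s := by
  have hI : invThreshold ρ i s = invThreshold ρ' i s :=
    funext fun x => invThreshold_congr (h2 x) (h3 x)
  have hC : evictCount ρ i s = evictCount ρ' i s :=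
    funext fun m => funext fun x => evictCount_congr (h2 x) (h3 x)
  unfold relEvict
  rw [evictLevel_congr (fun x _ => h2 x) (fun x _ => h3 x), hI, hC]

theorem relStep_congr {k : ℕ} {ℓ : ℝ} {A : Finset 𝒳} {ρ ρ' : RandCall 𝒳 → UnitOpen}
    {s : RelaxedState 𝒳} {e : 𝒳 × ℝ} {i : ℕ} (h1 : ρ (.entry i) = ρ' (.entry i))
    (h2 : ∀ x, ρ (.evictU i x) = ρ' (.evictU i x)) (h3 : ∀ x, ρ (.evictR i x) = ρ' (.evictR i x)) :
    relStep k ℓ A ρ s e i = relStep k ℓ A ρ' s e i := by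
  simp only [relStep, relEntry_congr h1, relEvict_congr h2 h3]

/-- The state after `l` does not see the hashes or the numbers drawn for later elements. The update
lemmas below are its use as independence. -/
theorem relaxed_congr {k : ℕ} {ℓ : ℝ} {A : Finset 𝒳} {l : List (𝒳 × ℝ)}
    {ρ ρ' : RandCall 𝒳 → UnitOpen} (h : ∀ i < l.length, ρ (.entry i) = ρ' (.entry i) ∧
      (∀ x, ρ (.evictU i x) = ρ' (.evictU i x)) ∧ ∀ x, ρ (.evictR i x) = ρ' (.evictR i x)) :
    relaxed k ℓ A l ρ = relaxed k ℓ A l ρ' := by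
  induction l using List.reverseRecOn with
  | nil => rfl
  | append_singleton l e ih =>
    rw [relaxed_append, relaxed_append, ih fun i hi => h i (by simp; omega)]
    obtain ⟨h1, h2, h3⟩ := h l.length (by simp)
    exact relStep_congr h1 h2 h3

theorem relaxed_update_entry {k : ℕ} {ℓ : ℝ} {A : Finset 𝒳} {l : List (𝒳 × ℝ)}
    (ρ : RandCall 𝒳 → UnitOpen) (u : UnitOpen) :
    relaxed k ℓ A l (Function.update ρ (.entry l.length) u) = relaxed k ℓ A l ρ :=
  relaxed_congr fun i hi => by simp [hi.ne]

theorem relaxed_update_evictU {k : ℕ} {ℓ : ℝ} {A : Finset 𝒳} {l : List (𝒳 × ℝ)}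
    (ρ : RandCall 𝒳 → UnitOpen) (x : 𝒳) (u : UnitOpen) :
    relaxed k ℓ A l (Function.update ρ (.evictU l.length x) u) = relaxed k ℓ A l ρ :=
  relaxed_congr fun i hi => by simp [hi.ne]

theorem relaxed_update_evictR {k : ℕ} {ℓ : ℝ} {A : Finset 𝒳} {l : List (𝒳 × ℝ)}
    (ρ : RandCall 𝒳 → UnitOpen) (x : 𝒳) (u : UnitOpen) :
    relaxed k ℓ A l (Function.update ρ (.evictR l.length x) u) = relaxed k ℓ A l ρ :=
  relaxed_congr fun i hi => by simp [hi.ne]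

theorem relaxed_update_hash {k : ℕ} {ℓ : ℝ} {A : Finset 𝒳} {l : List (𝒳 × ℝ)}
    (ρ : RandCall 𝒳 → UnitOpen) (x : 𝒳) (u : UnitOpen) :
    relaxed k ℓ A l (Function.update ρ (.hash x) u) = relaxed k ℓ A l ρ :=
  relaxed_congr fun i hi => by simp

/-! ### Measurability -/

/-- Measurability of a random state of the relaxed process. -/
structure MeasurableState {β : Type*} [MeasurableSpace β] (s : β → RelaxedState 𝒳) : Prop where
  level : Measurable fun b => (s b).level
  count : ∀ x, Measurable fun b => (s b).count x

variable {s : (RandCall 𝒳 → UnitOpen) → RelaxedState 𝒳}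

theorem measurable_call (c : RandCall 𝒳) : Measurable fun ρ : RandCall 𝒳 → UnitOpen => (ρ c : ℝ) :=
  measurable_subtype_coe.comp (measurable_pi_apply c)

theorem measurable_stdExp_call (c : RandCall 𝒳) :
    Measurable fun ρ : RandCall 𝒳 → UnitOpen => stdExp (ρ c) :=
  measurable_stdExp.comp (measurable_call c)

theorem MeasurableState.measurableSet_pos {β : Type*} [MeasurableSpace β] {s : β → RelaxedState 𝒳}
    (hs : MeasurableState s) (x : 𝒳) : MeasurableSet {b | 0 < (s b).count x} :=
  measurableSet_lt measurable_const (hs.count x)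

theorem MeasurableState.relEntry (hs : MeasurableState s) (e : 𝒳 × ℝ) (i : ℕ) :
    MeasurableState fun ρ => relEntry ρ (s ρ) e i := by
  refine ⟨hs.level, fun x => ?_⟩
  by_cases hx : x = e.1
  · subst hx
    simp only [ContSH.relEntry, Function.update_self]
    exact Measurable.ite (hs.measurableSet_pos _) ((hs.count _).add_const _)
      (measurable_const.max (((measurable_stdExp_call _).mul hs.level).const_sub _))
  · simpa only [ContSH.relEntry, Function.update_of_ne hx] using hs.count x

theorem measurable_fold_min {β κ : Type*} [MeasurableSpace β] (A : Finset κ) (ℓ : ℝ)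
    {f : β → κ → ℝ} (hf : ∀ x ∈ A, Measurable fun b => f b x) :
    Measurable fun b => A.fold min ℓ (f b) := by
  classical
  induction A using Finset.induction_on with
  | empty => simp
  | insert x A hx ih =>
    simp only [Finset.fold_insert hx]
    exact (hf x (Finset.mem_insert_self x A)).min
      (ih fun y hy => hf y (Finset.mem_insert_of_mem hy))

theorem MeasurableState.invThreshold (hs : MeasurableState s) (i : ℕ) (x : 𝒳) :
    Measurable fun ρ => invThreshold ρ i (s ρ) x :=
  (hs.level.div (measurable_call _)).max ((hs.count x).div (measurable_stdExp_call _))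

theorem MeasurableState.evictLevel (hs : MeasurableState s) (ℓ : ℝ) (A : Finset 𝒳) (i : ℕ) :
    Measurable fun ρ => evictLevel ℓ A ρ i (s ρ) :=
  measurable_fold_min A ℓ fun x _ =>
    Measurable.ite (hs.measurableSet_pos x) (hs.invThreshold i x) measurable_const

theorem MeasurableState.evictCount (hs : MeasurableState s) (i : ℕ)
    {m : (RandCall 𝒳 → UnitOpen) → ℝ} (hm : Measurable m) (x : 𝒳) :
    Measurable fun ρ => evictCount ρ i (s ρ) (m ρ) x :=
  Measurable.ite (measurableSet_le (measurable_call _) (hs.level.div hm)) (hs.count x)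
    ((hs.count x).sub ((measurable_stdExp_call _).mul hm))

theorem MeasurableState.relEvict (hs : MeasurableState s) (ℓ : ℝ) (A : Finset 𝒳) (i : ℕ) :
    MeasurableState fun ρ => relEvict ℓ A ρ i (s ρ) :=
  ⟨hs.evictLevel ℓ A i, fun x => Measurable.ite
    ((hs.measurableSet_pos x).inter (measurableSet_lt (hs.evictLevel ℓ A i) (hs.invThreshold i x)))
    (hs.evictCount i (hs.evictLevel ℓ A i) x) measurable_const⟩

theorem measurable_card_filter {β κ : Type*} [MeasurableSpace β] (A : Finset κ)
    {p : β → κ → Prop} [∀ b, DecidablePred (p b)] (hp : ∀ x ∈ A, MeasurableSet {b | p b x}) :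
    Measurable fun b => (A.filter (p b)).card := by
  simp only [Finset.card_filter]
  exact Finset.measurable_fun_sum A fun x hx =>
    Measurable.ite (hp x hx) measurable_const measurable_const

theorem MeasurableState.card_cached {β : Type*} [MeasurableSpace β] {s : β → RelaxedState 𝒳}
    (hs : MeasurableState s) (A : Finset 𝒳) : Measurable fun b => ((s b).cached A).card :=
  measurable_card_filter A fun x _ => hs.measurableSet_pos x

theorem MeasurableState.measurableSet_full {β : Type*} [MeasurableSpace β]
    {s : β → RelaxedState 𝒳} (hs : MeasurableState s) (k : ℕ) (ℓ : ℝ) (A : Finset 𝒳) :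
    MeasurableSet {b | (s b).level < ℓ ∧ ((s b).cached A).card = k + 1} :=
  (measurableSet_lt hs.level measurable_const).inter
    ((hs.card_cached A) (measurableSet_singleton (k + 1)))

theorem MeasurableState.relStep (hs : MeasurableState s) (k : ℕ) (ℓ : ℝ) (A : Finset 𝒳)
    (e : 𝒳 × ℝ) (i : ℕ) : MeasurableState fun ρ => relStep k ℓ A ρ (s ρ) e i := by
  have h1 := hs.relEntry e i
  have h2 := h1.relEvict ℓ A i
  have h3 := h1.measurableSet_full k ℓ A
  unfold ContSH.relStep
  constructor
  · simp only [apply_ite RelaxedState.level]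
    exact Measurable.ite h3 h2.level h1.level
  · intro x
    simp only [apply_ite RelaxedState.count, ite_apply]
    exact Measurable.ite h3 (h2.count x) (h1.count x)

theorem measurableState_relaxed (k : ℕ) (ℓ : ℝ) (A : Finset 𝒳) (l : List (𝒳 × ℝ)) :
    MeasurableState (relaxed k ℓ A l) := by
  induction l using List.reverseRecOn with
  | nil => exact ⟨measurable_const, fun _ => measurable_const⟩
  | append_singleton l e ih =>
    have := ih.relStep k ℓ A e l.length
    simpa only [← relaxed_append] using this

end Relaxed

/-! ### Product moments of the relaxed process. -/

theorem IsTest.bound {g g' : ℝ → ℝ} (h : IsTest g g') (ℓ W : ℝ) :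
    ∃ K, ∀ m c, 0 ≤ m → m ≤ ℓ → 0 ≤ c → c ≤ W → |g c + m * g' c| ≤ K := by
  obtain ⟨K, hK⟩ := h.bdd
  obtain ⟨L, hL⟩ := isCompact_Icc.exists_bound_of_continuousOn (s := Set.Icc 0 W)
    h.cont.continuousOn
  refine ⟨L + ℓ * K, fun m c hm hmℓ hc hcW => (abs_add_le _ _).trans
    (add_le_add (hL c ⟨hc, hcW⟩) ?_)⟩
  rw [abs_mul, abs_of_nonneg hm]
  exact mul_le_mul hmℓ (hK c hc) (abs_nonneg _) (hm.trans hmℓ)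

section Relaxed

variable {𝒳 : Type*} [DecidableEq 𝒳]

/-- The contribution of a key to the estimate computed from a state of the relaxed process. -/
noncomputable def relEst (g g' : ℝ → ℝ) (s : RelaxedState 𝒳) (x : 𝒳) : ℝ :=
  if 0 < s.count x then g (s.count x) + s.level * g' (s.count x) else 0

/-- The contribution of a key after an eviction that raises the level to `m`. -/
noncomputable def evictEst (g g' : ℝ → ℝ) (ρ : RandCall 𝒳 → UnitOpen) (i : ℕ) (s : RelaxedState 𝒳)
    (m : ℝ) (x : 𝒳) : ℝ :=
  if 0 < s.count x ∧ m < invThreshold ρ i s x then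
    g (evictCount ρ i s m x) + m * g' (evictCount ρ i s m x) else 0

theorem IsTest.relEst_bound {g g' : ℝ → ℝ} (h : IsTest g g') (ℓ W : ℝ) :
    ∃ K, ∀ (s : RelaxedState 𝒳) (x : 𝒳), s.Bounded ℓ W → |relEst g g' s x| ≤ K := by
  obtain ⟨K, hK⟩ := h.bound ℓ W
  refine ⟨max K 0, fun s x hs => ?_⟩
  unfold relEst
  split_ifs
  · exact (hK _ _ hs.level_nonneg hs.level_le (hs.count_nonneg x) (hs.count_le x)).trans
      (le_max_left _ _)
  · simp

theorem IsTest.measurable_relEst {β : Type*} [MeasurableSpace β] {s : β → RelaxedState 𝒳}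
    (hs : MeasurableState s) {g g' : ℝ → ℝ} (h : IsTest g g') (x : 𝒳) :
    Measurable fun b => relEst g g' (s b) x :=
  Measurable.ite (hs.measurableSet_pos x) ((h.cont.measurable.comp (hs.count x)).add
    (hs.level.mul (h.meas.comp (hs.count x)))) measurable_const

theorem relEst_relEvict {ℓ : ℝ} (hℓ : 0 < ℓ) (g g' : ℝ → ℝ) (A : Finset 𝒳)
    (ρ : RandCall 𝒳 → UnitOpen) (i : ℕ) (s : RelaxedState 𝒳) (x : 𝒳) :
    relEst g g' (relEvict ℓ A ρ i s) x = evictEst g g' ρ i s (evictLevel ℓ A ρ i s) x := by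
  unfold relEst evictEst
  simp only [relEvict_count_pos_iff hℓ]
  split_ifs with h
  · simp [relEvict, h]
  · rfl

/-- Decoupling of the level from the keys of `B`. If every cached key of `B` beats the level
determined by `A \ B`, the keys of `B` do not affect the minimum and the two levels coincide.
Otherwise a key of `B` is evicted under either level, and both products vanish. -/
theorem prod_relEst_relEvict {ℓ : ℝ} (hℓ : 0 < ℓ) (g g' : 𝒳 → ℝ → ℝ) {A B : Finset 𝒳}
    (ρ : RandCall 𝒳 → UnitOpen) (i : ℕ) (s : RelaxedState 𝒳) :
    ∏ x ∈ B, relEst (g x) (g' x) (relEvict ℓ A ρ i s) x =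
      ∏ x ∈ B, evictEst (g x) (g' x) ρ i s (evictLevel ℓ (A \ B) ρ i s) x := by
  simp only [relEst_relEvict hℓ]
  by_cases hall : ∀ x ∈ B, 0 < s.count x → evictLevel ℓ (A \ B) ρ i s < invThreshold ρ i s x
  · have : evictLevel ℓ A ρ i s = evictLevel ℓ (A \ B) ρ i s := by
      apply le_antisymm
      · refine (Finset.le_fold_min _).2 ⟨evictLevel_le, fun x hx => ?_⟩
        split_ifs with hc
        · exact evictLevel_le_invThreshold (Finset.mem_sdiff.1 hx).1 hc
        · exact evictLevel_le
      · refine (Finset.le_fold_min _).2 ⟨evictLevel_le, fun x hx => ?_⟩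
        split_ifs with hc
        · by_cases hxB : x ∈ B
          · exact (hall x hxB hc).le
          · exact evictLevel_le_invThreshold (Finset.mem_sdiff.2 ⟨hx, hxB⟩) hc
        · exact evictLevel_le
    rw [this]
  · push Not at hall
    obtain ⟨y, hyB, hyc, hy⟩ := hall
    -- This key attains the minimum over all of `A` and kills the left product, while `y` kills the
    -- right one.
    obtain ⟨x, hx, hmin⟩ := (B.filter fun x => 0 < s.count x).exists_min_image
      (invThreshold ρ i s) ⟨y, Finset.mem_filter.2 ⟨hyB, hyc⟩⟩
    rw [Finset.mem_filter] at hx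
    have hxy := (hmin y (Finset.mem_filter.2 ⟨hyB, hyc⟩)).trans hy
    rw [Finset.prod_eq_zero hx.1, Finset.prod_eq_zero hyB]
    · rw [evictEst, if_neg fun h => not_lt.2 hy h.2]
    · rw [evictEst, if_neg fun h => not_lt.2 ?_ h.2]
      refine (Finset.le_fold_min _).2 ⟨hxy.trans evictLevel_le, fun z hz => ?_⟩
      split_ifs with hc
      · by_cases hzB : z ∈ B
        · exact hmin z (Finset.mem_filter.2 ⟨hzB, hc⟩)
        · exact hxy.trans (evictLevel_le_invThreshold (Finset.mem_sdiff.2 ⟨hz, hzB⟩) hc)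
      · exact hxy.trans evictLevel_le

/-- An eviction is neutral in expectation: with the level of `A \ B` in place, each key of `B` is
averaged over its own two numbers by `integral_evict`. The predicate `p` is the condition that
triggers the eviction; it depends only on the state before it. -/
theorem integral_prod_relEst_evict {ℓ W : ℝ} (hℓ : 0 < ℓ) {A B : Finset 𝒳} (i : ℕ)
    {s : (RandCall 𝒳 → UnitOpen) → RelaxedState 𝒳} (hs : MeasurableState s)
    (hW : ∀ ρ, (s ρ).Bounded ℓ W)
    (hinv : ∀ ρ x u r, s (Function.update (Function.update ρ (.evictU i x) u) (.evictR i x) r) =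
      s ρ) {p : RelaxedState 𝒳 → Prop} [DecidablePred p] (hp : MeasurableSet {ρ | p (s ρ)})
    (g g' : 𝒳 → ℝ → ℝ) (hg : ∀ x ∈ B, IsTest (g x) (g' x)) :
    ∫ ρ, ∏ x ∈ B, relEst (g x) (g' x) (if p (s ρ) then relEvict ℓ A ρ i (s ρ) else s ρ) x
      ∂(Measure.infinitePi fun _ => unitMeasure) =
    ∫ ρ, ∏ x ∈ B, relEst (g x) (g' x) (s ρ) x ∂(Measure.infinitePi fun _ => unitMeasure) := by
  set m : (RandCall 𝒳 → UnitOpen) → ℝ := fun ρ => evictLevel ℓ (A \ B) ρ i (s ρ) with hm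
  have hmm : Measurable m := hs.evictLevel ℓ (A \ B) i
  have hm0 : ∀ ρ, 0 < m ρ := fun ρ => evictLevel_pos hℓ
  have hmℓ : ∀ ρ, m ρ ≤ ℓ := fun ρ => evictLevel_le
  have hsm : ∀ ρ, (s ρ).level ≤ m ρ := fun ρ => le_evictLevel (hW ρ).level_nonneg (hW ρ).level_le
  have hminv : ∀ ρ, ∀ x ∈ B, ∀ u r,
      m (Function.update (Function.update ρ (.evictU i x) u) (.evictR i x) r) = m ρ := by
    intro ρ x hx u r
    simp only [hm, hinv]
    have hne : ∀ y ∈ A \ B, y ≠ x := fun y hy h => (Finset.mem_sdiff.1 hy).2 (h ▸ hx)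
    exact evictLevel_congr (fun y hy => by simp [hne y hy]) (fun y hy => by simp [hne y hy])
  have key := integral_mul_prod_resample unitMeasure (RandCall.evictU i) (RandCall.evictR i) B
    (fun _ => 1) (fun x ρ => if p (s ρ) then evictEst (g x) (g' x) ρ i (s ρ) (m ρ) x
      else relEst (g x) (g' x) (s ρ) x) (fun x ρ => relEst (g x) (g' x) (s ρ) x)
    measurable_const ⟨1, by simp⟩ ?_ ?_ ?_ ?_ ?_ ?_ ?_ (fun _ _ _ _ _ => rfl)
  · simp only [one_mul] at key
    rw [← key]
    refine integral_congr_ae (.of_forall fun ρ => ?_)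
    by_cases h : p (s ρ)
    · simp only [h, if_true]
      exact prod_relEst_relEvict hℓ g g' ρ i (s ρ)
    · simp [h]
  · intro x hx
    refine Measurable.ite hp (Measurable.ite ?_ ?_ measurable_const)
      ((hg x hx).measurable_relEst hs x)
    · exact (hs.measurableSet_pos x).inter (measurableSet_lt hmm (hs.invThreshold i x))
    · have hc := hs.evictCount i hmm x
      exact ((hg x hx).cont.measurable.comp hc).add (hmm.mul ((hg x hx).meas.comp hc))
  · intro x hx
    obtain ⟨K, hK⟩ := (hg x hx).bound ℓ W
    obtain ⟨L, hL⟩ := (hg x hx).relEst_bound (𝒳 := 𝒳) ℓ W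
    refine ⟨max (max K 0) L, fun ρ => ?_⟩
    split_ifs
    · refine le_max_of_le_left ?_
      rw [evictEst]
      split_ifs with h
      · exact (hK _ _ (hm0 ρ).le (hmℓ ρ) (evictCount_pos (hm0 ρ) h.1 h.2).le
          ((evictCount_le (hm0 ρ)).trans ((hW ρ).count_le x))).trans (le_max_left _ _)
      · simp
    · exact le_max_of_le_right (hL _ x (hW ρ))
  · exact fun x hx => (hg x hx).measurable_relEst hs x
  · intro x hx
    obtain ⟨L, hL⟩ := (hg x hx).relEst_bound (𝒳 := 𝒳) ℓ W
    exact ⟨L, fun ρ => hL _ x (hW ρ)⟩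
  · intro x hx ρ
    simp only [hinv, hminv ρ x hx]
    split_ifs with h
    · unfold evictEst relEst
      by_cases hc : 0 < (s ρ).count x
      · simp only [hc, true_and, if_true]
        rw [← integral_evict (hg x hx) (hW ρ).level_nonneg (hsm ρ) (hm0 ρ) hc]
        simp [invThreshold, evictCount]
      · simp [hc]
    · simp
  · intro x hx y hy hyx ρ u r
    simp only [hinv, hminv ρ x hx]
    split_ifs
    · unfold evictEst
      rw [invThreshold_congr (ρ' := ρ) (by simp [hyx]) (by simp [hyx]),
        evictCount_congr (ρ' := ρ) (by simp [hyx]) (by simp [hyx])]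
    · rfl
  · intro x hx y hy hyx ρ u r
    rw [hinv]

theorem relEst_relEntry_of_ne {g g' : ℝ → ℝ} {ρ : RandCall 𝒳 → UnitOpen} {s : RelaxedState 𝒳}
    {e : 𝒳 × ℝ} {i : ℕ} {x : 𝒳} (h : x ≠ e.1) :
    relEst g g' (relEntry ρ s e i) x = relEst g g' s x := by
  simp [relEst, relEntry, Function.update_of_ne h]

/-- In mean, an arrival of weight w at `e.1` adds g(w) to the contribution before it, computed for
the shifted function g(· + w) − g(w). This holds whether or not the key was cached. -/
theorem integral_prod_relEst_entry {ℓ W : ℝ} {B : Finset 𝒳} (i : ℕ) {e : 𝒳 × ℝ} (he : 0 < e.2)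
    {s : (RandCall 𝒳 → UnitOpen) → RelaxedState 𝒳} (hs : MeasurableState s)
    (hW : ∀ ρ, (s ρ).Bounded ℓ W) (hinv : ∀ ρ u, s (Function.update ρ (.entry i) u) = s ρ)
    (g g' : 𝒳 → ℝ → ℝ) (hg : ∀ x ∈ B, IsTest (g x) (g' x)) (heB : e.1 ∈ B) :
    ∫ ρ, ∏ x ∈ B, relEst (g x) (g' x) (relEntry ρ (s ρ) e i) x
      ∂(Measure.infinitePi fun _ => unitMeasure) =
    g e.1 e.2 * ∫ ρ, ∏ x ∈ B.erase e.1, relEst (g x) (g' x) (s ρ) x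
      ∂(Measure.infinitePi fun _ => unitMeasure) +
    ∫ ρ, relEst (fun c => g e.1 (c + e.2) - g e.1 e.2) (fun c => g' e.1 (c + e.2)) (s ρ) e.1 *
      ∏ x ∈ B.erase e.1, relEst (g x) (g' x) (s ρ) x
      ∂(Measure.infinitePi fun _ => unitMeasure) := by
  have hge := hg e.1 heB
  have hsh := hge.shift he.le
  have hmE : ∀ x ∈ B, Measurable fun ρ => relEst (g x) (g' x) (relEntry ρ (s ρ) e i) x :=
    fun x hx => (hg x hx).measurable_relEst (hs.relEntry e i) x
  have hprodb : ∀ C ⊆ B, ∀ (s' : (RandCall 𝒳 → UnitOpen) → RelaxedState 𝒳) (W' : ℝ),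
      (∀ ρ, (s' ρ).Bounded ℓ W') → ∃ K, ∀ ρ, |∏ x ∈ C, relEst (g x) (g' x) (s' ρ) x| ≤ K := by
    intro C hC s' W' hb
    choose! K hK using fun x hx => (hg x hx).relEst_bound (𝒳 := 𝒳) ℓ W'
    refine ⟨∏ x ∈ C, K x, fun ρ => ?_⟩
    rw [Finset.abs_prod]
    exact Finset.prod_le_prod (fun x _ => abs_nonneg _) fun x hx => hK x (hC hx) _ x (hb ρ)
  have hbR := hprodb (B.erase e.1) (Finset.erase_subset _ _) s W hW
  have hmR : Measurable fun ρ => ∏ x ∈ B.erase e.1, relEst (g x) (g' x) (s ρ) x :=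
    Finset.measurable_fun_prod _ fun x hx =>
      (hg x (Finset.mem_of_mem_erase hx)).measurable_relEst hs x
  obtain ⟨L, hL⟩ := hsh.relEst_bound (𝒳 := 𝒳) ℓ W
  rw [integral_resample unitMeasure (.entry i) (Finset.measurable_fun_prod B hmE)
    (hprodb B subset_rfl _ _ fun ρ => (hW ρ).relEntry ρ he i), ← integral_const_mul,
    ← integral_add]
  · refine integral_congr_ae (.of_forall fun ρ => ?_)
    simp only [hinv]
    have h1 : ∀ u, ∏ x ∈ B, relEst (g x) (g' x)
        (relEntry (Function.update ρ (.entry i) u) (s ρ) e i) x =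
        relEst (g e.1) (g' e.1) (relEntry (Function.update ρ (.entry i) u) (s ρ) e i) e.1 *
          ∏ x ∈ B.erase e.1, relEst (g x) (g' x) (s ρ) x := by
      intro u
      rw [← Finset.mul_prod_erase B _ heB]
      congr 1
      exact Finset.prod_congr rfl fun x hx => relEst_relEntry_of_ne (Finset.ne_of_mem_erase hx)
    simp only [h1, integral_mul_const]
    rw [← add_mul]
    congr 1
    -- For a cached key this is an identity without averaging; for an uncached one the shifted
    -- contribution is 0 and `integral_entry` gives g(w).
    by_cases hc : 0 < (s ρ).count e.1
    · have : 0 < (s ρ).count e.1 + e.2 := by linarith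
      simp [relEst, relEntry, hc, this]
      ring
    · have hE := integral_entry hge (hW ρ).level_nonneg he
      simp only [relEst, relEntry, hc, if_false, Function.update_self, add_zero]
      rw [← hE]
      refine integral_congr_ae (.of_forall fun u => ?_)
      simp only [lt_max_iff, lt_irrefl, false_or]
      split_ifs with h
      · rw [max_eq_right h.le]
      · rfl
  · exact (integrable_of_measurable_bounded hmR hbR).const_mul _
  · refine integrable_of_measurable_bounded ((hsh.measurable_relEst hs e.1).mul hmR) ?_
    obtain ⟨K, hK⟩ := hbR
    refine ⟨L * K, fun ρ => ?_⟩
    rw [abs_mul]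
    exact mul_le_mul (hL _ _ (hW ρ)) (hK ρ) (abs_nonneg _) ((abs_nonneg _).trans (hL _ e.1 (hW ρ)))

theorem keyWeight_append (l : List (𝒳 × ℝ)) (e : 𝒳 × ℝ) (x : 𝒳) :
    keyWeight (l ++ [e]) x = keyWeight l x + if e.1 = x then e.2 else 0 := by
  unfold keyWeight
  rw [List.filter_append, List.map_append, List.sum_append]
  congr 1
  by_cases h : e.1 = x <;> simp [h]

/-- Induction on the stream: evictions change nothing, and an arrival is traded for a shift of one
test function. The functions must therefore vary in the induction. -/
theorem integral_prod_relEst_relaxed (k : ℕ) {ℓ : ℝ} (hℓ : 0 < ℓ) {A B : Finset 𝒳}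
    (l : List (𝒳 × ℝ)) (hl : ∀ e ∈ l, 0 < e.2) (g g' : 𝒳 → ℝ → ℝ)
    (hg : ∀ x ∈ B, IsTest (g x) (g' x)) :
    ∫ ρ, ∏ x ∈ B, relEst (g x) (g' x) (relaxed k ℓ A l ρ) x
      ∂(Measure.infinitePi fun _ => unitMeasure) = ∏ x ∈ B, g x (keyWeight l x) := by
  induction l using List.reverseRecOn generalizing B g g' with
  | nil =>
    have : ∀ x ∈ B, g x (keyWeight [] x) = 0 := fun x hx => by
      simpa [keyWeight] using (hg x hx).zero
    simp only [relaxed, List.zipIdx_nil, List.foldl_nil, relEst, lt_irrefl, if_false]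
    rw [Finset.prod_congr rfl this]
    simp
  | append_singleton l e ih =>
    have hl' : ∀ e' ∈ l, 0 < e'.2 := fun e' he' => hl e' (by simp [he'])
    have he : 0 < e.2 := hl e (by simp)
    obtain ⟨W, hW⟩ := relaxed_bounded k hℓ A l hl'
    have hs := measurableState_relaxed k ℓ A l
    have hinvE : ∀ (ρ : RandCall 𝒳 → UnitOpen) x u r,
        relEntry (Function.update (Function.update ρ (.evictU l.length x) u) (.evictR l.length x) r)
          (relaxed k ℓ A l (Function.update (Function.update ρ (.evictU l.length x) u)
            (.evictR l.length x) r)) e l.length =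
        relEntry ρ (relaxed k ℓ A l ρ) e l.length := by
      intro ρ x u r
      rw [relaxed_update_evictR, relaxed_update_evictU]
      exact relEntry_congr (by simp)
    have h1 := integral_prod_relEst_evict hℓ (A := A) l.length (hs.relEntry e l.length)
      (fun ρ => (hW ρ).relEntry ρ he l.length) hinvE
      (p := fun s => s.level < ℓ ∧ (s.cached A).card = k + 1)
      ((hs.relEntry e l.length).measurableSet_full k ℓ A) g g' hg
    simp only [relaxed_append, relStep]
    rw [h1]
    by_cases heB : e.1 ∈ B
    · rw [integral_prod_relEst_entry l.length he hs hW
        (fun ρ u => relaxed_update_entry ρ u) g g' hg heB,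
        ih hl' g g' fun x hx => hg x (Finset.mem_of_mem_erase hx)]
      -- The induction hypothesis with the function at `e.1` shifted; its value g(w_x + w) − g(w)
      -- and the extra g(w) add up to the function at the new weight.
      have h2 := ih hl' (Function.update g e.1 fun c => g e.1 (c + e.2) - g e.1 e.2)
        (Function.update g' e.1 fun c => g' e.1 (c + e.2)) (by
          intro x hx
          by_cases hxe : x = e.1
          · subst hxe; simpa using (hg _ hx).shift he.le
          · simpa [Function.update_of_ne hxe] using hg x hx)
      have h3 : ∀ (h : 𝒳 → ℝ), (∀ x ∈ B.erase e.1, h x = g x (keyWeight l x)) →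
          ∏ x ∈ B, h x = h e.1 * ∏ x ∈ B.erase e.1, g x (keyWeight l x) := fun h hh => by
        rw [← Finset.mul_prod_erase B h heB, Finset.prod_congr rfl hh]
      have h4 : ∀ ρ, ∏ x ∈ B, relEst (Function.update g e.1
            (fun c => g e.1 (c + e.2) - g e.1 e.2) x)
            (Function.update g' e.1 (fun c => g' e.1 (c + e.2)) x) (relaxed k ℓ A l ρ) x =
          relEst (fun c => g e.1 (c + e.2) - g e.1 e.2) (fun c => g' e.1 (c + e.2))
            (relaxed k ℓ A l ρ) e.1 *
          ∏ x ∈ B.erase e.1, relEst (g x) (g' x) (relaxed k ℓ A l ρ) x := fun ρ => by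
        rw [← Finset.mul_prod_erase B _ heB]
        simp only [Function.update_self]
        congr 1
        refine Finset.prod_congr rfl fun x hx => ?_
        rw [Function.update_of_ne (Finset.ne_of_mem_erase hx),
          Function.update_of_ne (Finset.ne_of_mem_erase hx)]
      simp only [h4] at h2
      rw [h2, h3 _ fun x hx => by rw [Function.update_of_ne (Finset.ne_of_mem_erase hx)],
        h3 (fun x => g x (keyWeight (l ++ [e]) x)) fun x hx => by
          simp [keyWeight_append, (Finset.ne_of_mem_erase hx).symm]]
      simp only [Function.update_self, keyWeight_append, if_true]
      ring
    · have h5 : ∀ x ∈ B, x ≠ e.1 := fun x hx h => heB (h ▸ hx)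
      have h6 : ∏ x ∈ B, g x (keyWeight (l ++ [e]) x) = ∏ x ∈ B, g x (keyWeight l x) :=
        Finset.prod_congr rfl fun x hx => by simp [keyWeight_append, (h5 x hx).symm]
      rw [h6, ← ih hl' g g' hg]
      refine integral_congr_ae (.of_forall fun ρ => ?_)
      exact Finset.prod_congr rfl fun x hx => relEst_relEntry_of_ne (h5 x hx)

end Relaxed

/-! ### Inverse probability weights from the base hashes. -/

section Hash

variable {𝒳 : Type*} [DecidableEq 𝒳]

/-- The smallest hash in `C \ B` that exceeds at least `k - |B|` other hashes in `C \ B`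
(and `1` if there is none). -/
noncomputable def hashThreshold (k : ℕ) (A B C : Finset 𝒳) (h : 𝒳 → ℝ) : ℝ :=
  A.fold min 1 fun y =>
    if y ∈ C \ B ∧ k ≤ ((C \ B).filter fun z => h z < h y).card + B.card then h y else 1

theorem hashThreshold_pos {k : ℕ} {A B C : Finset 𝒳} {h : 𝒳 → ℝ} (h0 : ∀ x, 0 < h x) :
    0 < hashThreshold k A B C h := by
  refine (Finset.lt_fold_min _).2 ⟨one_pos, fun x _ => ?_⟩
  split_ifs
  · exact h0 x
  · exact one_pos

theorem hashThreshold_le_one {k : ℕ} {A B C : Finset 𝒳} {h : 𝒳 → ℝ} :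
    hashThreshold k A B C h ≤ 1 :=
  (Finset.fold_min_le _).2 (Or.inl le_rfl)

/-- This is why `B` is left out of the threshold: given the other hashes it is a constant for the
keys of `B`. -/
theorem hashThreshold_congr {k : ℕ} {A B C : Finset 𝒳} {h h' : 𝒳 → ℝ}
    (hh : ∀ x, x ∉ B → h x = h' x) : hashThreshold k A B C h = hashThreshold k A B C h' := by
  refine Finset.fold_congr fun y _ => ?_
  by_cases hy : y ∈ C \ B
  · have hyB := hh y (Finset.mem_sdiff.1 hy).2
    have : (C \ B).filter (fun z => h z < h y) = (C \ B).filter (fun z => h' z < h' y) :=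
      Finset.filter_congr fun z hz => by rw [hyB, hh z (Finset.mem_sdiff.1 hz).2]
    rw [this, hyB]
  · simp [hy]

theorem card_filter_sdiff_add {B C : Finset 𝒳} (hBC : B ⊆ C) (p : 𝒳 → Prop) [DecidablePred p] :
    ((C \ B).filter p).card + (B.filter p).card = (C.filter p).card := by
  rw [← Finset.card_union_of_disjoint
    (Finset.disjoint_filter_filter Finset.sdiff_disjoint), ← Finset.filter_union,
    Finset.sdiff_union_of_subset hBC]

/-- When all of `B` lies below `y`, exactly k − |B| keys of `C \ B` do too, so `y` qualifies; a
smaller hash has strictly fewer keys below it and does not. -/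
theorem hashThreshold_eq {k : ℕ} {A B C : Finset 𝒳} {h : 𝒳 → ℝ} (h1 : ∀ x, h x < 1)
    (hCA : C ⊆ A) (hBC : B ⊆ C) {y : 𝒳} (hy : y ∈ C)
    (hcard : (C.filter fun x => h x < h y).card = k) (hB : ∀ x ∈ B, h x < h y) :
    hashThreshold k A B C h = h y := by
  have hsplit := card_filter_sdiff_add hBC fun x => h x < h y
  rw [hcard, Finset.filter_true_of_mem hB] at hsplit
  have hyD : y ∈ C \ B := Finset.mem_sdiff.2 ⟨hy, fun hyB => lt_irrefl _ (hB y hyB)⟩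
  apply le_antisymm
  · refine (Finset.fold_min_le _).2 (Or.inr ⟨y, hCA hy, ?_⟩)
    rw [if_pos ⟨hyD, hsplit.ge⟩]
  · refine (Finset.le_fold_min _).2 ⟨(h1 y).le, fun z _ => ?_⟩
    split_ifs with hz
    · by_contra! hlt
      have : ((C \ B).filter fun x => h x < h z).card < ((C \ B).filter fun x => h x < h y).card := by
        refine Finset.card_lt_card ((Finset.ssubset_iff_of_subset ?_).2 ⟨z, ?_, ?_⟩)
        · exact Finset.monotone_filter_right _ fun x _ hx => lt_trans hx hlt
        · exact Finset.mem_filter.2 ⟨hz.1, hlt⟩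
        · simp
      omega
    · exact (h1 y).le

/-- If some key of `B` were not below `t`, more than k − |B| keys of `C \ B` would be. The largest
of these would then qualify for the threshold and push it below `t`, contradicting that key's
position. -/
theorem lt_of_lt_hashThreshold {k : ℕ} {A B C : Finset 𝒳} {h : 𝒳 → ℝ} (hinj : Set.InjOn h C)
    (hCA : C ⊆ A) (hBC : B ⊆ C) (hBk : B.card ≤ k) {t : ℝ}
    (hcard : (C.filter fun x => h x < t).card = k)
    (hB : ∀ x ∈ B, h x < hashThreshold k A B C h) : ∀ x ∈ B, h x < t := by
  by_contra! hcon
  obtain ⟨x, hxB, hx⟩ := hcon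
  have hsplit := card_filter_sdiff_add hBC fun x => h x < t
  rw [hcard] at hsplit
  have hlt : (B.filter fun x => h x < t).card < B.card :=
    Finset.card_lt_card ((Finset.ssubset_iff_of_subset (Finset.filter_subset _ _)).2
      ⟨x, hxB, by simp [hx]⟩)
  have hne : ((C \ B).filter fun x => h x < t).Nonempty := by
    rw [← Finset.card_pos]; omega
  obtain ⟨y, hy, hmax⟩ := Finset.exists_max_image _ h hne
  have hyD := (Finset.mem_filter.1 hy).1
  have hsub : ((C \ B).filter fun x => h x < t).erase y ⊆ (C \ B).filter fun x => h x < h y := by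
    intro z hz
    obtain ⟨hzy, hz⟩ := Finset.mem_erase.1 hz
    have hzD := (Finset.mem_filter.1 hz).1
    refine Finset.mem_filter.2 ⟨hzD, lt_of_le_of_ne (hmax z hz) fun heq => hzy ?_⟩
    exact hinj (Finset.mem_sdiff.1 hzD).1 (Finset.mem_sdiff.1 hyD).1 heq
  have hc := Finset.card_le_card hsub
  rw [Finset.card_erase_of_mem hy] at hc
  have hle : hashThreshold k A B C h ≤ h y := by
    refine (Finset.fold_min_le _).2 (Or.inr ⟨y, hCA (Finset.mem_sdiff.1 hyD).1, ?_⟩)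
    rw [if_pos ⟨hyD, by omega⟩]
  have := hB x hxB
  have := (Finset.mem_filter.1 hy).2
  linarith

/-- The hash of a key. -/
def hashOf (ρ : RandCall 𝒳 → UnitOpen) (x : 𝒳) : ℝ := ρ (.hash x)

/-- The inverse probability weight of a key `x ∈ B` due to its hash. -/
noncomputable def hashWeight (k : ℕ) (ℓ : ℝ) (A B : Finset 𝒳) (s : RelaxedState 𝒳)
    (ρ : RandCall 𝒳 → UnitOpen) (x : 𝒳) : ℝ :=
  if s.level < ℓ then 1
  else if hashOf ρ x < hashThreshold k A B (s.cached A) (hashOf ρ) then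
    (hashThreshold k A B (s.cached A) (hashOf ρ))⁻¹ else 0

theorem hashWeight_nonneg {k : ℕ} {ℓ : ℝ} {A B : Finset 𝒳} {s : RelaxedState 𝒳}
    {ρ : RandCall 𝒳 → UnitOpen} {x : 𝒳} : 0 ≤ hashWeight k ℓ A B s ρ x := by
  have := hashThreshold_pos (k := k) (A := A) (B := B) (C := s.cached A) (h := hashOf ρ)
    fun x => (ρ (.hash x)).2.1
  unfold hashWeight
  split_ifs <;> positivity

theorem MeasurableState.hashThreshold {s : (RandCall 𝒳 → UnitOpen) → RelaxedState 𝒳}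
    (hs : MeasurableState s) (k : ℕ) (A B : Finset 𝒳) :
    Measurable fun ρ => hashThreshold k A B ((s ρ).cached A) (hashOf ρ) := by
  have hmem : ∀ y, MeasurableSet {ρ | y ∈ (s ρ).cached A \ B} := by
    intro y
    simp only [RelaxedState.cached, Finset.mem_sdiff, Finset.mem_filter, Set.ofPred_and]
    exact (MeasurableSet.inter (.const _) (hs.measurableSet_pos y)).inter (.const _)
  have hh : ∀ y : 𝒳, Measurable fun ρ : RandCall 𝒳 → UnitOpen => hashOf ρ y :=
    fun y => measurable_call (.hash y)
  refine measurable_fold_min A 1 fun y _ => Measurable.ite ?_ (hh y) measurable_const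
  refine (hmem y).inter ?_
  have : ∀ ρ, ((s ρ).cached A \ B).filter (fun z => hashOf ρ z < hashOf ρ y) =
      A.filter fun z => z ∈ (s ρ).cached A \ B ∧ hashOf ρ z < hashOf ρ y := by
    intro ρ
    ext z
    simp only [RelaxedState.cached, Finset.mem_sdiff, Finset.mem_filter]
    tauto
  simp only [this]
  have hc : Measurable fun ρ => (A.filter fun z => z ∈ (s ρ).cached A \ B ∧
      hashOf ρ z < hashOf ρ y).card + B.card :=
    (measurable_card_filter A (p := fun ρ z => z ∈ (s ρ).cached A \ B ∧
      hashOf ρ z < hashOf ρ y) fun z _ => (hmem z).inter (measurableSet_lt (hh z) (hh y))).add_const _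
  exact measurableSet_le measurable_const hc

theorem MeasurableState.hashWeight {s : (RandCall 𝒳 → UnitOpen) → RelaxedState 𝒳}
    (hs : MeasurableState s) (k : ℕ) (ℓ : ℝ) (A B : Finset 𝒳) (x : 𝒳) :
    Measurable fun ρ => hashWeight k ℓ A B (s ρ) ρ x := by
  have hm := hs.hashThreshold k A B
  exact Measurable.ite (measurableSet_lt hs.level measurable_const) measurable_const
    (Measurable.ite (measurableSet_lt (measurable_call (.hash x)) hm) hm.inv measurable_const)

theorem lintegral_inverse_probability {m : ℝ} (h0 : 0 < m) (h1 : m ≤ 1) :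
    ∫⁻ u : UnitOpen, ENNReal.ofReal (if (u : ℝ) < m then m⁻¹ else 0) ∂unitMeasure = 1 := by
  rw [lintegral_unitOpen fun u => ENNReal.ofReal (if u < m then m⁻¹ else 0)]
  have : ∀ u, ENNReal.ofReal (if u < m then m⁻¹ else 0) =
      (Set.Iio m).indicator (fun _ => ENNReal.ofReal m⁻¹) u := by
    intro u
    by_cases h : u < m <;> simp [h]
  simp only [this]
  rw [lintegral_indicator measurableSet_Iio, setLIntegral_const,
    Measure.restrict_apply measurableSet_Iio]
  have : Set.Iio m ∩ Set.Ioo 0 1 = Set.Ioo 0 m := by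
    ext u; simp only [Set.mem_inter_iff, Set.mem_Iio, Set.mem_Ioo]
    constructor
    · rintro ⟨a, b, c⟩; exact ⟨b, a⟩
    · rintro ⟨a, b⟩; exact ⟨b, a, by linarith⟩
  rw [this, Real.volume_Ioo, sub_zero, ← ENNReal.ofReal_mul (by positivity),
    inv_mul_cancel₀ h0.ne', ENNReal.ofReal_one]

/-- Given the relaxed state and the hashes outside `B`, the hash of a key of `B` falls below the
threshold m with probability m, and its weight is then 1/m. -/
theorem lintegral_mul_prod_hashWeight {s : (RandCall 𝒳 → UnitOpen) → RelaxedState 𝒳}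
    (hs : MeasurableState s) (hinv : ∀ ρ x u, s (Function.update ρ (.hash x) u) = s ρ)
    (k : ℕ) (ℓ : ℝ) (A B : Finset 𝒳) {Z : (RandCall 𝒳 → UnitOpen) → ℝ≥0∞} (hZ : Measurable Z)
    (hinvZ : ∀ ρ x u, Z (Function.update ρ (.hash x) u) = Z ρ) :
    ∫⁻ ρ, Z ρ * ∏ x ∈ B, ENNReal.ofReal (hashWeight k ℓ A B (s ρ) ρ x)
      ∂(Measure.infinitePi fun _ => unitMeasure) =
    ∫⁻ ρ, Z ρ ∂(Measure.infinitePi fun _ => unitMeasure) := by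
  have hne : ∀ {x y : 𝒳}, y ≠ x → ∀ (ρ : RandCall 𝒳 → UnitOpen) u,
      hashOf (Function.update ρ (.hash x) u) y = hashOf ρ y := by
    intro x y hyx ρ u
    simp [hashOf, hyx]
  have hthr : ∀ x ∈ B, ∀ (ρ : RandCall 𝒳 → UnitOpen) u (C : Finset 𝒳),
      hashThreshold k A B C (hashOf (Function.update ρ (.hash x) u)) =
        hashThreshold k A B C (hashOf ρ) := fun x hx ρ u C =>
    hashThreshold_congr fun y hy => hne (fun h : y = x => hy (h ▸ hx)) ρ u
  refine lintegral_mul_prod_resample unitMeasure RandCall.hash B Z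
    (fun x ρ => ENNReal.ofReal (hashWeight k ℓ A B (s ρ) ρ x)) hZ
    (fun x _ => (hs.hashWeight k ℓ A B x).ennreal_ofReal) ?_ ?_ fun x _ ρ u => hinvZ ρ x u
  · intro x hx ρ
    simp only [hinv, hashWeight, hthr x hx]
    split_ifs
    · simp
    · simp only [hashOf, Function.update_self]
      exact lintegral_inverse_probability (hashThreshold_pos fun x => (ρ (.hash x)).2.1)
        hashThreshold_le_one
  · intro x hx y hy hyx ρ u
    simp only [hinv, hashWeight, hthr x hx, hne hyx]

/-- The weights are nonnegative, so the `ℝ≥0∞` identity applied to |F| gives integrability, and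
applied to the positive and negative parts of F it gives the value. -/
theorem integral_mul_prod_hashWeight {s : (RandCall 𝒳 → UnitOpen) → RelaxedState 𝒳}
    (hs : MeasurableState s) (hinv : ∀ ρ x u, s (Function.update ρ (.hash x) u) = s ρ)
    (k : ℕ) (ℓ : ℝ) (A B : Finset 𝒳) {F : (RandCall 𝒳 → UnitOpen) → ℝ} (hF : Measurable F)
    (hFb : ∃ K, ∀ ρ, |F ρ| ≤ K) (hinvF : ∀ ρ x u, F (Function.update ρ (.hash x) u) = F ρ) :
    Integrable (fun ρ => F ρ * ∏ x ∈ B, hashWeight k ℓ A B (s ρ) ρ x)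
      (Measure.infinitePi fun _ => unitMeasure) ∧
    ∫ ρ, F ρ * ∏ x ∈ B, hashWeight k ℓ A B (s ρ) ρ x
      ∂(Measure.infinitePi fun _ => unitMeasure) =
    ∫ ρ, F ρ ∂(Measure.infinitePi fun _ => unitMeasure) := by
  have hFi := integrable_of_measurable_bounded (μ := Measure.infinitePi fun _ => unitMeasure) hF hFb
  have hw : ∀ ρ, 0 ≤ ∏ x ∈ B, hashWeight k ℓ A B (s ρ) ρ x :=
    fun ρ => Finset.prod_nonneg fun x _ => hashWeight_nonneg
  have hofReal : ∀ (G : (RandCall 𝒳 → UnitOpen) → ℝ) ρ,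
      ENNReal.ofReal (G ρ * ∏ x ∈ B, hashWeight k ℓ A B (s ρ) ρ x) =
        ENNReal.ofReal (G ρ) * ∏ x ∈ B, ENNReal.ofReal (hashWeight k ℓ A B (s ρ) ρ x) := by
    intro G ρ
    rw [ENNReal.ofReal_mul' (hw ρ), ENNReal.ofReal_prod_of_nonneg fun x _ => hashWeight_nonneg]
  have hpart : ∀ G : (RandCall 𝒳 → UnitOpen) → ℝ, Measurable G →
      (∀ ρ x u, G (Function.update ρ (.hash x) u) = G ρ) →
      ∫⁻ ρ, ENNReal.ofReal (G ρ * ∏ x ∈ B, hashWeight k ℓ A B (s ρ) ρ x)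
        ∂(Measure.infinitePi fun _ => unitMeasure) =
      ∫⁻ ρ, ENNReal.ofReal (G ρ) ∂(Measure.infinitePi fun _ => unitMeasure) := by
    intro G hG hGi
    simp only [hofReal]
    exact lintegral_mul_prod_hashWeight hs hinv k ℓ A B hG.ennreal_ofReal
      fun ρ x u => by rw [hGi]
  have hmeas : Measurable fun ρ => F ρ * ∏ x ∈ B, hashWeight k ℓ A B (s ρ) ρ x :=
    hF.mul (Finset.measurable_fun_prod B fun x _ => hs.hashWeight k ℓ A B x)
  have hint : Integrable (fun ρ => F ρ * ∏ x ∈ B, hashWeight k ℓ A B (s ρ) ρ x)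
      (Measure.infinitePi fun _ => unitMeasure) := by
    refine ⟨hmeas.aestronglyMeasurable, ?_⟩
    rw [hasFiniteIntegral_iff_norm]
    have : ∀ ρ, ‖F ρ * ∏ x ∈ B, hashWeight k ℓ A B (s ρ) ρ x‖ =
        |F ρ| * ∏ x ∈ B, hashWeight k ℓ A B (s ρ) ρ x := fun ρ => by
      rw [Real.norm_eq_abs, abs_mul, abs_of_nonneg (hw ρ)]
    simp only [this]
    rw [hpart (fun ρ => |F ρ|) hF.abs fun ρ x u => by rw [hinvF]]
    exact (hasFiniteIntegral_iff_norm _).1 hFi.2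
  refine ⟨hint, ?_⟩
  rw [integral_eq_lintegral_pos_part_sub_lintegral_neg_part hint,
    integral_eq_lintegral_pos_part_sub_lintegral_neg_part hFi, hpart F hF hinvF]
  have hneg : ∀ ρ, -(F ρ * ∏ x ∈ B, hashWeight k ℓ A B (s ρ) ρ x) =
      (-F ρ) * ∏ x ∈ B, hashWeight k ℓ A B (s ρ) ρ x := fun ρ => by ring
  simp only [hneg]
  rw [hpart (fun ρ => -F ρ) hF.neg fun ρ x u => by rw [hinvF]]

end Hash

/-! ### Thresholds in `ℝ≥0∞` -/

theorem inv_ofReal_mul_ofReal {a b : ℝ} (hb : 0 < b) :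
    (ENNReal.ofReal a)⁻¹ * ENNReal.ofReal b = (ENNReal.ofReal (a / b))⁻¹ := by
  rw [ENNReal.ofReal_div_of_pos hb, ENNReal.inv_div (by simp) (by simp [hb]), mul_comm,
    div_eq_mul_inv]

theorem inv_ofReal_lt_inv_ofReal {a b : ℝ} (ha : 0 < a) :
    (ENNReal.ofReal a)⁻¹ < (ENNReal.ofReal b)⁻¹ ↔ b < a := by
  rw [ENNReal.inv_lt_inv, ENNReal.ofReal_lt_ofReal_iff ha]

theorem inv_ofReal_le_inv_ofReal {a b : ℝ} (hb : 0 < b) :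
    (ENNReal.ofReal a)⁻¹ ≤ (ENNReal.ofReal b)⁻¹ ↔ b ≤ a := by
  rw [← not_lt, inv_ofReal_lt_inv_ofReal hb, not_lt]

theorem one_lt_inv_ofReal_mul {a ℓ : ℝ} (hℓ : 0 < ℓ) :
    1 < (ENNReal.ofReal a)⁻¹ * ENNReal.ofReal ℓ ↔ a < ℓ := by
  rw [inv_ofReal_mul_ofReal hℓ]
  have : (1 : ℝ≥0∞) = (ENNReal.ofReal 1)⁻¹ := by simp
  rw [this, inv_ofReal_lt_inv_ofReal one_pos, div_lt_one hℓ]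

theorem expDraw_inv_ofReal (u : UnitOpen) {m : ℝ} (hm : 0 ≤ m) :
    expDraw u (ENNReal.ofReal m)⁻¹ = stdExp u * m := by
  have : 0 ≤ -Real.log (1 - (u : ℝ)) := (stdExp_pos u).le
  unfold expDraw
  rw [div_eq_mul_inv, inv_inv, ENNReal.toReal_mul, ENNReal.toReal_ofReal hm,
    ENNReal.toReal_ofReal this]
  rfl

/-! ### Coupling of the algorithm with the relaxed process. -/

section Coupling

variable {𝒳 : Type*} [DecidableEq 𝒳]

/-- The sampling algorithm and the relaxed process are in corresponding states. -/
inductive Coupled (k : ℕ) (ℓ : ℝ) (A : Finset 𝒳) (ρ : RandCall 𝒳 → UnitOpen) (st : State 𝒳)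
    (s : RelaxedState 𝒳) : Prop
  | above (hlevel : s.level < ℓ) (hτ : st.τ = (ENNReal.ofReal s.level)⁻¹)
      (hkeys : st.keys = s.cached A) (hcount : ∀ x ∈ A, st.count x = s.count x)
      (hle : st.keys.card ≤ k) (hcard : 0 < s.level → st.keys.card = k)
  | below (hlevel : s.level = ℓ) (y : 𝒳) (hy : y ∈ s.cached A)
      (hτ : st.τ = ENNReal.ofReal (hashOf ρ y / ℓ))
      (hkeys : st.keys = (s.cached A).filter fun x => hashOf ρ x < hashOf ρ y)
      (hcount : ∀ x ∈ st.keys, st.count x = s.count x) (hcard : st.keys.card = k)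

theorem argmaxKey_mem {S : Finset 𝒳} (hS : S.Nonempty) (z : 𝒳 → ℝ≥0∞) : argmaxKey S hS z ∈ S :=
  (S.exists_max_image z hS).choose_spec.1

theorem le_argmaxKey {S : Finset 𝒳} (hS : S.Nonempty) (z : 𝒳 → ℝ≥0∞) {x : 𝒳} (hx : x ∈ S) :
    z x ≤ z (argmaxKey S hS z) :=
  (S.exists_max_image z hS).choose_spec.2 x hx

theorem mem_cached {s : RelaxedState 𝒳} {A : Finset 𝒳} {x : 𝒳} :
    x ∈ s.cached A ↔ x ∈ A ∧ 0 < s.count x :=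
  Finset.mem_filter

/-- The random numbers `r` agree with `ρ` on all calls that concern the first `n` elements and the
keys in `A`. -/
structure Agree (n : ℕ) (A : Finset 𝒳) (r : RandCall 𝒳 → ℝ) (ρ : RandCall 𝒳 → UnitOpen) : Prop where
  hash : ∀ x ∈ A, r (.hash x) = ρ (.hash x)
  entry : ∀ i < n, r (.entry i) = ρ (.entry i)
  evictU : ∀ i < n, ∀ x ∈ A, r (.evictU i x) = ρ (.evictU i x)
  evictR : ∀ i < n, ∀ x ∈ A, r (.evictR i x) = ρ (.evictR i x)

/-- No two cached keys have the same inverse threshold, and no inverse threshold equals `ℓ`. -/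
def NoTies (ℓ : ℝ) (A : Finset 𝒳) (ρ : RandCall 𝒳 → UnitOpen) (i : ℕ) (s : RelaxedState 𝒳) :
    Prop :=
  ∀ x ∈ A, 0 < s.count x → invThreshold ρ i s x ≠ ℓ ∧
    ∀ y ∈ A, y ≠ x → invThreshold ρ i s x ≠ invThreshold ρ i s y

theorem keyBase_of_agree {n : ℕ} {A : Finset 𝒳} {r : RandCall 𝒳 → ℝ} {ρ : RandCall 𝒳 → UnitOpen}
    (h : Agree n A r ρ) (ℓ : ℝ) {x : 𝒳} (hx : x ∈ A) :
    keyBase ℓ r x = ENNReal.ofReal (hashOf ρ x / ℓ) := by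
  unfold keyBase hashOf; rw [h.hash x hx]

theorem hashOf_pos (ρ : RandCall 𝒳 → UnitOpen) (x : 𝒳) : 0 < hashOf ρ x := (ρ (.hash x)).2.1

theorem hashOf_lt_one (ρ : RandCall 𝒳 → UnitOpen) (x : 𝒳) : hashOf ρ x < 1 := (ρ (.hash x)).2.2

theorem ofReal_hashOf_le_iff {ℓ : ℝ} (hℓ : 0 < ℓ) {ρ : RandCall 𝒳 → UnitOpen} {x y : 𝒳} :
    ENNReal.ofReal (hashOf ρ x / ℓ) ≤ ENNReal.ofReal (hashOf ρ y / ℓ) ↔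
      hashOf ρ x ≤ hashOf ρ y := by
  rw [ENNReal.ofReal_le_ofReal_iff (div_nonneg (hashOf_pos ρ y).le hℓ.le),
    div_le_div_iff_of_pos_right hℓ]

theorem keyBase_le {ℓ : ℝ} (hℓ : 0 < ℓ) (ρ : RandCall 𝒳 → UnitOpen) (x : 𝒳) :
    ENNReal.ofReal (hashOf ρ x / ℓ) ≤ (ENNReal.ofReal ℓ)⁻¹ := by
  rw [← ENNReal.ofReal_inv_of_pos hℓ, inv_eq_one_div]
  exact ENNReal.ofReal_le_ofReal (div_le_div_of_nonneg_right (hashOf_lt_one ρ x).le hℓ.le)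

/-- Passing to reciprocals turns the minimum defining the threshold into the maximum in
`invThreshold`, and the test against 1/ℓ into a test against ℓ. -/
theorem evictionThreshold_eq {n i : ℕ} (hi : i < n) {A : Finset 𝒳} {r : RandCall 𝒳 → ℝ}
    {ρ : RandCall 𝒳 → UnitOpen} (h : Agree n A r ρ) {ℓ : ℝ} (hℓ : 0 < ℓ) {st : State 𝒳}
    {s : RelaxedState 𝒳} (hτ : st.τ = (ENNReal.ofReal s.level)⁻¹) {x : 𝒳} (hx : x ∈ A)
    (hcount : st.count x = s.count x) :
    evictionThreshold ℓ r i st x = if ℓ ≤ invThreshold ρ i s x then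
      ENNReal.ofReal (hashOf ρ x / ℓ) else (ENNReal.ofReal (invThreshold ρ i s x))⁻¹ := by
  have hz : min (st.τ * ENNReal.ofReal (r (.evictU i x)))
      (ENNReal.ofReal (-Real.log (1 - r (.evictR i x))) / ENNReal.ofReal (st.count x)) =
      (ENNReal.ofReal (invThreshold ρ i s x))⁻¹ := by
    rw [hτ, h.evictU i hi x hx, h.evictR i hi x hx, hcount, invThreshold,
      inv_ofReal_mul_ofReal (ρ (.evictU i x)).2.1]
    have : ENNReal.ofReal (-Real.log (1 - (ρ (.evictR i x) : ℝ))) / ENNReal.ofReal (s.count x) =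
        (ENNReal.ofReal (s.count x / stdExp (ρ (.evictR i x))))⁻¹ := by
      rw [← inv_ofReal_mul_ofReal (stdExp_pos _), mul_comm, div_eq_mul_inv]; rfl
    rw [this, ENNReal.ofReal_mono.map_max]
    rcases le_total (ENNReal.ofReal (s.level / (ρ (.evictU i x) : ℝ)))
      (ENNReal.ofReal (s.count x / stdExp (ρ (.evictR i x)))) with hle | hle
    · rw [max_eq_right hle, min_eq_right (ENNReal.inv_le_inv.2 hle)]
    · rw [max_eq_left hle, min_eq_left (ENNReal.inv_le_inv.2 hle)]
  unfold evictionThreshold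
  simp only [hz, ENNReal.ofReal_inv_of_pos hℓ, inv_ofReal_le_inv_ofReal hℓ,
    keyBase_of_agree h ℓ hx]

/-- The largest threshold is the smallest inverse threshold. If that is below ℓ, both processes drop
the same key. If all inverse thresholds exceed ℓ, the algorithm compares hashes and drops the
largest, while the relaxed process keeps all keys and freezes its level. -/
theorem coupled_evict {n i k : ℕ} (hi : i < n) {A : Finset 𝒳} {r : RandCall 𝒳 → ℝ}
    {ρ : RandCall 𝒳 → UnitOpen} (h : Agree n A r ρ) (hinj : Set.InjOn (hashOf ρ) A) {ℓ : ℝ}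
    (hℓ : 0 < ℓ) {st : State 𝒳} {s : RelaxedState 𝒳} (hlevel : s.level < ℓ) (hties : NoTies ℓ A ρ i s)
    (hτ : st.τ = (ENNReal.ofReal s.level)⁻¹) (hkeys : st.keys = s.cached A)
    (hcount : ∀ x ∈ A, st.count x = s.count x) (hcard : st.keys.card = k + 1)
    (hne : st.keys.Nonempty) :
    Coupled k ℓ A ρ (evict ℓ r i st hne) (relEvict ℓ A ρ i s) := by
  have hmem : ∀ {x}, x ∈ st.keys ↔ x ∈ A ∧ 0 < s.count x := by
    intro x; rw [hkeys, mem_cached]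
  set L := evictLevel ℓ A ρ i s with hL
  have hLpos : 0 < L := evictLevel_pos hℓ
  have hz : ∀ x ∈ st.keys, evictionThreshold ℓ r i st x = if ℓ ≤ invThreshold ρ i s x then
      ENNReal.ofReal (hashOf ρ x / ℓ) else (ENNReal.ofReal (invThreshold ρ i s x))⁻¹ :=
    fun x hx => evictionThreshold_eq hi h hℓ hτ (hmem.1 hx).1 (hcount x (hmem.1 hx).1)
  set y := argmaxKey st.keys hne (evictionThreshold ℓ r i st) with hy
  have hyk : y ∈ st.keys := argmaxKey_mem hne _
  have hmax : ∀ x ∈ st.keys, evictionThreshold ℓ r i st x ≤ evictionThreshold ℓ r i st y :=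
    fun x hx => le_argmaxKey hne _ hx
  have hlarge : 1 < st.τ * ENNReal.ofReal ℓ := by rwa [hτ, one_lt_inv_ofReal_mul hℓ]
  have hev : evict ℓ r i st hne =
      { τ := evictionThreshold ℓ r i st y
        keys := st.keys.erase y
        count := fun x => if x ∈ st.keys.erase y then
          if max (evictionThreshold ℓ r i st y) (ENNReal.ofReal ℓ⁻¹) / st.τ <
            ENNReal.ofReal (r (.evictU i x)) then
            st.count x - expDraw (r (.evictR i x))
              (max (evictionThreshold ℓ r i st y) (ENNReal.ofReal ℓ⁻¹))
          else st.count x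
        else 0 } := by
    unfold evict
    rw [if_pos hlarge]
  have hcnt : max (evictionThreshold ℓ r i st y) (ENNReal.ofReal ℓ⁻¹) = (ENNReal.ofReal L)⁻¹ →
      ∀ x ∈ st.keys.erase y, L < invThreshold ρ i s x →
      (evict ℓ r i st hne).count x = (relEvict ℓ A ρ i s).count x := by
    intro hrate x hx hLx
    obtain ⟨hxA, hxc⟩ := hmem.1 (Finset.mem_of_mem_erase hx)
    rw [hev]
    simp only [hx, if_true, hrate, relEvict, ← hL, hxc, hLx, and_self, evictCount]
    rw [h.evictU i hi x hxA, h.evictR i hi x hxA, expDraw_inv_ofReal _ hLpos.le, hcount x hxA]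
    have hcmp : (ENNReal.ofReal L)⁻¹ / st.τ < ENNReal.ofReal (ρ (.evictU i x)) ↔
        s.level / L < ρ (.evictU i x) := by
      rw [hτ, div_eq_mul_inv, inv_inv, mul_comm, ← div_eq_mul_inv,
        ← ENNReal.ofReal_div_of_pos hLpos, ENNReal.ofReal_lt_ofReal_iff (ρ (.evictU i x)).2.1]
    by_cases hu : s.level / L < ρ (.evictU i x)
    · rw [if_pos (hcmp.2 hu), if_neg (not_le.2 hu)]
    · rw [if_neg (fun h => hu (hcmp.1 h)), if_pos (not_lt.1 hu)]
  rcases lt_or_ge L ℓ with hLℓ | hLℓ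
  · obtain ⟨x₀, hx₀A, hx₀⟩ : ∃ x ∈ A, (if 0 < s.count x then invThreshold ρ i s x else ℓ) ≤ L :=
      ((Finset.fold_min_le _).1 hL.ge).resolve_left (not_le.2 hLℓ)
    have hx₀c : 0 < s.count x₀ := by
      by_contra hc
      rw [if_neg hc] at hx₀
      linarith
    rw [if_pos hx₀c] at hx₀
    have hzx₀ := hz x₀ (hmem.2 ⟨hx₀A, hx₀c⟩)
    rw [if_neg (not_le.2 (lt_of_le_of_lt hx₀ hLℓ))] at hzx₀
    have hge := hmax x₀ (hmem.2 ⟨hx₀A, hx₀c⟩)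
    rw [hzx₀] at hge
    have hx₀pos : 0 < invThreshold ρ i s x₀ :=
      lt_of_lt_of_le hLpos (evictLevel_le_invThreshold hx₀A hx₀c)
    -- A threshold replaced by a base hash is at most 1/ℓ, so it cannot beat that of `x₀`.
    have hyℓ : ¬ ℓ ≤ invThreshold ρ i s y := by
      intro hle
      rw [hz y hyk, if_pos hle] at hge
      have := hge.trans (keyBase_le hℓ ρ y)
      rw [inv_ofReal_le_inv_ofReal hℓ] at this
      linarith
    have hzy := hz y hyk
    rw [if_neg hyℓ] at hzy
    have hyL : invThreshold ρ i s y = L := by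
      have hypos : 0 < invThreshold ρ i s y :=
        lt_of_lt_of_le hLpos (evictLevel_le_invThreshold (hmem.1 hyk).1 (hmem.1 hyk).2)
      rw [hzy, inv_ofReal_le_inv_ofReal hypos] at hge
      exact le_antisymm (hge.trans hx₀) (evictLevel_le_invThreshold (hmem.1 hyk).1 (hmem.1 hyk).2)
    rw [hyL] at hzy
    have hrate : max (evictionThreshold ℓ r i st y) (ENNReal.ofReal ℓ⁻¹) =
        (ENNReal.ofReal L)⁻¹ := by
      rw [hzy, ENNReal.ofReal_inv_of_pos hℓ]
      exact max_eq_left ((inv_ofReal_le_inv_ofReal hLpos).2 hLℓ.le)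
    have hsurv : ∀ x, x ∈ st.keys.erase y ↔ x ∈ st.keys ∧ L < invThreshold ρ i s x := by
      intro x
      rw [Finset.mem_erase]
      constructor
      · rintro ⟨hxy, hx⟩
        refine ⟨hx, lt_of_le_of_ne (evictLevel_le_invThreshold (hmem.1 hx).1 (hmem.1 hx).2) ?_⟩
        rw [← hyL]
        exact (hties y (hmem.1 hyk).1 (hmem.1 hyk).2).2 x (hmem.1 hx).1 hxy
      · rintro ⟨hx, hlt⟩
        refine ⟨fun hxy => ?_, hx⟩
        rw [hxy, hyL] at hlt
        exact lt_irrefl _ hlt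
    have hcard' : (st.keys.erase y).card = k := by
      rw [Finset.card_erase_of_mem hyk, hcard]; rfl
    refine Coupled.above hLℓ (by rw [hev]; exact hzy) ?_ ?_ (by rw [hev]; exact hcard'.le)
      (fun _ => by rw [hev]; exact hcard')
    · rw [hev]
      ext x
      rw [hsurv, mem_cached, relEvict_count_pos_iff hℓ, hmem, and_assoc]
    · intro x hxA
      by_cases hx : x ∈ st.keys.erase y
      · exact hcnt hrate x hx ((hsurv x).1 hx).2
      · rw [hev]
        simp only [hx, if_false, relEvict]
        rw [if_neg]
        rintro ⟨h1, h2⟩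
        exact hx ((hsurv x).2 ⟨hmem.2 ⟨hxA, h1⟩, h2⟩)
  -- The crossing of 1/ℓ: the evicted `y` stays cached in the relaxed process and serves as the key
  -- of (k + 1)-st smallest hash.
  · have hLeq : L = ℓ := le_antisymm evictLevel_le hLℓ
    have hgt : ∀ x ∈ st.keys, L < invThreshold ρ i s x := by
      intro x hx
      refine lt_of_le_of_ne (evictLevel_le_invThreshold (hmem.1 hx).1 (hmem.1 hx).2) ?_
      rw [hLeq]
      exact (hties x (hmem.1 hx).1 (hmem.1 hx).2).1.symm
    have hz' : ∀ x ∈ st.keys, evictionThreshold ℓ r i st x = ENNReal.ofReal (hashOf ρ x / ℓ) := by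
      intro x hx
      rw [hz x hx, if_pos (hLeq ▸ (hgt x hx).le)]
    have hcach : (relEvict ℓ A ρ i s).cached A = st.keys := by
      ext x
      rw [mem_cached, relEvict_count_pos_iff hℓ, hmem]
      refine and_congr_right fun hxA => ⟨fun h => h.1, fun hc => ⟨hc, hgt x (hmem.2 ⟨hxA, hc⟩)⟩⟩
    have hrate : max (evictionThreshold ℓ r i st y) (ENNReal.ofReal ℓ⁻¹) =
        (ENNReal.ofReal L)⁻¹ := by
      rw [hz' y hyk, ENNReal.ofReal_inv_of_pos hℓ, hLeq]
      exact max_eq_right (keyBase_le hℓ ρ y)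
    refine Coupled.below hLeq y (hcach ▸ hyk) (by rw [hev]; exact hz' y hyk) ?_ ?_ ?_
    · rw [hcach, hev]
      ext x
      simp only [Finset.mem_erase, Finset.mem_filter]
      constructor
      · rintro ⟨hxy, hx⟩
        refine ⟨hx, lt_of_le_of_ne ?_ fun heq => hxy (hinj (hmem.1 hx).1 (hmem.1 hyk).1 heq)⟩
        have := hmax x hx
        rwa [hz' x hx, hz' y hyk, ofReal_hashOf_le_iff hℓ] at this
      · rintro ⟨hx, hlt⟩
        exact ⟨fun hxy => lt_irrefl _ (hxy ▸ hlt), hx⟩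
    · intro x hx
      have hx' : x ∈ st.keys.erase y := by rw [hev] at hx; exact hx
      exact hcnt hrate x hx' (hgt x (Finset.mem_of_mem_erase hx'))
    · rw [hev]
      show (st.keys.erase y).card = k
      rw [Finset.card_erase_of_mem hyk, hcard]; rfl

end Coupling

section Coupling

variable {𝒳 : Type*} [DecidableEq 𝒳]

theorem relEntry_of_cached {ρ : RandCall 𝒳 → UnitOpen} {s : RelaxedState 𝒳} {e : 𝒳 × ℝ} {i : ℕ}
    (hc : 0 < s.count e.1) : relEntry ρ s e i =
      { level := s.level, count := Function.update s.count e.1 (s.count e.1 + e.2) } := by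
  simp [relEntry, hc]

theorem relEntry_of_lt {ρ : RandCall 𝒳 → UnitOpen} {s : RelaxedState 𝒳} {e : 𝒳 × ℝ} {i : ℕ}
    (hc : ¬ 0 < s.count e.1) (hΔ : stdExp (ρ (.entry i)) * s.level < e.2) : relEntry ρ s e i =
      { level := s.level,
        count := Function.update s.count e.1 (e.2 - stdExp (ρ (.entry i)) * s.level) } := by
  simp [relEntry, hc, max_eq_right (sub_pos.2 hΔ).le]

theorem relEntry_of_le {ρ : RandCall 𝒳 → UnitOpen} {s : RelaxedState 𝒳} {e : 𝒳 × ℝ} {i : ℕ}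
    (hc : s.count e.1 = 0) (hΔ : ¬ stdExp (ρ (.entry i)) * s.level < e.2) :
    relEntry ρ s e i = s := by
  have : max 0 (e.2 - stdExp (ρ (.entry i)) * s.level) = s.count e.1 := by
    rw [max_eq_left (sub_nonpos.2 (not_lt.1 hΔ)), hc]
  simp only [relEntry, hc, lt_irrefl, if_false]
  rw [this, Function.update_eq_self]

theorem cached_update {A : Finset 𝒳} {s : RelaxedState 𝒳} {x : 𝒳} {c m : ℝ} (hx : x ∈ A)
    (hc : 0 < c) :
    RelaxedState.cached { level := m, count := Function.update s.count x c } A =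
      insert x (s.cached A) := by
  ext y
  rw [mem_cached, Finset.mem_insert, mem_cached]
  by_cases hy : y = x
  · subst hy; simp [hx, hc]
  · simp [hy]

/-- Above 1/ℓ the two processes move together. Below it the real cache is the set of relaxed cached
keys with hash under that of `y`, and this persists: a key with a larger hash is refused, and one
with a smaller hash lowers the threshold to the largest hash in the enlarged cache. -/
theorem coupled_step {n i k : ℕ} (hi : i < n) {A : Finset 𝒳} {r : RandCall 𝒳 → ℝ}
    {ρ : RandCall 𝒳 → UnitOpen} (h : Agree n A r ρ) (hinj : Set.InjOn (hashOf ρ) A) {ℓ W : ℝ}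
    (hℓ : 0 < ℓ) {st : State 𝒳} {s : RelaxedState 𝒳} (hs : s.Bounded ℓ W) {e : 𝒳 × ℝ}
    (heA : e.1 ∈ A) (he : 0 < e.2) (hties : NoTies ℓ A ρ i (relEntry ρ s e i))
    (hst : Coupled k ℓ A ρ st s) :
    Coupled k ℓ A ρ (step k ℓ r st e i) (relStep k ℓ A ρ s e i) := by
  have hc0 : ¬ 0 < s.count e.1 → s.count e.1 = 0 := fun hc =>
    le_antisymm (not_lt.1 hc) (hs.count_nonneg _)
  cases hst with
  | above hlevel hτ hkeys hcount hle hcard =>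
    have hlarge : 1 < st.τ * ENNReal.ofReal ℓ := by rwa [hτ, one_lt_inv_ofReal_mul hℓ]
    have hΔ : expDraw (r (.entry i)) (max (ENNReal.ofReal ℓ⁻¹) st.τ) =
        stdExp (ρ (.entry i)) * s.level := by
      have : max (ENNReal.ofReal ℓ⁻¹) st.τ = (ENNReal.ofReal s.level)⁻¹ := by
        rw [hτ, ENNReal.ofReal_inv_of_pos hℓ]
        exact max_eq_right (ENNReal.inv_le_inv.2 (ENNReal.ofReal_le_ofReal hlevel.le))
      rw [h.entry i hi, this, expDraw_inv_ofReal _ hs.level_nonneg]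
    have hek : e.1 ∈ st.keys ↔ 0 < s.count e.1 := by rw [hkeys, mem_cached]; simp [heA]
    have hupd : ∀ c, ∀ x ∈ A, Function.update st.count e.1 c x = Function.update s.count e.1 c x := by
      intro c x hx
      by_cases hxe : x = e.1
      · subst hxe; simp
      · simp [hxe, hcount x hx]
    by_cases hc : 0 < s.count e.1
    · have hins : insert e.1 (s.cached A) = s.cached A :=
        Finset.insert_eq_self.2 (mem_cached.2 ⟨heA, hc⟩)
      have hcach := cached_update (s := s) (m := s.level) heA (add_pos hc he)
      rw [hins] at hcach
      rw [step, if_pos (hek.2 hc), relStep, relEntry_of_cached hc, if_neg]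
      · refine Coupled.above hlevel hτ (by rw [hcach]; exact hkeys) ?_ hle hcard
        intro x hx
        simp only [hcount e.1 heA]
        exact hupd _ x hx
      · rintro ⟨-, h2⟩
        rw [hcach, ← hkeys] at h2
        omega
    · have hnk : e.1 ∉ st.keys := fun hk => hc (hek.1 hk)
      rw [step, if_neg hnk]
      simp only [hΔ, hlarge, true_or, and_true]
      by_cases hlt : stdExp (ρ (.entry i)) * s.level < e.2
      · rw [if_pos hlt, relStep]
        have hcach : (relEntry ρ s e i).cached A = insert e.1 st.keys := by
          rw [relEntry_of_lt hc hlt, cached_update heA (sub_pos.2 hlt), hkeys]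
        have hcnt : ∀ x ∈ A, Function.update st.count e.1
            (e.2 - stdExp (ρ (.entry i)) * s.level) x = (relEntry ρ s e i).count x := by
          rw [relEntry_of_lt hc hlt]
          exact hupd _
        have hcard' : (insert e.1 st.keys).card = st.keys.card + 1 :=
          Finset.card_insert_of_notMem hnk
        by_cases hfull : (insert e.1 st.keys).card = k + 1
        · rw [if_pos hfull, if_pos ⟨hlevel, by rw [hcach]; exact hfull⟩]
          exact coupled_evict (s := relEntry ρ s e i) (st := ⟨st.τ, insert e.1 st.keys,
            Function.update st.count e.1 (e.2 - stdExp (ρ (.entry i)) * s.level)⟩) hi h hinj hℓ hlevel hties hτ hcach.symm hcnt hfull _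
        · rw [if_neg hfull, if_neg fun hh => hfull (by rw [← hcach]; exact hh.2)]
          refine Coupled.above hlevel hτ hcach.symm hcnt ?_ fun hpos => ?_
          · show (insert e.1 st.keys).card ≤ k
            omega
          · have := hcard hpos
            omega
      · rw [if_neg hlt, relStep, relEntry_of_le (hc0 hc) hlt, if_neg]
        · exact Coupled.above hlevel hτ hkeys hcount hle hcard
        · rintro ⟨-, h2⟩
          rw [← hkeys] at h2
          omega
  | below hlevel y hy hτ hkeys hcount hcard =>
    have hyA := (mem_cached.1 hy).1
    have hsmall : ∀ z : 𝒳, ¬ 1 < ENNReal.ofReal (hashOf ρ z / ℓ) * ENNReal.ofReal ℓ := by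
      intro z
      rw [← ENNReal.ofReal_mul (div_nonneg (hashOf_pos ρ z).le hℓ.le), div_mul_cancel₀ _ hℓ.ne',
        not_lt]
      exact ENNReal.ofReal_le_one.2 (hashOf_lt_one ρ z).le
    have hΔ : expDraw (r (.entry i)) (max (ENNReal.ofReal ℓ⁻¹) st.τ) =
        stdExp (ρ (.entry i)) * s.level := by
      have : max (ENNReal.ofReal ℓ⁻¹) st.τ = (ENNReal.ofReal s.level)⁻¹ := by
        rw [hτ, ENNReal.ofReal_inv_of_pos hℓ, hlevel]
        exact max_eq_left (keyBase_le hℓ ρ y)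
      rw [h.entry i hi, this, expDraw_inv_ofReal _ hs.level_nonneg]
    have hrel : relStep k ℓ A ρ s e i = relEntry ρ s e i := by
      rw [relStep, if_neg]
      rintro ⟨h1, -⟩
      exact absurd h1 (not_lt.2 hlevel.ge)
    have hek : e.1 ∈ st.keys ↔ 0 < s.count e.1 ∧ hashOf ρ e.1 < hashOf ρ y := by
      rw [hkeys, Finset.mem_filter, mem_cached]; simp [heA]
    rw [hrel]
    by_cases hc : 0 < s.count e.1
    · have hins : insert e.1 (s.cached A) = s.cached A :=
        Finset.insert_eq_self.2 (mem_cached.2 ⟨heA, hc⟩)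
      have hcach := cached_update (s := s) (m := s.level) heA (add_pos hc he)
      rw [hins] at hcach
      rw [relEntry_of_cached hc]
      by_cases hk : e.1 ∈ st.keys
      · rw [step, if_pos hk]
        refine Coupled.below hlevel y (by rwa [hcach]) hτ (by rw [hcach]; exact hkeys) ?_ hcard
        intro x hx
        by_cases hxe : x = e.1
        · subst hxe; simp [hcount _ hk]
        · simp [hxe, hcount x hx]
      -- The key is cached only in the relaxed process, so its hash is at least that of `y` and the
      -- algorithm refuses it.
      · rw [step, if_neg hk, if_neg]
        · refine Coupled.below hlevel y (by rwa [hcach]) hτ (by rw [hcach]; exact hkeys) ?_ hcard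
          intro x hx
          have hxe : x ≠ e.1 := fun hxe => hk (hxe ▸ hx)
          simp [hxe, hcount x hx]
        · rintro ⟨-, h2 | ⟨-, h2⟩⟩
          · rw [hτ] at h2; exact hsmall y h2
          · rw [hτ, keyBase_of_agree h ℓ heA, ← not_le, ofReal_hashOf_le_iff hℓ, not_le] at h2
            exact hk (hek.2 ⟨hc, h2⟩)
    · have hnk : e.1 ∉ st.keys := fun hk => hc (hek.1 hk).1
      rw [step, if_neg hnk]
      simp only [hΔ]
      by_cases hlt : stdExp (ρ (.entry i)) * s.level < e.2
      · have hcach : (relEntry ρ s e i).cached A = insert e.1 (s.cached A) := by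
          rw [relEntry_of_lt hc hlt, cached_update heA (sub_pos.2 hlt)]
        have hlev : (relEntry ρ s e i).level = ℓ := hlevel
        have hne : ∀ x ∈ st.keys, x ≠ e.1 := fun x hx hxe => hnk (hxe ▸ hx)
        by_cases hh : hashOf ρ e.1 < hashOf ρ y
        · rw [if_pos]
          swap
          · refine ⟨hlt, Or.inr ⟨by rw [hτ]; exact not_lt.1 (hsmall y), ?_⟩⟩
            rw [hτ, keyBase_of_agree h ℓ heA, ← not_le, ofReal_hashOf_le_iff hℓ, not_le]
            exact hh
          have hfull : (insert e.1 st.keys).card = k + 1 := by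
            rw [Finset.card_insert_of_notMem hnk, hcard]
          rw [if_pos hfull]
          set S := insert e.1 st.keys with hS
          have hSA : ∀ x ∈ S, x ∈ A := by
            intro x hx
            rcases Finset.mem_insert.1 hx with rfl | hx
            · exact heA
            · rw [hkeys, Finset.mem_filter, mem_cached] at hx
              exact hx.1.1
          have hSy : ∀ x ∈ S, hashOf ρ x < hashOf ρ y := by
            intro x hx
            rcases Finset.mem_insert.1 hx with rfl | hx
            · exact hh
            · rw [hkeys, Finset.mem_filter] at hx
              exact hx.2
          have hSmem : ∀ x, x ∈ (relEntry ρ s e i).cached A → hashOf ρ x < hashOf ρ y → x ∈ S := by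
            intro x hx hxy
            rw [hcach, Finset.mem_insert] at hx
            rcases hx with rfl | hx
            · exact Finset.mem_insert_self _ _
            · exact Finset.mem_insert_of_mem (by rw [hkeys]; exact Finset.mem_filter.2 ⟨hx, hxy⟩)
          have hScach : ∀ x ∈ S, x ∈ (relEntry ρ s e i).cached A := by
            intro x hx
            rw [hcach]
            rcases Finset.mem_insert.1 hx with rfl | hx
            · exact Finset.mem_insert_self _ _
            · rw [hkeys, Finset.mem_filter] at hx
              exact Finset.mem_insert_of_mem hx.1
          have hSne : S.Nonempty := Finset.insert_nonempty _ _
          set z := argmaxKey S hSne (keyBase ℓ r) with hz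
          have hzS : z ∈ S := argmaxKey_mem hSne _
          have hzmax : ∀ x ∈ S, hashOf ρ x ≤ hashOf ρ z := by
            intro x hx
            have := le_argmaxKey hSne (keyBase ℓ r) hx
            rwa [keyBase_of_agree h ℓ (hSA x hx), ← hz, keyBase_of_agree h ℓ (hSA z hzS),
              ofReal_hashOf_le_iff hℓ] at this
          have hnot : ¬ 1 < st.τ * ENNReal.ofReal ℓ := by rw [hτ]; exact hsmall y
          rw [evict, if_neg hnot]
          refine Coupled.below hlev z (hScach z hzS) (keyBase_of_agree h ℓ (hSA z hzS)) ?_ ?_ ?_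
          · show S.erase z = _
            ext x
            rw [Finset.mem_erase, Finset.mem_filter]
            constructor
            · rintro ⟨hxz, hx⟩
              exact ⟨hScach x hx, lt_of_le_of_ne (hzmax x hx) fun heq =>
                hxz (hinj (hSA x hx) (hSA z hzS) heq)⟩
            · rintro ⟨hx, hlt'⟩
              exact ⟨fun hxz => lt_irrefl _ (hxz ▸ hlt'), hSmem x hx (hlt'.trans (hSy z hzS))⟩
          · intro x hx
            have hx' : x ∈ S.erase z := hx
            obtain ⟨hxz, hxS⟩ := Finset.mem_erase.1 hx'
            show Function.update (Function.update st.count e.1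
              (e.2 - stdExp (ρ (.entry i)) * s.level)) z 0 x = _
            rw [Function.update_of_ne hxz, relEntry_of_lt hc hlt]
            rcases Finset.mem_insert.1 hxS with hxe | hxk
            · rw [hxe]; simp
            · simp [hne x hxk, hcount x hxk]
          · show (S.erase z).card = k
            rw [Finset.card_erase_of_mem hzS, hfull]; rfl
        · rw [if_neg]
          · refine Coupled.below hlev y (by rw [hcach]; exact Finset.mem_insert_of_mem hy) hτ ?_ ?_
              hcard
            · rw [hcach, Finset.filter_insert, if_neg hh, hkeys]
            · intro x hx
              rw [relEntry_of_lt hc hlt]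
              simp [hne x hx, hcount x hx]
          · rintro ⟨-, h2 | ⟨-, h2⟩⟩
            · rw [hτ] at h2; exact hsmall y h2
            · rw [hτ, keyBase_of_agree h ℓ heA, ← not_le, ofReal_hashOf_le_iff hℓ, not_le] at h2
              exact hh h2
      · rw [if_neg fun hh => hlt hh.1, relEntry_of_le (hc0 hc) hlt]
        exact Coupled.below hlevel y hy hτ hkeys hcount hcard

theorem sample_append (k : ℕ) (ℓ : ℝ) (l : List (𝒳 × ℝ)) (e : 𝒳 × ℝ) (r : RandCall 𝒳 → ℝ) :
    sample k ℓ (l ++ [e]) r = step k ℓ r (sample k ℓ l r) e l.length := by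
  simp [sample, List.zipIdx_append]

theorem Agree.mono {m n : ℕ} (hmn : m ≤ n) {A : Finset 𝒳} {r : RandCall 𝒳 → ℝ}
    {ρ : RandCall 𝒳 → UnitOpen} (h : Agree n A r ρ) : Agree m A r ρ :=
  ⟨h.hash, fun i hi => h.entry i (hi.trans_le hmn), fun i hi => h.evictU i (hi.trans_le hmn),
    fun i hi => h.evictR i (hi.trans_le hmn)⟩

/-! ### Genericity -/

/-- Each branch of the maximum is a strictly monotone function of its own uniform number, so it
avoids a value independent of that number. -/
theorem ae_invThreshold_ne {s : (RandCall 𝒳 → UnitOpen) → RelaxedState 𝒳} (hs : MeasurableState s)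
    {ℓ W : ℝ} (hW : ∀ ρ, (s ρ).Bounded ℓ W) (i : ℕ) (x : 𝒳)
    (hinvU : ∀ ρ u, s (Function.update ρ (.evictU i x) u) = s ρ)
    (hinvR : ∀ ρ u, s (Function.update ρ (.evictR i x) u) = s ρ)
    {φ : (RandCall 𝒳 → UnitOpen) → ℝ} (hφ : Measurable φ)
    (hφU : ∀ ρ u, φ (Function.update ρ (.evictU i x) u) = φ ρ)
    (hφR : ∀ ρ u, φ (Function.update ρ (.evictR i x) u) = φ ρ) :
    ∀ᵐ ρ ∂(Measure.infinitePi fun _ => unitMeasure),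
      0 < (s ρ).count x → invThreshold ρ i (s ρ) x ≠ φ ρ := by
  have h1 : ∀ᵐ ρ ∂(Measure.infinitePi fun _ => unitMeasure),
      ¬ (0 < (s ρ).count x ∧ (s ρ).count x / stdExp (ρ (.evictR i x)) = φ ρ) := by
    refine ae_resample unitMeasure (.evictR i x) ?_ fun ρ => ?_
    · exact ((hs.measurableSet_pos x).inter (measurableSet_eq_fun
        ((hs.count x).div (measurable_stdExp_call _)) hφ)).compl
    · filter_upwards [ae_unitOpen_ne (1 - Real.exp (-((s ρ).count x / φ ρ)))] with u hu
      simp only [hinvR, hφR, Function.update_self]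
      rintro ⟨hc, heq⟩
      refine hu ((stdExp_eq_iff u _).1 ?_)
      rw [← heq]
      field_simp
  have h2 : ∀ᵐ ρ ∂(Measure.infinitePi fun _ => unitMeasure),
      ¬ (0 < (s ρ).level ∧ (s ρ).level / ρ (.evictU i x) = φ ρ) := by
    refine ae_resample unitMeasure (.evictU i x) ?_ fun ρ => ?_
    · exact ((measurableSet_lt measurable_const hs.level).inter (measurableSet_eq_fun
        (hs.level.div (measurable_call _)) hφ)).compl
    · filter_upwards [ae_unitOpen_ne ((s ρ).level / φ ρ)] with u hu
      simp only [hinvU, hφU, Function.update_self]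
      rintro ⟨hc, heq⟩
      refine hu ?_
      have := u.2.1
      rw [← heq]
      field_simp
  filter_upwards [h1, h2] with ρ h1 h2 hc heq
  rcases max_choice ((s ρ).level / ρ (.evictU i x)) ((s ρ).count x / stdExp (ρ (.evictR i x)))
    with hm | hm
  -- At level 0 the first branch is the constant 0, but it cannot be the maximum because the second
  -- branch is positive.
  · rcases (hW ρ).level_nonneg.eq_or_lt with h0 | h0
    · have hpos := div_pos hc (stdExp_pos (ρ (.evictR i x)))
      have := max_eq_left_iff.1 hm
      rw [← h0, zero_div] at this
      linarith
    · exact h2 ⟨h0, hm ▸ heq⟩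
  · exact h1 ⟨hc, hm ▸ heq⟩

/-- Ties would break the coupling: the relaxed process drops every key attaining a minimum below ℓ,
the algorithm exactly one key. -/
theorem ae_noTies {s : (RandCall 𝒳 → UnitOpen) → RelaxedState 𝒳} (hs : MeasurableState s)
    {ℓ W : ℝ} (hW : ∀ ρ, (s ρ).Bounded ℓ W) (i : ℕ)
    (hinvU : ∀ ρ x u, s (Function.update ρ (.evictU i x) u) = s ρ)
    (hinvR : ∀ ρ x u, s (Function.update ρ (.evictR i x) u) = s ρ) (A : Finset 𝒳) :
    ∀ᵐ ρ ∂(Measure.infinitePi fun _ => unitMeasure), NoTies ℓ A ρ i (s ρ) := by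
  have h1 : ∀ x ∈ A, ∀ᵐ ρ ∂(Measure.infinitePi fun _ => unitMeasure),
      0 < (s ρ).count x → invThreshold ρ i (s ρ) x ≠ ℓ := fun x _ =>
    ae_invThreshold_ne hs hW i x (fun ρ => hinvU ρ x) (fun ρ => hinvR ρ x) measurable_const
      (fun _ _ => rfl) fun _ _ => rfl
  have h2 : ∀ x ∈ A, ∀ y ∈ A, ∀ᵐ ρ ∂(Measure.infinitePi fun _ => unitMeasure),
      y ≠ x → 0 < (s ρ).count x → invThreshold ρ i (s ρ) x ≠ invThreshold ρ i (s ρ) y := by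
    intro x _ y _
    by_cases hyx : y = x
    · exact .of_forall fun ρ h => absurd hyx h
    · refine (ae_invThreshold_ne hs hW i x (fun ρ => hinvU ρ x) (fun ρ => hinvR ρ x)
        (hs.invThreshold i y) (fun ρ u => ?_) fun ρ u => ?_).mono fun ρ h _ => h
      · rw [hinvU]; exact invThreshold_congr (by simp [hyx]) (by simp)
      · rw [hinvR]; exact invThreshold_congr (by simp) (by simp [hyx])
  rw [← Filter.eventually_all_finset] at h1
  have h3 : ∀ x ∈ A, ∀ᵐ ρ ∂(Measure.infinitePi fun _ => unitMeasure), ∀ y ∈ A,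
      y ≠ x → 0 < (s ρ).count x → invThreshold ρ i (s ρ) x ≠ invThreshold ρ i (s ρ) y :=
    fun x hx => (Filter.eventually_all_finset A).2 (h2 x hx)
  rw [← Filter.eventually_all_finset] at h3
  filter_upwards [h1, h3] with ρ h1 h3 x hx hc
  exact ⟨h1 x hx hc, fun y hy hyx => h3 x hx y hy hyx hc⟩

theorem ae_injOn_hashOf (A : Finset 𝒳) :
    ∀ᵐ ρ ∂(Measure.infinitePi fun _ : RandCall 𝒳 => unitMeasure), Set.InjOn (hashOf ρ) A := by
  have h2 : ∀ x ∈ A, ∀ y ∈ A, ∀ᵐ ρ ∂(Measure.infinitePi fun _ : RandCall 𝒳 => unitMeasure),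
      hashOf ρ x = hashOf ρ y → x = y := by
    intro x _ y _
    by_cases hyx : y = x
    · exact .of_forall fun ρ _ => hyx.symm
    · have : ∀ᵐ ρ ∂(Measure.infinitePi fun _ : RandCall 𝒳 => unitMeasure),
          hashOf ρ x ≠ hashOf ρ y := by
        refine ae_resample unitMeasure (.hash x) ?_ fun ρ => ?_
        · exact (measurableSet_eq_fun (measurable_call (.hash x))
            (measurable_call (.hash y))).compl
        · filter_upwards [ae_unitOpen_ne (hashOf ρ y)] with u hu
          simpa [hashOf, hyx] using hu
      exact this.mono fun ρ h heq => absurd heq h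
  have h3 : ∀ x ∈ A, ∀ᵐ ρ ∂(Measure.infinitePi fun _ : RandCall 𝒳 => unitMeasure), ∀ y ∈ A,
      hashOf ρ x = hashOf ρ y → x = y := fun x hx => (Filter.eventually_all_finset A).2 (h2 x hx)
  rw [← Filter.eventually_all_finset] at h3
  exact h3.mono fun ρ h x hx y hy => h x hx y hy

theorem ae_coupled (k : ℕ) {ℓ : ℝ} (hℓ : 0 < ℓ) (A : Finset 𝒳) (l : List (𝒳 × ℝ))
    (hl : ∀ e ∈ l, 0 < e.2) (hlA : ∀ e ∈ l, e.1 ∈ A) :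
    ∀ᵐ ρ ∂(Measure.infinitePi fun _ : RandCall 𝒳 => unitMeasure), ∀ r : RandCall 𝒳 → ℝ,
      Agree l.length A r ρ → Coupled k ℓ A ρ (sample k ℓ l r) (relaxed k ℓ A l ρ) := by
  induction l using List.reverseRecOn with
  | nil =>
    refine .of_forall fun ρ r _ => Coupled.above hℓ ?_ ?_ ?_ ?_ ?_
    · simp [sample, relaxed]
    · simp [sample, relaxed, RelaxedState.cached]
    · simp [sample, relaxed]
    · simp [sample]
    · simp [relaxed]
  | append_singleton l e ih =>
    have hl' : ∀ e' ∈ l, 0 < e'.2 := fun e' he' => hl e' (by simp [he'])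
    obtain ⟨W, hW⟩ := relaxed_bounded k hℓ A l hl'
    have hs := measurableState_relaxed k ℓ A l
    have hties := ae_noTies (hs.relEntry e l.length)
      (fun ρ => (hW ρ).relEntry ρ (hl e (by simp)) l.length) l.length
      (fun ρ x u => by rw [relaxed_update_evictU]; exact relEntry_congr (by simp))
      (fun ρ x u => by rw [relaxed_update_evictR]; exact relEntry_congr (by simp)) A
    filter_upwards [ih hl' fun e' he' => hlA e' (by simp [he']), hties, ae_injOn_hashOf A]
      with ρ h1 h2 h3 r hr
    rw [sample_append, relaxed_append]
    have hlen : (l ++ [e]).length = l.length + 1 := by simp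
    rw [hlen] at hr
    exact coupled_step (Nat.lt_succ_self _) hr h3 hℓ (hW ρ) (hlA e (by simp)) (hl e (by simp)) h2
      (h1 r (hr.mono (Nat.le_succ _)))

end Coupling

/-! ### Product moments of the contributions to the estimator. -/

section Moments

variable {𝒳 : Type*} [DecidableEq 𝒳]

/-- The contribution of a key to the estimator, for a function `g` with derivative `g'`. -/
noncomputable def sampleEst (g g' : ℝ → ℝ) (ℓ : ℝ) (st : State 𝒳) (x : 𝒳) : ℝ :=
  if x ∈ st.keys then g (st.count x) / (min 1 (ENNReal.ofReal ℓ * st.τ)).toReal +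
    g' (st.count x) * (st.τ⁻¹).toReal else 0

theorem min_one_ofReal_mul_inv {ℓ m : ℝ} (hℓ : 0 < ℓ) (hm : m < ℓ) :
    min 1 (ENNReal.ofReal ℓ * (ENNReal.ofReal m)⁻¹) = 1 := by
  rw [mul_comm]
  exact min_eq_left ((one_lt_inv_ofReal_mul hℓ).2 hm).le

theorem min_one_ofReal_mul_hash {ℓ h : ℝ} (hℓ : 0 < ℓ) (h0 : 0 < h) (h1 : h < 1) :
    (min 1 (ENNReal.ofReal ℓ * ENNReal.ofReal (h / ℓ))).toReal = h := by
  rw [← ENNReal.ofReal_mul hℓ.le, mul_div_cancel₀ _ hℓ.ne',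
    min_eq_right (ENNReal.ofReal_le_one.2 h1.le), ENNReal.toReal_ofReal h0.le]

/-- Above 1/ℓ the weights are 1. At level ℓ with all of `B` sampled, the threshold of the weights is
the hash h of `y`; then p = h and 1/τ = ℓ/h, so the contribution is (g + ℓg')/h. If some key of `B`
is not sampled, both sides vanish, possibly through different keys; this is where |B| ≤ k enters. -/
theorem Coupled.prod_sampleEst {k : ℕ} {ℓ W : ℝ} (hℓ : 0 < ℓ) {A B : Finset 𝒳}
    {ρ : RandCall 𝒳 → UnitOpen} {st : State 𝒳} {s : RelaxedState 𝒳} (h : Coupled k ℓ A ρ st s)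
    (hs : s.Bounded ℓ W) (hinj : Set.InjOn (hashOf ρ) A) (hBA : B ⊆ A) (hBk : B.card ≤ k)
    (g g' : 𝒳 → ℝ → ℝ) :
    ∏ x ∈ B, sampleEst (g x) (g' x) ℓ st x =
      (∏ x ∈ B, relEst (g x) (g' x) s x) * ∏ x ∈ B, hashWeight k ℓ A B s ρ x := by
  rw [← Finset.prod_mul_distrib]
  cases h with
  | above hlevel hτ hkeys hcount hle hcard =>
    refine Finset.prod_congr rfl fun x hx => ?_
    have hxk : x ∈ st.keys ↔ 0 < s.count x := by rw [hkeys, mem_cached]; simp [hBA hx]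
    unfold sampleEst relEst hashWeight
    simp only [hxk, hlevel, if_true, one_mul, hτ, min_one_ofReal_mul_inv hℓ hlevel,
      hcount x (hBA hx), inv_inv, ENNReal.toReal_ofReal hs.level_nonneg, ENNReal.toReal_one,
      div_one, mul_comm]
  | below hlevel y hy hτ hkeys hcount hcard =>
    have hnl : ¬ s.level < ℓ := not_lt.2 hlevel.ge
    by_cases hBC : B ⊆ s.cached A
    · by_cases hB : ∀ x ∈ B, hashOf ρ x < hashOf ρ y
      · have hm : hashThreshold k A B (s.cached A) (hashOf ρ) = hashOf ρ y :=
          hashThreshold_eq (hashOf_lt_one ρ) (Finset.filter_subset _ _) hBC hy (hkeys ▸ hcard) hB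
        refine Finset.prod_congr rfl fun x hx => ?_
        have hxk : x ∈ st.keys := by rw [hkeys]; exact Finset.mem_filter.2 ⟨hBC hx, hB x hx⟩
        have h0 := hashOf_pos ρ y
        have hinv : ((ENNReal.ofReal (hashOf ρ y / ℓ))⁻¹).toReal = ℓ / hashOf ρ y := by
          rw [ENNReal.toReal_inv, ENNReal.toReal_ofReal (div_nonneg h0.le hℓ.le), inv_div]
        have hw : hashWeight k ℓ A B s ρ x = (hashOf ρ y)⁻¹ := by
          rw [hashWeight, if_neg hnl, hm, if_pos (hB x hx)]
        rw [hw]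
        unfold sampleEst relEst
        simp only [hxk, if_true, hτ, hcount x hxk, hinv,
          min_one_ofReal_mul_hash hℓ h0 (hashOf_lt_one ρ y), (mem_cached.1 (hBC hx)).2, hlevel]
        field_simp
      · have hB' := hB
        push Not at hB'
        obtain ⟨x, hx, hxy⟩ := hB'
        have hcon : ¬ ∀ x ∈ B, hashOf ρ x < hashThreshold k A B (s.cached A) (hashOf ρ) :=
          fun hall => hB (lt_of_lt_hashThreshold
            (hinj.mono (Finset.coe_subset.2 (Finset.filter_subset _ _)))
            (Finset.filter_subset _ _) hBC hBk (hkeys ▸ hcard) hall)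
        push Not at hcon
        obtain ⟨z, hz, hzm⟩ := hcon
        rw [Finset.prod_eq_zero hx, Finset.prod_eq_zero hz]
        · rw [hashWeight, if_neg hnl, if_neg (not_lt.2 hzm), mul_zero]
        · rw [sampleEst, if_neg]
          rw [hkeys, Finset.mem_filter]
          exact fun hh => not_lt.2 hxy hh.2
    · obtain ⟨x, hx, hxC⟩ := Finset.not_subset.1 hBC
      rw [Finset.prod_eq_zero hx, Finset.prod_eq_zero hx]
      · rw [relEst, if_neg, zero_mul]
        exact fun hc => hxC (mem_cached.2 ⟨hBA hx, hc⟩)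
      · rw [sampleEst, if_neg]
        rw [hkeys, Finset.mem_filter]
        exact fun hh => hxC hh.1

open Classical in
/-- Moving a number outside `(0, 1)` to `1 / 2`. -/
noncomputable def clip (u : ℝ) : UnitOpen :=
  if h : u ∈ Set.Ioo (0 : ℝ) 1 then ⟨u, h⟩ else ⟨1 / 2, by norm_num, by norm_num⟩

theorem measurable_clip : Measurable clip := by
  classical
  exact Measurable.dite (f := fun u : Set.Ioo (0 : ℝ) 1 => u)
    (g := fun _ => ⟨1 / 2, by norm_num, by norm_num⟩) measurable_id measurable_const
    measurableSet_Ioo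

theorem clip_coe (u : UnitOpen) : clip u = u := by
  unfold clip
  rw [dif_pos u.2]

theorem map_coe_unitMeasure :
    unitMeasure.map ((↑) : UnitOpen → ℝ) = volume.restrict (Set.Ioo (0 : ℝ) 1) :=
  map_comap_subtype_coe measurableSet_Ioo volume

variable {Ω : Type*} [MeasurableSpace Ω] {P : Measure Ω} [IsProbabilityMeasure P]

theorem map_uniform {X : Ω → ℝ} (hX : pdf.IsUniform X (Set.Icc (0 : ℝ) 1) P) :
    P.map X = unitMeasure.map ((↑) : UnitOpen → ℝ) := by
  rw [map_coe_unitMeasure, hX, ProbabilityTheory.cond, Real.volume_Icc,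
    Measure.restrict_congr_set Ioo_ae_eq_Icc]
  simp

theorem map_clip_uniform {X : Ω → ℝ} (hXm : Measurable X)
    (hX : pdf.IsUniform X (Set.Icc (0 : ℝ) 1) P) :
    P.map (fun ω => clip (X ω)) = unitMeasure := by
  have : (fun ω => clip (X ω)) = clip ∘ X := rfl
  rw [this, ← Measure.map_map measurable_clip hXm, map_uniform hX,
    Measure.map_map measurable_clip measurable_subtype_coe]
  have : clip ∘ ((↑) : UnitOpen → ℝ) = id := funext clip_coe
  rw [this, Measure.map_id]

theorem ae_eq_clip {X : Ω → ℝ} (hXm : Measurable X)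
    (hX : pdf.IsUniform X (Set.Icc (0 : ℝ) 1) P) : ∀ᵐ ω ∂P, X ω = clip (X ω) := by
  have hmeas : MeasurableSet {u : ℝ | u = clip u} :=
    measurableSet_eq_fun measurable_id (measurable_subtype_coe.comp measurable_clip)
  have h1 : ∀ᵐ u ∂(P.map X), u = (clip u : ℝ) := by
    rw [map_uniform hX, ae_map_iff measurable_subtype_coe.aemeasurable hmeas]
    exact .of_forall fun u => by rw [clip_coe]
  exact ae_of_ae_map hXm.aemeasurable h1

variable {U : RandCall 𝒳 → Ω → ℝ}

theorem measurePreserving_clip (hU_meas : ∀ c, Measurable (U c))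
    (hU_unif : ∀ c, pdf.IsUniform (U c) (Set.Icc (0 : ℝ) 1) P) (hU_indep : iIndepFun U P) :
    MeasurePreserving (fun ω c => clip (U c ω)) P (Measure.infinitePi fun _ => unitMeasure) := by
  have hm : ∀ c, Measurable fun ω => clip (U c ω) := fun c => measurable_clip.comp (hU_meas c)
  refine ⟨measurable_pi_lambda _ hm, ?_⟩
  have hind : iIndepFun (fun c ω => clip (U c ω)) P :=
    hU_indep.comp (fun _ => clip) fun _ => measurable_clip
  rw [hind.map_fun_eq_infinitePi_map hm]
  congr 1
  funext c
  exact map_clip_uniform (hU_meas c) (hU_unif c)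

/-- The key set may be uncountable, so agreement is claimed only for countably many calls, those
that the stream can reach. -/
theorem ae_agree (hU_meas : ∀ c, Measurable (U c))
    (hU_unif : ∀ c, pdf.IsUniform (U c) (Set.Icc (0 : ℝ) 1) P) (n : ℕ) (A : Finset 𝒳) :
    ∀ᵐ ω ∂P, Agree n A (fun c => U c ω) fun c => clip (U c ω) := by
  have h : ∀ c, ∀ᵐ ω ∂P, U c ω = clip (U c ω) := fun c => ae_eq_clip (hU_meas c) (hU_unif c)
  have h1 := (Filter.eventually_all_finset A).2 fun x _ => h (.hash x)
  have h2 : ∀ᵐ ω ∂P, ∀ i, U (.entry i) ω = clip (U (.entry i) ω) :=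
    ae_all_iff.2 fun i => h (.entry i)
  have h3 : ∀ᵐ ω ∂P, ∀ i, ∀ x ∈ A, U (.evictU i x) ω = clip (U (.evictU i x) ω) :=
    ae_all_iff.2 fun i => (Filter.eventually_all_finset A).2 fun x _ => h (.evictU i x)
  have h4 : ∀ᵐ ω ∂P, ∀ i, ∀ x ∈ A, U (.evictR i x) ω = clip (U (.evictR i x) ω) :=
    ae_all_iff.2 fun i => (Filter.eventually_all_finset A).2 fun x _ => h (.evictR i x)
  filter_upwards [h1, h2, h3, h4] with ω h1 h2 h3 h4
  exact ⟨h1, fun i _ => h2 i, fun i _ => h3 i, fun i _ => h4 i⟩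

theorem ae_coupled_sample (hU_meas : ∀ c, Measurable (U c))
    (hU_unif : ∀ c, pdf.IsUniform (U c) (Set.Icc (0 : ℝ) 1) P) (hU_indep : iIndepFun U P)
    (k : ℕ) {ℓ : ℝ} (hℓ : 0 < ℓ) (A : Finset 𝒳) (l : List (𝒳 × ℝ)) (hl : ∀ e ∈ l, 0 < e.2)
    (hlA : ∀ e ∈ l, e.1 ∈ A) :
    ∀ᵐ ω ∂P, Coupled k ℓ A (fun c => clip (U c ω)) (sample k ℓ l fun c => U c ω)
      (relaxed k ℓ A l fun c => clip (U c ω)) := by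
  filter_upwards [(measurePreserving_clip hU_meas hU_unif hU_indep).quasiMeasurePreserving.ae
    (ae_coupled k hℓ A l hl hlA), ae_agree hU_meas hU_unif l.length A] with ω h1 h2
  exact h1 _ h2

/-- The product is almost surely a measurable function of the clipped numbers, so measurability of
the algorithm itself is never needed. -/
theorem integral_prod_sampleEst (hU_meas : ∀ c, Measurable (U c))
    (hU_unif : ∀ c, pdf.IsUniform (U c) (Set.Icc (0 : ℝ) 1) P) (hU_indep : iIndepFun U P)
    (k : ℕ) {ℓ : ℝ} (hℓ : 0 < ℓ) {A B : Finset 𝒳} (hBA : B ⊆ A) (hBk : B.card ≤ k)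
    (l : List (𝒳 × ℝ)) (hl : ∀ e ∈ l, 0 < e.2) (hlA : ∀ e ∈ l, e.1 ∈ A) (g g' : 𝒳 → ℝ → ℝ)
    (hg : ∀ x ∈ B, IsTest (g x) (g' x)) :
    Integrable (fun ω => ∏ x ∈ B, sampleEst (g x) (g' x) ℓ (sample k ℓ l fun c => U c ω) x) P ∧
    ∫ ω, ∏ x ∈ B, sampleEst (g x) (g' x) ℓ (sample k ℓ l fun c => U c ω) x ∂P =
      ∏ x ∈ B, g x (keyWeight l x) := by
  have hmp := measurePreserving_clip hU_meas hU_unif hU_indep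
  obtain ⟨W, hW⟩ := relaxed_bounded k hℓ A l hl
  have hs := measurableState_relaxed k ℓ A l
  set F : (RandCall 𝒳 → UnitOpen) → ℝ :=
    fun ρ => ∏ x ∈ B, relEst (g x) (g' x) (relaxed k ℓ A l ρ) x with hF
  have hFm : Measurable F :=
    Finset.measurable_fun_prod B fun x hx => (hg x hx).measurable_relEst hs x
  have hFb : ∃ K, ∀ ρ, |F ρ| ≤ K := by
    choose! K hK using fun x hx => (hg x hx).relEst_bound (𝒳 := 𝒳) ℓ W
    refine ⟨∏ x ∈ B, K x, fun ρ => ?_⟩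
    rw [hF, Finset.abs_prod]
    exact Finset.prod_le_prod (fun x _ => abs_nonneg _) fun x hx => hK x hx _ x (hW ρ)
  obtain ⟨hint, hval⟩ := integral_mul_prod_hashWeight hs (fun ρ x u => relaxed_update_hash ρ x u)
    k ℓ A B hFm hFb fun ρ x u => by simp only [hF, relaxed_update_hash]
  have hae : (fun ω => ∏ x ∈ B, sampleEst (g x) (g' x) ℓ (sample k ℓ l fun c => U c ω) x) =ᵐ[P]
      (fun ρ => F ρ * ∏ x ∈ B, hashWeight k ℓ A B (relaxed k ℓ A l ρ) ρ x) ∘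
        fun ω c => clip (U c ω) := by
    filter_upwards [ae_coupled_sample hU_meas hU_unif hU_indep k hℓ A l hl hlA,
      hmp.quasiMeasurePreserving.ae (ae_injOn_hashOf A)] with ω h1 h2
    exact h1.prod_sampleEst hℓ (hW _) h2 hBA hBk g g'
  refine ⟨(integrable_congr hae).2 (hmp.integrable_comp_of_integrable hint), ?_⟩
  rw [integral_congr_ae hae, ← integral_prod_relEst_relaxed k hℓ l hl g g' hg (A := A), ← hval,
    ← hmp.map_eq, integral_map hmp.measurable.aemeasurable
      (by rw [hmp.map_eq]; exact hint.aestronglyMeasurable)]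
  rfl

end Moments

/-! ### Test functions -/

/-- The derivative of `cap T` (with value `0` at `T`). -/
noncomputable def capDeriv (T c : ℝ) : ℝ := if c < T then 1 else 0

theorem continuous_cap (T : ℝ) : Continuous (cap T) := continuous_id.min continuous_const

theorem cap_nonneg {T c : ℝ} (hT : 0 ≤ T) (hc : 0 ≤ c) : 0 ≤ cap T c := le_min hc hT

theorem cap_le_right (T c : ℝ) : cap T c ≤ T := min_le_right _ _

theorem hasDerivAt_cap {T c : ℝ} (h : c ≠ T) : HasDerivAt (cap T) (capDeriv T c) c := by
  rcases lt_or_gt_of_ne h with h | h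
  · have : cap T =ᶠ[nhds c] id := by
      filter_upwards [gt_mem_nhds h] with y hy using min_eq_left hy.le
    rw [capDeriv, if_pos h]
    exact (hasDerivAt_id c).congr_of_eventuallyEq this
  · have : cap T =ᶠ[nhds c] fun _ => T := by
      filter_upwards [lt_mem_nhds h] with y hy using min_eq_right hy.le
    rw [capDeriv, if_neg (not_lt.2 h.le)]
    exact (hasDerivAt_const c T).congr_of_eventuallyEq this

/-- At the kink `deriv` is 0, since the cap attains its maximum there; this is the convention in
`capDeriv`. -/
theorem deriv_cap (T : ℝ) : deriv (cap T) = capDeriv T := by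
  funext c
  by_cases h : c = T
  · subst h
    have : IsLocalMax (cap c) c := .of_forall fun y => by
      simp [cap]
    rw [this.deriv_eq_zero, capDeriv, if_neg (lt_irrefl c)]
  · exact (hasDerivAt_cap h).deriv

theorem isTest_comp_cap {Ψ Ψ' : ℝ → ℝ} (h0 : Ψ 0 = 0) (hΨ : ∀ y, HasDerivAt Ψ (Ψ' y) y)
    (hΨ' : Continuous Ψ') {T : ℝ} (hT : 0 < T) :
    IsTest (fun c => Ψ (cap T c)) fun c => Ψ' (cap T c) * capDeriv T c := by
  have hm : Measurable (capDeriv T) :=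
    Measurable.ite measurableSet_Iio measurable_const measurable_const
  obtain ⟨K, hK⟩ := isCompact_Icc.exists_bound_of_continuousOn (s := Set.Icc 0 T)
    hΨ'.continuousOn
  refine ⟨?_, ?_, ?_, ⟨K, fun c hc => ?_⟩, {T}, Set.countable_singleton T, fun c _ hcT => ?_⟩
  · simp only [cap, min_eq_left hT.le, h0]
  · exact (continuous_iff_continuousAt.2 fun y => (hΨ y).continuousAt).comp (continuous_cap T)
  · exact (hΨ'.measurable.comp (continuous_cap T).measurable).mul hm
  · have h1 := hK (cap T c) ⟨cap_nonneg hT.le hc, cap_le_right T c⟩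
    rw [abs_mul]
    have h2 : |capDeriv T c| ≤ 1 := by unfold capDeriv; split_ifs <;> simp
    calc |Ψ' (cap T c)| * |capDeriv T c| ≤ K * 1 :=
          mul_le_mul h1 h2 (abs_nonneg _) ((abs_nonneg _).trans h1)
      _ = K := mul_one K
  · exact (hΨ (cap T c)).comp c (hasDerivAt_cap hcT)

theorem isTest_cap {T : ℝ} (hT : 0 < T) : IsTest (cap T) (capDeriv T) := by
  simpa using isTest_comp_cap (Ψ := fun y => y) (Ψ' := fun _ => 1) rfl hasDerivAt_id'
    continuous_const hT

theorem isTest_cap_sq {T : ℝ} (hT : 0 < T) :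
    IsTest (fun c => cap T c ^ 2) fun c => 2 * cap T c * capDeriv T c :=
  isTest_comp_cap (Ψ := fun y => y ^ 2) (Ψ' := fun y => 2 * y) (by simp)
    (fun y => by simpa using hasDerivAt_pow 2 y) (by fun_prop) hT

/-- The inclusion probability of a key of weight `c` at threshold `ℓ⁻¹`, multiplied by `ℓ`. -/
noncomputable def expSat (ℓ c : ℝ) : ℝ := ℓ * (1 - Real.exp (-(c / ℓ)))

theorem hasDerivAt_expSat {ℓ : ℝ} (hℓ : 0 < ℓ) (c : ℝ) :
    HasDerivAt (expSat ℓ) (Real.exp (-(c / ℓ))) c := by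
  have h := ((((hasDerivAt_id c).div_const ℓ).neg.exp).const_sub 1).const_mul ℓ
  refine h.congr_deriv ?_
  simp only [Pi.neg_apply, id_eq]
  field_simp

theorem isTest_expSat {ℓ : ℝ} (hℓ : 0 < ℓ) : IsTest (expSat ℓ) fun c => Real.exp (-(c / ℓ)) := by
  refine ⟨by simp [expSat], by unfold expSat; fun_prop, by fun_prop, ⟨1, fun c hc => ?_⟩, ∅,
    Set.countable_empty, fun c _ _ => hasDerivAt_expSat hℓ c⟩
  rw [abs_of_pos (Real.exp_pos _), Real.exp_le_one_iff, neg_nonpos]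
  positivity

/-- The function whose estimate bounds the conditional variance, as a function of `cap T`. -/
noncomputable def varBound (ℓ y : ℝ) : ℝ := y ^ 2 / ℓ + expSat ℓ y

theorem isTest_varBound_cap {ℓ T : ℝ} (hℓ : 0 < ℓ) (hT : 0 < T) :
    IsTest (fun c => varBound ℓ (cap T c))
      fun c => (2 * cap T c / ℓ + Real.exp (-(cap T c / ℓ))) * capDeriv T c := by
  refine isTest_comp_cap (Ψ := varBound ℓ) (Ψ' := fun y => 2 * y / ℓ + Real.exp (-(y / ℓ)))
    (by simp [varBound, expSat]) (fun y => ?_) (by fun_prop) hT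
  exact (by simpa using (hasDerivAt_pow 2 y).div_const ℓ : HasDerivAt (fun y => y ^ 2 / ℓ)
    (2 * y / ℓ) y).add (hasDerivAt_expSat hℓ y)

theorem one_sub_exp_neg_le (u : ℝ) : 1 - Real.exp (-u) ≤ u := by
  have := Real.add_one_le_exp (-u)
  linarith

theorem expSat_nonneg {ℓ c : ℝ} (hℓ : 0 < ℓ) (hc : 0 ≤ c) : 0 ≤ expSat ℓ c := by
  have : Real.exp (-(c / ℓ)) ≤ 1 := by
    rw [Real.exp_le_one_iff, neg_nonpos]; positivity
  exact mul_nonneg hℓ.le (by linarith)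

/-- `expSat` is bounded by both c and ℓ; the first is used for c ≤ T and the second for c ≥ T. -/
theorem expSat_le {ℓ T c : ℝ} (hℓ : 0 < ℓ) (hT : 0 < T) (hc : 0 ≤ c) :
    expSat ℓ c ≤ max 1 (ℓ / T) * cap T c := by
  have h1 : expSat ℓ c ≤ c := by
    have := one_sub_exp_neg_le (c / ℓ)
    calc expSat ℓ c ≤ ℓ * (c / ℓ) := mul_le_mul_of_nonneg_left this hℓ.le
      _ = c := by field_simp
  have h2 : expSat ℓ c ≤ ℓ := by
    have := Real.exp_pos (-(c / ℓ))
    unfold expSat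
    nlinarith
  rcases le_total c T with h | h
  · rw [cap, min_eq_left h]
    calc expSat ℓ c ≤ 1 * c := by linarith
      _ ≤ _ := mul_le_mul_of_nonneg_right (le_max_left _ _) hc
  · rw [cap, min_eq_right h]
    calc expSat ℓ c ≤ ℓ / T * T := by rw [div_mul_cancel₀ _ hT.ne']; exact h2
      _ ≤ _ := mul_le_mul_of_nonneg_right (le_max_right _ _) hT.le

/-- The quotient decreases in u, but no faster than u grows. After clearing denominators this
follows from 1 − e^(−u) ≤ u and the tangent bound for e^(v−u). -/
theorem add_one_sub_exp_neg_div_mono {u v : ℝ} (hu : 0 < u) (huv : u ≤ v) :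
    u + (1 - Real.exp (-u)) / u ≤ v + (1 - Real.exp (-v)) / v := by
  have hv : 0 < v := hu.trans_le huv
  have h1 : (v - u) * Real.exp (-v) ≤ Real.exp (-u) - Real.exp (-v) := by
    have hsplit : Real.exp (-u) = Real.exp (-v) * Real.exp (v - u) := by
      rw [← Real.exp_add]; congr 1; ring
    have := Real.add_one_le_exp (v - u)
    have := Real.exp_pos (-v)
    rw [hsplit]
    nlinarith
  have h2 := one_sub_exp_neg_le u
  have h3 := one_sub_exp_neg_le v
  have key : v * (1 - Real.exp (-u)) - u * (1 - Real.exp (-v)) ≤ u * v * (v - u) := by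
    have hd : 0 ≤ v - u := sub_nonneg.2 huv
    have e1 : u * ((v - u) * Real.exp (-v)) ≤ u * (Real.exp (-u) - Real.exp (-v)) :=
      mul_le_mul_of_nonneg_left h1 hu.le
    have e2 : (v - u) * (1 - Real.exp (-u)) ≤ (v - u) * u := mul_le_mul_of_nonneg_left h2 hd
    have e3 : (v - u) * u * (1 - Real.exp (-v)) ≤ (v - u) * u * v :=
      mul_le_mul_of_nonneg_left h3 (mul_nonneg hd hu.le)
    nlinarith
  rw [← sub_nonneg]
  have : v + (1 - Real.exp (-v)) / v - (u + (1 - Real.exp (-u)) / u) =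
      (u * v * (v - u) - (v * (1 - Real.exp (-u)) - u * (1 - Real.exp (-v)))) / (u * v) := by
    field_simp
    ring
  rw [this]
  exact div_nonneg (by linarith) (mul_pos hu hv).le

/-- With u = y/ℓ the ratio of `varBound` to y is u + (1 − e^(−u))/u, which is increasing, so the
worst case is y = T. -/
theorem varBound_le {ℓ T y : ℝ} (hℓ : 0 < ℓ) (hy : 0 ≤ y) (hyT : y ≤ T) :
    varBound ℓ y ≤ (ℓ / T * (1 - Real.exp (-(T / ℓ))) + T / ℓ) * y := by
  rcases hy.eq_or_lt with rfl | hy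
  · simp [varBound, expSat]
  have hT : 0 < T := hy.trans_le hyT
  have h := add_one_sub_exp_neg_div_mono (div_pos hy hℓ) (div_le_div_of_nonneg_right hyT hℓ.le)
  have e1 : varBound ℓ y = y * (y / ℓ + (1 - Real.exp (-(y / ℓ))) / (y / ℓ)) := by
    unfold varBound expSat; field_simp
  have e2 : (ℓ / T * (1 - Real.exp (-(T / ℓ))) + T / ℓ) * y =
      y * (T / ℓ + (1 - Real.exp (-(T / ℓ))) / (T / ℓ)) := by
    field_simp; ring
  rw [e1, e2]
  exact mul_le_mul_of_nonneg_left h hy.le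

/-! ### The square of a single contribution -/

/-- The function `varBound` is made for this. When tp = ℓ, its quadratic part reproduces f²/p² and
the cross term, and its `expSat` part gives at least d t². When p = 1, the first two terms on the
right are already f² + 2fdt, and the `expSat` part covers d t² because t ≤ ℓ. -/
theorem sq_contribution_le {ℓ p t f d : ℝ} (hℓ : 0 < ℓ) (hp : 0 < p) (hp1 : p ≤ 1) (ht : 0 ≤ t)
    (hpt : p = 1 ∧ t ≤ ℓ ∨ t * p = ℓ) (hf : 0 ≤ f) (hd : d = 0 ∨ d = 1) :
    (f / p + d * t) ^ 2 ≤ f ^ 2 / p + 2 * f * d * t +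
      (varBound ℓ f / p + (2 * f / ℓ + Real.exp (-(f / ℓ))) * d * t) * t := by
  have hE1 : Real.exp (-(f / ℓ)) ≤ 1 := by
    rw [Real.exp_le_one_iff, neg_nonpos]; positivity
  have hE0 := Real.exp_pos (-(f / ℓ))
  unfold varBound expSat
  set E := Real.exp (-(f / ℓ))
  rcases hpt with ⟨rfl, htℓ⟩ | hpt
  · have h1 : 0 ≤ f ^ 2 / ℓ * t := by positivity
    have h2 : 0 ≤ ℓ * (1 - E) * t := mul_nonneg (mul_nonneg hℓ.le (by linarith)) ht
    have h3 : 0 ≤ f / ℓ * t * t := by positivity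
    have h4 : 0 ≤ (1 - E) * t * (ℓ - t) :=
      mul_nonneg (mul_nonneg (by linarith) ht) (by linarith)
    have e3 : 2 * f / ℓ = 2 * (f / ℓ) := by ring
    rw [e3]
    simp only [div_one]
    rcases hd with rfl | rfl
    · nlinarith
    · nlinarith
  · have htp : t = ℓ / p := by rw [← hpt]; field_simp
    have h1 : 0 ≤ (1 - E) * t ^ 2 := mul_nonneg (by linarith) (sq_nonneg t)
    have hid : (f ^ 2 / ℓ + ℓ * (1 - E)) / p * t + 2 * f / ℓ * d * t * t =
        f ^ 2 / p ^ 2 + (1 - E) * t ^ 2 + 2 * f * d * t / p := by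
      rw [htp]; field_simp
    have h2 : 0 ≤ f ^ 2 / p := by positivity
    have hsq : (f / p + d * t) ^ 2 = f ^ 2 / p ^ 2 + 2 * f * d * t / p + d ^ 2 * t ^ 2 := by
      field_simp; ring
    have h3 : 0 ≤ f * t := mul_nonneg hf ht
    have hd2 : d ^ 2 = d := by rcases hd with rfl | rfl <;> norm_num
    have hd0 : 0 ≤ d := by rcases hd with rfl | rfl <;> norm_num
    have hd1 : d ≤ 1 := by rcases hd with rfl | rfl <;> norm_num
    have h4 : 0 ≤ 2 * f * d * t := by positivity
    have h5 : 0 ≤ (1 - d) * ((1 - E) * t ^ 2) := mul_nonneg (by linarith) h1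
    rw [hsq, hd2]
    nlinarith

/-- `expSat` solves g + ℓg' = ℓ, so its estimate equals t when tp = ℓ; in general ℓ/p ≥ t and the
right side is a convex combination of ℓ/p and t. -/
theorem le_expSat_contribution {ℓ p t c : ℝ} (hp : 0 < p) (hpt : t * p ≤ ℓ) (hℓ : 0 < ℓ)
    (hc : 0 ≤ c) : t ≤ expSat ℓ c / p + Real.exp (-(c / ℓ)) * t := by
  have hE1 : Real.exp (-(c / ℓ)) ≤ 1 := by
    rw [Real.exp_le_one_iff, neg_nonpos]; positivity
  unfold expSat
  set E := Real.exp (-(c / ℓ))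
  have : t ≤ ℓ / p := (le_div_iff₀ hp).2 hpt
  have e : ℓ * (1 - E) / p = (1 - E) * (ℓ / p) := by ring
  rw [e]
  nlinarith

/-! ### Pathwise bound for squared contributions. -/

section Pathwise

variable {𝒳 : Type*} [DecidableEq 𝒳]

/-- A description common to both regimes, with p = min{1, ℓτ} and t = 1/τ, so that later estimates
need not mention the relaxed process. The alternative t = 0 is τ = ∞, when the cache need not be
full. -/
theorem Coupled.exists_params {k : ℕ} {ℓ W : ℝ} (hℓ : 0 < ℓ) {A : Finset 𝒳}
    {ρ : RandCall 𝒳 → UnitOpen} {st : State 𝒳} {s : RelaxedState 𝒳} (h : Coupled k ℓ A ρ st s)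
    (hs : s.Bounded ℓ W) :
    st.keys ⊆ A ∧ (∀ x ∈ st.keys, 0 < st.count x) ∧ ∃ p t : ℝ, 0 < p ∧ p ≤ 1 ∧ 0 ≤ t ∧
      (p = 1 ∧ t ≤ ℓ ∨ t * p = ℓ) ∧ (t = 0 ∨ st.keys.card = k) ∧
      ∀ g g' x, sampleEst g g' ℓ st x =
        if x ∈ st.keys then g (st.count x) / p + g' (st.count x) * t else 0 := by
  cases h with
  | above hlevel hτ hkeys hcount hle hcard =>
    have hA : st.keys ⊆ A := by rw [hkeys]; exact Finset.filter_subset _ _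
    refine ⟨hA, fun x hx => ?_, 1, s.level, one_pos, le_rfl, hs.level_nonneg,
      Or.inl ⟨rfl, hlevel.le⟩, ?_, fun g g' x => ?_⟩
    · rw [hcount x (hA hx)]
      rw [hkeys] at hx
      exact (mem_cached.1 hx).2
    · rcases hs.level_nonneg.eq_or_lt with h0 | h0
      · exact Or.inl h0.symm
      · exact Or.inr (hcard h0)
    · unfold sampleEst
      simp only [hτ, min_one_ofReal_mul_inv hℓ hlevel, inv_inv,
        ENNReal.toReal_ofReal hs.level_nonneg, ENNReal.toReal_one]
  | below hlevel y hy hτ hkeys hcount hcard =>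
    have h0 := hashOf_pos ρ y
    have h1 := hashOf_lt_one ρ y
    refine ⟨by rw [hkeys]; exact (Finset.filter_subset _ _).trans (Finset.filter_subset _ _),
      fun x hx => ?_, hashOf ρ y, ℓ / hashOf ρ y, h0, h1.le, by positivity,
      Or.inr (div_mul_cancel₀ _ h0.ne'), Or.inr hcard, fun g g' x => ?_⟩
    · rw [hcount x hx]
      rw [hkeys, Finset.mem_filter] at hx
      exact (mem_cached.1 hx.1).2
    · have hinv : ((ENNReal.ofReal (hashOf ρ y / ℓ))⁻¹).toReal = ℓ / hashOf ρ y := by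
        rw [ENNReal.toReal_inv, ENNReal.toReal_ofReal (div_nonneg h0.le hℓ.le), inv_div]
      unfold sampleEst
      simp only [hτ, min_one_ofReal_mul_hash hℓ h0 h1, hinv]

/-- The random factor t in `sq_contribution_le` is exchanged for an average of estimates of other
keys, leaving products over two distinct keys whose means are known. -/
theorem Coupled.sq_sampleEst_le {k : ℕ} (hk : 2 ≤ k) {ℓ T W : ℝ} (hℓ : 0 < ℓ) (hT : 0 < T)
    {A : Finset 𝒳} {ρ : RandCall 𝒳 → UnitOpen} {st : State 𝒳} {s : RelaxedState 𝒳}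
    (h : Coupled k ℓ A ρ st s) (hs : s.Bounded ℓ W) (x : 𝒳) :
    sampleEst (cap T) (capDeriv T) ℓ st x ^ 2 ≤
      sampleEst (fun c => cap T c ^ 2) (fun c => 2 * cap T c * capDeriv T c) ℓ st x +
      ∑ y ∈ A.erase x, sampleEst (fun c => varBound ℓ (cap T c))
          (fun c => (2 * cap T c / ℓ + Real.exp (-(cap T c / ℓ))) * capDeriv T c) ℓ st x *
        sampleEst (expSat ℓ) (fun c => Real.exp (-(c / ℓ))) ℓ st y / ((k : ℝ) - 1) := by
  obtain ⟨hA, hpos, p, t, hp, hp1, ht, hpt, hcard, hest⟩ := h.exists_params hℓ hs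
  simp only [hest]
  by_cases hx : x ∈ st.keys
  swap
  · simp [hx]
  simp only [hx, if_true]
  have hk1 : (0 : ℝ) < k - 1 := by
    have : (2 : ℝ) ≤ k := by exact_mod_cast hk
    linarith
  have htp : t * p ≤ ℓ := by
    rcases hpt with ⟨rfl, h⟩ | h
    · simpa using h
    · exact h.le
  set f := cap T (st.count x) with hf
  set d := capDeriv T (st.count x) with hd
  have hf0 : 0 ≤ f := cap_nonneg hT.le (hpos x hx).le
  have hd01 : d = 0 ∨ d = 1 := by rw [hd, capDeriv]; split_ifs <;> simp
  have hd0 : 0 ≤ d := by rcases hd01 with h | h <;> rw [h] <;> norm_num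
  set V := varBound ℓ f / p + (2 * f / ℓ + Real.exp (-(f / ℓ))) * d * t with hV
  have hV0 : 0 ≤ V := by
    have h1 := expSat_nonneg hℓ hf0
    have h2 := Real.exp_pos (-(f / ℓ))
    have h3 : 0 ≤ varBound ℓ f := add_nonneg (by positivity) h1
    positivity
  -- With `x` set aside, a full cache has k − 1 other keys, each contributing at least t.
  have hsum : ((k : ℝ) - 1) * t ≤ ∑ y ∈ A.erase x, if y ∈ st.keys then
      expSat ℓ (st.count y) / p + Real.exp (-(st.count y / ℓ)) * t else 0 := by
    rcases hcard with h0 | hcard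
    · subst h0
      rw [mul_zero]
      refine Finset.sum_nonneg fun y _ => ?_
      split_ifs with hy
      · have := expSat_nonneg hℓ (hpos y hy).le
        positivity
      · exact le_rfl
    · rw [← Finset.sum_filter]
      have hfil : (A.erase x).filter (fun y => y ∈ st.keys) = st.keys.erase x := by
        ext y
        simp only [Finset.mem_filter, Finset.mem_erase]
        exact ⟨fun h => ⟨h.1.1, h.2⟩, fun h => ⟨⟨h.1, hA h.2⟩, h.2⟩⟩
      have hc : ((st.keys.erase x).card : ℝ) = k - 1 := by
        rw [Finset.card_erase_of_mem hx, hcard, Nat.cast_sub (by omega), Nat.cast_one]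
      rw [hfil, ← hc, ← nsmul_eq_mul]
      exact Finset.card_nsmul_le_sum _ _ _ fun y hy =>
        le_expSat_contribution hp htp hℓ (hpos y (Finset.mem_of_mem_erase hy)).le
  have hfin : V * t ≤ ∑ y ∈ A.erase x, V * (if y ∈ st.keys then
      expSat ℓ (st.count y) / p + Real.exp (-(st.count y / ℓ)) * t else 0) / ((k : ℝ) - 1) := by
    rw [← Finset.sum_div, ← Finset.mul_sum, le_div_iff₀ hk1]
    calc V * t * (k - 1) = V * ((k - 1) * t) := by ring
      _ ≤ _ := mul_le_mul_of_nonneg_left hsum hV0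
  exact (sq_contribution_le hℓ hp hp1 ht hpt hf0 hd01).trans (by gcongr)

end Pathwise

/-! ### Mean and variance of the estimator. -/

section Variance

variable {𝒳 : Type*} [DecidableEq 𝒳]
variable {Ω : Type*} [MeasurableSpace Ω] {P : Measure Ω} [IsProbabilityMeasure P]
variable {U : RandCall 𝒳 → Ω → ℝ}

theorem integral_sampleEst (hU_meas : ∀ c, Measurable (U c))
    (hU_unif : ∀ c, pdf.IsUniform (U c) (Set.Icc (0 : ℝ) 1) P) (hU_indep : iIndepFun U P)
    {k : ℕ} (hk : 2 ≤ k) {ℓ : ℝ} (hℓ : 0 < ℓ) {A : Finset 𝒳} {l : List (𝒳 × ℝ)}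
    (hl : ∀ e ∈ l, 0 < e.2) (hlA : ∀ e ∈ l, e.1 ∈ A) {g g' : ℝ → ℝ} (hg : IsTest g g') {x : 𝒳}
    (hx : x ∈ A) :
    Integrable (fun ω => sampleEst g g' ℓ (sample k ℓ l fun c => U c ω) x) P ∧
    ∫ ω, sampleEst g g' ℓ (sample k ℓ l fun c => U c ω) x ∂P = g (keyWeight l x) := by
  simpa using integral_prod_sampleEst hU_meas hU_unif hU_indep k hℓ
    (Finset.singleton_subset_iff.2 hx) (by simp; omega) l hl hlA (fun _ => g) (fun _ => g')
    fun _ _ => hg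

theorem integral_sampleEst_mul (hU_meas : ∀ c, Measurable (U c))
    (hU_unif : ∀ c, pdf.IsUniform (U c) (Set.Icc (0 : ℝ) 1) P) (hU_indep : iIndepFun U P)
    {k : ℕ} (hk : 2 ≤ k) {ℓ : ℝ} (hℓ : 0 < ℓ) {A : Finset 𝒳} {l : List (𝒳 × ℝ)}
    (hl : ∀ e ∈ l, 0 < e.2) (hlA : ∀ e ∈ l, e.1 ∈ A) {g g' h h' : ℝ → ℝ} (hg : IsTest g g')
    (hh : IsTest h h') {x y : 𝒳} (hx : x ∈ A) (hy : y ∈ A) (hxy : x ≠ y) :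
    Integrable (fun ω => sampleEst g g' ℓ (sample k ℓ l fun c => U c ω) x *
      sampleEst h h' ℓ (sample k ℓ l fun c => U c ω) y) P ∧
    ∫ ω, sampleEst g g' ℓ (sample k ℓ l fun c => U c ω) x *
      sampleEst h h' ℓ (sample k ℓ l fun c => U c ω) y ∂P =
        g (keyWeight l x) * h (keyWeight l y) := by
  have := integral_prod_sampleEst hU_meas hU_unif hU_indep k hℓ (A := A) (B := {x, y})
    (by intro z hz; rcases Finset.mem_insert.1 hz with rfl | hz
        · exact hx
        · rw [Finset.mem_singleton.1 hz]; exact hy)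
    (by rw [Finset.card_pair hxy]; exact hk) l hl hlA (fun z => if z = x then g else h)
    (fun z => if z = x then g' else h') (fun z _ => by split_ifs <;> assumption)
  simpa [Finset.prod_pair hxy, hxy.symm] using this

/-- Second moments of the contributions to the estimator of a frequency cap statistic. -/
theorem integral_sq_sampleEst_le (hU_meas : ∀ c, Measurable (U c))
    (hU_unif : ∀ c, pdf.IsUniform (U c) (Set.Icc (0 : ℝ) 1) P) (hU_indep : iIndepFun U P)
    {k : ℕ} (hk : 2 ≤ k) {ℓ T : ℝ} (hℓ : 0 < ℓ) (hT : 0 < T) {A : Finset 𝒳} {l : List (𝒳 × ℝ)}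
    (hl : ∀ e ∈ l, 0 < e.2) (hlA : ∀ e ∈ l, e.1 ∈ A) {x : 𝒳} (hx : x ∈ A) :
    Integrable (fun ω =>
      sampleEst (cap T) (capDeriv T) ℓ (sample k ℓ l fun c => U c ω) x ^ 2) P ∧
    ∫ ω, sampleEst (cap T) (capDeriv T) ℓ (sample k ℓ l fun c => U c ω) x ^ 2 ∂P ≤
      cap T (keyWeight l x) ^ 2 + ∑ y ∈ A.erase x,
        varBound ℓ (cap T (keyWeight l x)) * expSat ℓ (keyWeight l y) / ((k : ℝ) - 1) := by
  obtain ⟨W, hW⟩ := relaxed_bounded k hℓ A l hl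
  obtain ⟨h1, h1'⟩ := integral_sampleEst hU_meas hU_unif hU_indep hk hℓ hl hlA
    (isTest_cap_sq hT) hx
  have h2 := fun y (hy : y ∈ A.erase x) => integral_sampleEst_mul hU_meas hU_unif hU_indep hk hℓ
    hl hlA (isTest_varBound_cap hℓ hT) (isTest_expSat hℓ) hx (Finset.mem_of_mem_erase hy)
    (Finset.ne_of_mem_erase hy).symm
  have h3 := h1.add (integrable_finsetSum (A.erase x)
    fun y hy => (h2 y hy).1.div_const ((k : ℝ) - 1))
  have hle : ∀ᵐ ω ∂P, _ ≤ _ :=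
    (ae_coupled_sample hU_meas hU_unif hU_indep k hℓ A l hl hlA).mono
      fun ω hc => hc.sq_sampleEst_le hk hℓ hT (hW _) x
  have hm := (integral_sampleEst hU_meas hU_unif hU_indep hk hℓ hl hlA (isTest_cap hT) hx).1
  have hint : Integrable (fun ω =>
      sampleEst (cap T) (capDeriv T) ℓ (sample k ℓ l fun c => U c ω) x ^ 2) P := by
    refine h3.mono' (hm.aestronglyMeasurable.pow 2) (hle.mono fun ω h => ?_)
    rw [Real.norm_eq_abs, abs_of_nonneg (sq_nonneg _)]
    exact h
  refine ⟨hint, (integral_mono_ae hint h3 hle).trans_eq ?_⟩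
  simp only [Pi.add_apply]
  rw [integral_add h1 (integrable_finsetSum _
    fun y hy => (h2 y hy).1.div_const ((k : ℝ) - 1)), h1',
    integral_finsetSum _ fun y hy => (h2 y hy).1.div_const ((k : ℝ) - 1)]
  congr 1
  refine Finset.sum_congr rfl fun y hy => ?_
  rw [integral_div, (h2 y hy).2]

/-- Distinct contributions are uncorrelated, so only the diagonal of the double sum survives, and
there the squared mean cancels against the leading term of the second moment. -/
theorem variance_sum_sampleEst_le (hU_meas : ∀ c, Measurable (U c))
    (hU_unif : ∀ c, pdf.IsUniform (U c) (Set.Icc (0 : ℝ) 1) P) (hU_indep : iIndepFun U P)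
    {k : ℕ} (hk : 2 ≤ k) {ℓ T : ℝ} (hℓ : 0 < ℓ) (hT : 0 < T) {A F : Finset 𝒳} (hFA : F ⊆ A)
    {l : List (𝒳 × ℝ)} (hl : ∀ e ∈ l, 0 < e.2) (hlA : ∀ e ∈ l, e.1 ∈ A) {X : Ω → ℝ}
    (hX : X =ᵐ[P] fun ω =>
      ∑ x ∈ F, sampleEst (cap T) (capDeriv T) ℓ (sample k ℓ l fun c => U c ω) x) :
    MemLp X 2 P ∧ ∫ ω, X ω ∂P = ∑ x ∈ F, cap T (keyWeight l x) ∧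
    variance X P ≤ ∑ x ∈ F, ∑ y ∈ A.erase x,
      varBound ℓ (cap T (keyWeight l x)) * expSat ℓ (keyWeight l y) / ((k : ℝ) - 1) := by
  set a : 𝒳 → Ω → ℝ := fun x ω =>
    sampleEst (cap T) (capDeriv T) ℓ (sample k ℓ l fun c => U c ω) x with ha
  have h1 : ∀ x ∈ F, Integrable (a x) P ∧ ∫ ω, a x ω ∂P = cap T (keyWeight l x) := fun x hx =>
    integral_sampleEst hU_meas hU_unif hU_indep hk hℓ hl hlA (isTest_cap hT) (hFA hx)
  have h2 : ∀ x ∈ F, ∀ y ∈ F, x ≠ y → Integrable (fun ω => a x ω * a y ω) P ∧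
      ∫ ω, a x ω * a y ω ∂P = cap T (keyWeight l x) * cap T (keyWeight l y) :=
    fun x hx y hy hxy => integral_sampleEst_mul hU_meas hU_unif hU_indep hk hℓ hl hlA
      (isTest_cap hT) (isTest_cap hT) (hFA hx) (hFA hy) hxy
  have h3 : ∀ x ∈ F, Integrable (fun ω => a x ω ^ 2) P ∧ ∫ ω, a x ω ^ 2 ∂P ≤
      cap T (keyWeight l x) ^ 2 + ∑ y ∈ A.erase x,
        varBound ℓ (cap T (keyWeight l x)) * expSat ℓ (keyWeight l y) / ((k : ℝ) - 1) :=
    fun x hx => integral_sq_sampleEst_le hU_meas hU_unif hU_indep hk hℓ hT hl hlA (hFA hx)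
  have h4 : ∀ x ∈ F, ∀ y ∈ F, Integrable (fun ω => a x ω * a y ω) P := by
    intro x hx y hy
    by_cases hxy : x = y
    · subst hxy
      simpa only [sq] using (h3 x hx).1
    · exact (h2 x hx y hy hxy).1
  have hLp : MemLp X 2 P := by
    refine MemLp.ae_eq hX.symm (memLp_finsetSum F fun x hx => ?_)
    exact (memLp_two_iff_integrable_sq (h1 x hx).1.aestronglyMeasurable).2 (h3 x hx).1
  have hmean : ∫ ω, X ω ∂P = ∑ x ∈ F, cap T (keyWeight l x) := by
    rw [integral_congr_ae hX, integral_finsetSum F fun x hx => (h1 x hx).1]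
    exact Finset.sum_congr rfl fun x hx => (h1 x hx).2
  refine ⟨hLp, hmean, ?_⟩
  rw [variance_eq_sub hLp, hmean]
  have hsq : ∫ ω, (X ^ 2) ω ∂P = ∑ x ∈ F, ∑ y ∈ F, ∫ ω, a x ω * a y ω ∂P := by
    have : (fun ω => (X ^ 2) ω) =ᵐ[P] fun ω => ∑ x ∈ F, ∑ y ∈ F, a x ω * a y ω := by
      filter_upwards [hX] with ω hω
      rw [Pi.pow_apply, hω, sq, Finset.sum_mul_sum]
    rw [integral_congr_ae this, integral_finsetSum F fun x hx =>
      integrable_finsetSum F fun y hy => h4 x hx y hy]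
    exact Finset.sum_congr rfl fun x hx => integral_finsetSum F fun y hy => h4 x hx y hy
  rw [hsq, sq, Finset.sum_mul_sum, ← Finset.sum_sub_distrib]
  refine Finset.sum_le_sum fun x hx => ?_
  rw [← Finset.sum_sub_distrib, Finset.sum_eq_single_of_mem x hx]
  · have := (h3 x hx).2
    simp only [sq] at this
    linarith
  · intro y hy hyx
    rw [(h2 x hx y hy hyx.symm).2, sub_self]

theorem keyWeight_pos {l : List (𝒳 × ℝ)} (hl : ∀ e ∈ l, 0 < e.2) {x : 𝒳}
    (hx : x ∈ activeKeys l) : 0 < keyWeight l x := by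
  obtain ⟨e, he, rfl⟩ := List.mem_map.1 (List.mem_toFinset.1 hx)
  refine List.sum_pos _ (fun c hc => ?_) ?_
  · obtain ⟨e', he', rfl⟩ := List.mem_map.1 hc
    exact hl e' (List.mem_filter.1 he').1
  · intro hnil
    have : e ∈ l.filter fun e' => e'.1 = e.1 := List.mem_filter.2 ⟨he, by simp⟩
    rw [List.map_eq_nil_iff.1 hnil] at this
    exact absurd this List.not_mem_nil

open Classical in
theorem estimator_eq_sum_sampleEst {T ℓ : ℝ} {A : Finset 𝒳} (H : Set 𝒳) {st : State 𝒳}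
    (hA : st.keys ⊆ A) :
    estimator (cap T) ℓ H st =
      ∑ x ∈ A.filter (· ∈ H), sampleEst (cap T) (capDeriv T) ℓ st x := by
  unfold estimator sampleEst
  rw [← Finset.sum_filter]
  have : (A.filter (· ∈ H)).filter (· ∈ st.keys) = st.keys.filter (· ∈ H) := by
    ext x
    simp only [Finset.mem_filter]
    exact ⟨fun h => ⟨h.2, h.1.2⟩, fun h => ⟨⟨hA h.1, h.2⟩, h.1⟩⟩
  rw [this]
  exact Finset.sum_congr rfl fun x _ => by rw [beta, deriv_cap]

end Variance

/-! ### Numerical bounds -/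

theorem one_le_exp_div : 1 ≤ Real.exp 1 / (Real.exp 1 - 1) := by
  have := Real.exp_one_gt_d9
  rw [le_div_iff₀ (by linarith)]
  linarith

theorem cv_factor_le {ℓ T : ℝ} (hℓ : 0 < ℓ) (hT : 0 < T) :
    max 1 (ℓ / T) * (ℓ / T * (1 - Real.exp (-(T / ℓ))) + T / ℓ) ≤ 1 + max (ℓ / T) (T / ℓ) := by
  set u := T / ℓ with hu
  have hu0 : 0 < u := div_pos hT hℓ
  have hinv : ℓ / T = 1 / u := by rw [hu, one_div_div]
  rw [hinv]
  have h1 := one_sub_exp_neg_le u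
  have h2 : 1 / u * (1 - Real.exp (-u)) ≤ 1 := by
    rw [one_div, inv_mul_le_iff₀ hu0, mul_one]; exact h1
  rcases le_total 1 u with h | h
  · have h3 : 1 / u ≤ 1 := (div_le_one hu0).2 h
    rw [max_eq_left h3, one_mul]
    have := le_max_right (1 / u) u
    linarith
  · have h3 : 1 ≤ 1 / u := (le_div_iff₀ hu0).2 (by linarith)
    rw [max_eq_right h3]
    have := le_max_left (1 / u) u
    have h4 : 1 / u * (1 / u * (1 - Real.exp (-u))) ≤ 1 / u * 1 :=
      mul_le_mul_of_nonneg_left h2 (by positivity)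
    have h5 : 1 / u * u = 1 := by field_simp
    rw [mul_add, h5]
    linarith

theorem abs_sqrt_sub_lt : |√((2 * Real.exp 1 - 1) / (Real.exp 1 - 1)) - 1.6| < 0.01 := by
  have h1 := Real.exp_one_gt_d9
  have h2 := Real.exp_one_lt_d9
  have hpos : 0 < Real.exp 1 - 1 := by linarith
  rw [abs_lt]
  constructor
  -- The quotient is 2 + 1/(e − 1) ≈ 2.582, between 1.59² = 2.5281 and 1.61² = 2.5921.
  · have : (1.59 : ℝ) < √((2 * Real.exp 1 - 1) / (Real.exp 1 - 1)) := by
      refine Real.lt_sqrt_of_sq_lt ?_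
      rw [lt_div_iff₀ hpos]
      linarith
    linarith
  · have : √((2 * Real.exp 1 - 1) / (Real.exp 1 - 1)) < 1.61 := by
      rw [Real.sqrt_lt' (by norm_num), div_lt_iff₀ hpos]
      linarith
    linarith

theorem cv_bound_of_eq {ℓ : ℝ} (hℓ : 0 < ℓ) (c : ℝ) :
    Real.exp 1 / (Real.exp 1 - 1) * max 1 (ℓ / ℓ) *
      (ℓ / ℓ * (1 - Real.exp (-(ℓ / ℓ))) + ℓ / ℓ) / c =
    (2 * Real.exp 1 - 1) / (Real.exp 1 - 1) * (1 / c) := by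
  have h1 := Real.exp_one_gt_d9
  have hne : Real.exp 1 - 1 ≠ 0 := by linarith
  have h0 := (Real.exp_pos 1).ne'
  rw [div_self hℓ.ne', max_self, Real.exp_neg]
  field_simp
  ring

end ContSH

theorem mainTheorem2 {𝒳 : Type*} [DecidableEq 𝒳]
    {Ω : Type*} [MeasurableSpace Ω] (P : Measure Ω) [IsProbabilityMeasure P]
    -- independent random numbers, each uniform on `[0, 1]`
    (U : ContSH.RandCall 𝒳 → Ω → ℝ)
    (hU_meas : ∀ c, Measurable (U c))
    (hU_unif : ∀ c, pdf.IsUniform (U c) (Set.Icc (0 : ℝ) 1) P)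
    (hU_indep : iIndepFun U P)
    -- a stream of elements with positive weights
    (stream : List (𝒳 × ℝ)) (hstream : ∀ e ∈ stream, 0 < e.2)
    (k : ℕ) (hk : 2 ≤ k) (ℓ T : ℝ) (hℓ : 0 < ℓ) (hT : 0 < T)
    -- a segment that contains at least one active key
    (H : Set 𝒳) (hH : ∃ x ∈ ContSH.activeKeys stream, x ∈ H)
    (q : ℝ) (hq : q = ContSH.proportion stream (ContSH.cap T) H)
    (est : Ω → ℝ)
    (hest : ∀ ω, est ω =
      ContSH.estimator (ContSH.cap T) ℓ H (ContSH.sample k ℓ stream (fun c => U c ω))) :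
    0 < q ∧
    MemLp est 2 P ∧
    ∫ ω, est ω ∂P = ContSH.freqStat stream (ContSH.cap T) H ∧
    ContSH.cv P est ≤
      √(Real.exp 1 / (Real.exp 1 - 1) * max 1 (ℓ / T) *
          (ℓ / T * (1 - Real.exp (-(T / ℓ))) + T / ℓ) / (q * ((k : ℝ) - 1))) ∧
    √(Real.exp 1 / (Real.exp 1 - 1) * max 1 (ℓ / T) *
          (ℓ / T * (1 - Real.exp (-(T / ℓ))) + T / ℓ) / (q * ((k : ℝ) - 1))) ≤
      √(Real.exp 1 / (Real.exp 1 - 1) * (1 + max (ℓ / T) (T / ℓ)) / (q * ((k : ℝ) - 1))) ∧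
    (ℓ = T →
      ContSH.cv P est ≤
        √((2 * Real.exp 1 - 1) / (Real.exp 1 - 1) * (1 / (q * ((k : ℝ) - 1))))) ∧
    |√((2 * Real.exp 1 - 1) / (Real.exp 1 - 1)) - 1.6| < 0.01 := by
  classical
  have hk1 : (0 : ℝ) < k - 1 := by
    have : (2 : ℝ) ≤ k := by exact_mod_cast hk
    linarith
  set A := ContSH.activeKeys stream with hA
  set F := A.filter (· ∈ H) with hF
  have hlA : ∀ e ∈ stream, e.1 ∈ A := fun e he =>
    List.mem_toFinset.2 (List.mem_map.2 ⟨e, he, rfl⟩)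
  have hFA : F ⊆ A := Finset.filter_subset _ _
  set w := ContSH.keyWeight stream with hw
  have hwpos : ∀ x ∈ A, 0 < w x := fun x hx => ContSH.keyWeight_pos hstream hx
  have hcap : ∀ x ∈ A, 0 < ContSH.cap T (w x) := fun x hx => lt_min (hwpos x hx) hT
  have hstatH : ContSH.freqStat stream (ContSH.cap T) H = ∑ x ∈ F, ContSH.cap T (w x) := rfl
  have hstat : ContSH.freqStat stream (ContSH.cap T) Set.univ = ∑ x ∈ A, ContSH.cap T (w x) := by
    simp [ContSH.freqStat, hA, hw]
  set QH := ∑ x ∈ F, ContSH.cap T (w x) with hQH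
  set Q := ∑ x ∈ A, ContSH.cap T (w x) with hQ
  obtain ⟨x₀, hx₀A, hx₀H⟩ := hH
  have hQHpos : 0 < QH := Finset.sum_pos (fun x hx => hcap x (hFA hx))
    ⟨x₀, Finset.mem_filter.2 ⟨hx₀A, hx₀H⟩⟩
  have hQpos : 0 < Q := Finset.sum_pos hcap ⟨x₀, hx₀A⟩
  have hqQ : q = QH / Q := by rw [hq, ContSH.proportion, hstatH, hstat]
  have hqpos : 0 < q := hqQ ▸ div_pos hQHpos hQpos
  obtain ⟨W, hW⟩ := ContSH.relaxed_bounded k hℓ A stream hstream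
  have hX : est =ᵐ[P] fun ω => ∑ x ∈ F, ContSH.sampleEst (ContSH.cap T) (ContSH.capDeriv T) ℓ
      (ContSH.sample k ℓ stream fun c => U c ω) x := by
    filter_upwards [ContSH.ae_coupled_sample hU_meas hU_unif hU_indep k hℓ A stream hstream hlA]
      with ω hω
    rw [hest ω]
    exact ContSH.estimator_eq_sum_sampleEst H (hω.exists_params hℓ (hW _)).1
  obtain ⟨hLp, hmean, hvar⟩ := ContSH.variance_sum_sampleEst_le hU_meas hU_unif hU_indep hk hℓ hT
    hFA hstream hlA hX
  set C := ℓ / T * (1 - Real.exp (-(T / ℓ))) + T / ℓ with hC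
  set M := max 1 (ℓ / T) with hM
  have hM0 : 0 ≤ M := zero_le_one.trans (le_max_left _ _)
  have hC0 : 0 ≤ C := by
    have : Real.exp (-(T / ℓ)) ≤ 1 := by
      rw [Real.exp_le_one_iff, neg_nonpos]; positivity
    have : 0 ≤ 1 - Real.exp (-(T / ℓ)) := by linarith
    positivity
  have hvar' : variance est P ≤ C * QH * (M * Q) / (k - 1) := by
    refine hvar.trans ?_
    rw [hQH, hQ, Finset.mul_sum, Finset.mul_sum, Finset.sum_mul_sum, Finset.sum_div]
    refine Finset.sum_le_sum fun x hx => ?_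
    rw [Finset.sum_div]
    have hcx := hcap x (hFA hx)
    have hterm : ∀ y ∈ A, ContSH.varBound ℓ (ContSH.cap T (w x)) * ContSH.expSat ℓ (w y) /
        ((k : ℝ) - 1) ≤ C * ContSH.cap T (w x) * (M * ContSH.cap T (w y)) / (k - 1) := by
      intro y hy
      refine div_le_div_of_nonneg_right (mul_le_mul ?_ ?_ ?_ (mul_nonneg hC0 hcx.le)) hk1.le
      · exact ContSH.varBound_le hℓ hcx.le (ContSH.cap_le_right _ _)
      · exact ContSH.expSat_le hℓ hT (hwpos y hy).le
      · exact ContSH.expSat_nonneg hℓ (hwpos y hy).le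
    refine (Finset.sum_le_sum fun y hy => hterm y (Finset.mem_of_mem_erase hy)).trans ?_
    -- The term y = x is added back so that the inner sum becomes the full statistic.
    refine Finset.sum_le_sum_of_subset_of_nonneg (Finset.erase_subset _ _) fun y hy _ => ?_
    have := hcap y hy
    positivity
  have hqk : 0 < q * ((k : ℝ) - 1) := mul_pos hqpos hk1
  have hcv : ContSH.cv P est ≤
      √(Real.exp 1 / (Real.exp 1 - 1) * M * C / (q * ((k : ℝ) - 1))) := by
    rw [ContSH.cv, hmean, ← hQH, div_le_iff₀ hQHpos]
    calc √(variance est P) ≤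
        √(Real.exp 1 / (Real.exp 1 - 1) * M * C / (q * ((k : ℝ) - 1)) * QH ^ 2) := by
          refine Real.sqrt_le_sqrt (hvar'.trans ?_)
          -- Dividing by the squared mean turns Q/QH into 1/q; the factor e/(e − 1) is then inserted
          -- for free.
          have h1 : C * QH * (M * Q) / (k - 1) =
              1 * (M * C / (q * ((k : ℝ) - 1)) * QH ^ 2) := by
            rw [hqQ]; field_simp
          have h2 : Real.exp 1 / (Real.exp 1 - 1) * M * C / (q * ((k : ℝ) - 1)) * QH ^ 2 =
              Real.exp 1 / (Real.exp 1 - 1) * (M * C / (q * ((k : ℝ) - 1)) * QH ^ 2) := by ring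
          rw [h1, h2]
          exact mul_le_mul_of_nonneg_right ContSH.one_le_exp_div (by positivity)
      _ = _ := by rw [Real.sqrt_mul' _ (sq_nonneg _), Real.sqrt_sq hQHpos.le]
  refine ⟨hqpos, hLp, hmean, hcv, ?_, ?_, ContSH.abs_sqrt_sub_lt⟩
  · refine Real.sqrt_le_sqrt (div_le_div_of_nonneg_right ?_ hqk.le)
    rw [mul_assoc]
    exact mul_le_mul_of_nonneg_left (ContSH.cv_factor_le hℓ hT)
      (zero_le_one.trans ContSH.one_le_exp_div)
  · rintro rfl
    rw [← ContSH.cv_bound_of_eq hℓ]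
    exact hcv
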